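/- Let $N\ge 1$ and $m\ge 1$ be integers, $0<n<m$ real, $\omega=n/m$, $\gamma\in(0,1)$, $R>0$, and, if $n$ is not an integer, assume $(1-\omega)\gamma<\min(\{n\},1-\{n\})$, where $\{\cdot\}$ and $[\cdot]$ are the fractional and integer parts. Write $x=(x',x_N)\in\mathbb R^{N-1}\times\mathbb R$ and $\overline Q=\{(x,t):x\in\mathbb R^N,\ x_N\ge 0,\ t\in\mathbb R\}$. For positive nonintegers $a,b$, let $C^{a,b}_{x',t}(\mathbb R^{N-1}\times\mathbb R)$ be the space of continuous functions $v$ with finite norm $$\|v\|=\sup|v|+\sum_{i=1}^{N-1}\sup_{(x',t),\,h>0}\frac{|D_{x_i}^{[a]}v(x'+he_i,t)-D_{x_i}^{[a]}v(x',t)|}{h^{a-[a]}}+\sup_{(x',t),\,h>0}\frac{|D_t^{[b]}v(x',t+h)-D_t^{[b]}v(x',t)|}{h^{b-[b]}} .$$ For $\sigma\ge 0$ put $$|f|_{\sigma}=\sup_{\overline Q}|f|+\sup_{x\ne\overline x,\,t}\max(x_N,\overline x_N)^{\sigma}\frac{|f(x,t)-f(\overline x,t)|}{|x-\overline x|^{\gamma}}+\sup_{x,\,t\neq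 s}\frac{|f(x,t)-f(x,s)|}{|t-s|^{\gamma/m}},$$ where functions defined only for $x_N>0$ are extended continuously to $x_N=0$. For $\sigma\ge0$ let $$\|w\|_{(\sigma)}=\sup_{\overline Q}|w|+\sum_{0<|\alpha|<m-n}|D_x^\alpha w|_{\sigma}+\sum_{0\le j\le n}\ \sum_{|\alpha|=m-j}\bigl|x_N^{n-j}D_x^\alpha w\bigr|_{\omega\gamma}+|D_tw|_{\omega\gamma},$$ where, if $n$ is an integer, the term $|D_{x_N}^{m-n}w|_{\omega\gamma}$ (that is, $j=n$, $\alpha=(0,\dots,0,m-n)$) is omitted from the double sum. Let $C^{m+\gamma,\frac{m+\gamma}{m}}_{n,\omega\gamma}(\overline Q)$ be the space of continuous functions $w$ on $\overline Q$ with finite norm $\|w\|:=\|w\|_{(\omega\gamma)}$. Then there exist a linear operator $E$, defined on the functions $v\in C^{m-n+(1-\omega)\gamma,\,1+\gamma/m}_{x',t}(\mathbb R^{N-1}\times\mathbb R)$ that vanish outside $B_R=\{|x'|\le R,\ |t|\le R\}$, with values in $C^{m+\gamma,\frac{m+\gamma}{m}}_{n,\omega\gamma}(\overline Q)$, and a constant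 $C$ not depending on $v$, such that for every such $v$ the function $Ev$ has compact support in $\overline Q$, satisfies $$Ev(x',0,t)=v(x',t)\quad\text{for all }x',t,$$ and $$\|Ev\|_{C^{m+\gamma,\frac{m+\gamma}{m}}_{n,\omega\gamma}(\overline Q)}\le C\,\|v\|_{C^{m-n+(1-\omega)\gamma,\,1+\gamma/m}_{x',t}(\mathbb R^{N-1}\times\mathbb R)} .$$ If moreover $\omega\gamma\le 1-\{n\}$ (in particular if $n$ is an integer), then also $\|Ev\|_{(0)}\le C\,\|v\|_{C^{m-n+(1-\omega)\gamma,\,1+\gamma/m}_{x',t}(\mathbb R^{N-1}\times\mathbb R)}$, i.e. the derivatives of order $0<|\alpha|<m-n$ may be measured in the unweighted Hölder norm. -/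

import Mathlib

open scoped NNReal ENNReal

noncomputable section

namespace WeightedHolder

/-- Points `(x, t)` with `x` in the Euclidean space `ℝ^k` and `t ∈ ℝ`. -/
abbrev SpaceTime (k : ℕ) : Type := EuclideanSpace ℝ (Fin k) × ℝ

/-- The coordinate direction of the spatial variable `x_i`. -/
def spaceDir {k : ℕ} (i : Fin k) : SpaceTime k := (EuclideanSpace.single i 1, 0)

/-- The coordinate direction of the time variable. -/
def timeDir {k : ℕ} : SpaceTime k := (0, 1)

/-- The (partial) derivative of `f` in the direction `e`. -/
def dirDeriv {k : ℕ} (e : SpaceTime k) (f : SpaceTime k → ℝ) : SpaceTime k → ℝ :=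
  fun p => lineDeriv ℝ f p e

/-- The spatial derivative `D_x^α f = D_{x_1}^{α_1} ⋯ D_{x_k}^{α_k} f`. -/
def multiDeriv {k : ℕ} (α : Fin k → ℕ) (f : SpaceTime k → ℝ) : SpaceTime k → ℝ :=
  (List.finRange k).foldr (fun i g => (dirDeriv (spaceDir i))^[α i] g) f

/-! ### Anisotropic Hölder spaces on the whole space `ℝ^k × ℝ` -/

/-- Hölder seminorm of order `l` (a positive noninteger) in the coordinate direction `e`: the
Hölder constant along `e`, with exponent `l - [l]`, of the `[l]`-th derivative along `e`. -/
def dirSeminorm {k : ℕ} (e : SpaceTime k) (l : ℝ) (v : SpaceTime k → ℝ) : ℝ≥0∞ :=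
  ⨆ (p : SpaceTime k) (h : ℝ) (_ : 0 < h),
    ENNReal.ofReal (|((dirDeriv e)^[⌊l⌋₊] v) (p + h • e) - ((dirDeriv e)^[⌊l⌋₊] v) p|
      / h ^ (l - ⌊l⌋₊))

/-- Norm of the space `C^{a,b}_{x,t}(ℝ^k × ℝ)`. -/
def anisoNorm {k : ℕ} (a b : ℝ) (v : SpaceTime k → ℝ) : ℝ≥0∞ :=
  (⨆ p : SpaceTime k, ‖v p‖ₑ) + ∑ i : Fin k, dirSeminorm (spaceDir i) a v
    + dirSeminorm timeDir b v

/-- Membership in `C^{a,b}_{x,t}(ℝ^k × ℝ)`: continuous functions that have the pure derivatives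
entering the norm, with finite norm. -/
structure MemAniso {k : ℕ} (a b : ℝ) (v : SpaceTime k → ℝ) : Prop where
  continuous : Continuous v
  space_contDiff : ∀ (i : Fin k) (p : SpaceTime k),
    ContDiff ℝ (⌊a⌋₊ : ℕ) (fun s : ℝ => v (p + s • spaceDir i))
  time_contDiff : ∀ p : SpaceTime k,
    ContDiff ℝ (⌊b⌋₊ : ℕ) (fun s : ℝ => v (p + s • timeDir))
  norm_lt_top : anisoNorm a b v < ⊤

/-! ### Weighted Hölder spaces on the half space; the last spatial coordinate is `x_N`, `N = d+1` -/

/-- The set `Q = {x_N > 0}`. -/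
def openQ (d : ℕ) : Set (SpaceTime (d + 1)) := {p | 0 < p.1 (Fin.last d)}

/-- The set `Q̄ = {x_N ≥ 0}`. -/
def closedQ (d : ℕ) : Set (SpaceTime (d + 1)) := {p | 0 ≤ p.1 (Fin.last d)}

/-- `sup_S |f|`. -/
def supNormOn {d : ℕ} (S : Set (SpaceTime (d + 1))) (f : SpaceTime (d + 1) → ℝ) : ℝ≥0∞ :=
  ⨆ p ∈ S, ‖f p‖ₑ

/-- Hölder seminorm in `x` with exponent `γ` and weight `max(x_N, y_N)^σ` (`σ = 0`: no weight). -/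
def spaceSeminorm {d : ℕ} (S : Set (SpaceTime (d + 1))) (σ γ : ℝ)
    (f : SpaceTime (d + 1) → ℝ) : ℝ≥0∞ :=
  ⨆ (t : ℝ) (x : EuclideanSpace ℝ (Fin (d + 1))) (y : EuclideanSpace ℝ (Fin (d + 1)))
    (_ : (x, t) ∈ S) (_ : (y, t) ∈ S),
    ENNReal.ofReal (max (x (Fin.last d)) (y (Fin.last d)) ^ σ *
      (|f (x, t) - f (y, t)| / ‖x - y‖ ^ γ))

/-- Hölder seminorm in `t` with exponent `β`. -/
def timeSeminorm {d : ℕ} (S : Set (SpaceTime (d + 1))) (β : ℝ)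
    (f : SpaceTime (d + 1) → ℝ) : ℝ≥0∞ :=
  ⨆ (x : EuclideanSpace ℝ (Fin (d + 1))) (t : ℝ) (s : ℝ) (_ : (x, t) ∈ S) (_ : (x, s) ∈ S),
    ENNReal.ofReal (|f (x, t) - f (x, s)| / |t - s| ^ β)

/-- The norm `|f|_{σ,S}^{(γ)}` of the weighted Hölder space `C_σ^{γ,γ/m}(S)`. -/
def holderNormOn {d : ℕ} (S : Set (SpaceTime (d + 1))) (m : ℕ) (σ γ : ℝ)
    (f : SpaceTime (d + 1) → ℝ) : ℝ≥0∞ :=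
  supNormOn S f + spaceSeminorm S σ γ f + timeSeminorm S (γ / m) f

/-- The norm of `C^{m+γ,(m+γ)/m}_{n,ωγ}(Q̄)`, `ω = n/m`. The spatial derivatives of orders
`0 < |α| < m - n` are measured in the Hölder norm with weight exponent `σ`. The norms of spatial
derivatives are taken over `x_N > 0`: a function with finite weighted Hölder norm there extends
continuously to `x_N ≥ 0` with the same norm. -/
def weightedNorm {d : ℕ} (m : ℕ) (n γ σ : ℝ) (w : SpaceTime (d + 1) → ℝ) : ℝ≥0∞ :=
  supNormOn (closedQ d) w
    + (∑ k ∈ (Finset.range m).filter (fun k : ℕ => 0 < k ∧ (k : ℝ) < m - n),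
        ∑ α ∈ Finset.piAntidiag (Finset.univ : Finset (Fin (d + 1))) k,
          holderNormOn (openQ d) m σ γ (multiDeriv α w))
    + (∑ j ∈ Finset.range (⌊n⌋₊ + 1),
        ∑ α ∈ (Finset.piAntidiag (Finset.univ : Finset (Fin (d + 1))) (m - j)).filter
            (fun α : Fin (d + 1) → ℕ => ¬ ((j : ℝ) = n ∧ α (Fin.last d) = m - j)),
          holderNormOn (openQ d) m (n / m * γ) γ
            (fun p => (p.1 (Fin.last d)) ^ (n - j) * multiDeriv α w p))
    + holderNormOn (closedQ d) m (n / m * γ) γ (dirDeriv timeDir w)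

/-- Membership of (the restriction to `Q̄` of) `w` in `C^{m+γ,(m+γ)/m}_{n,ωγ}(Q̄)`. -/
structure MemWeighted {d : ℕ} (m : ℕ) (n γ : ℝ) (w : SpaceTime (d + 1) → ℝ) : Prop where
  continuousOn : ContinuousOn w (closedQ d)
  space_contDiffOn : ∀ t : ℝ, ContDiffOn ℝ m
    (fun x : EuclideanSpace ℝ (Fin (d + 1)) => w (x, t)) {x | 0 < x (Fin.last d)}
  time_differentiable : ∀ p ∈ closedQ d, LineDifferentiableAt ℝ w p timeDir
  norm_lt_top : weightedNorm m n γ (n / m * γ) w < ⊤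

/-- The projection `x = (x', x_N) ↦ x'`. -/
def tangential {d : ℕ} (x : EuclideanSpace ℝ (Fin (d + 1))) : EuclideanSpace ℝ (Fin d) :=
  WithLp.toLp 2 (fun i : Fin d => x i.castSucc)

end WeightedHolder

end

noncomputable section

namespace WeightedHolder

open MeasureTheory Set Filter Topology
open scoped ContDiff

section

/-! ### Test functions on the line and their moments -/

/-! Write z = x_N, ν = m - n, θ = (1 - ω)γ and a = ν + θ. The extension averages v at scale z in x'
and z^ν in t, then cuts off in z. Give each space variable the weight 1 and time the weight ν. Since
ν(1 + γ/m) = a, the datum has order a divided by the weight in every variable, so a single degree a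
governs all estimates. The kernel is a product of functions φ_i of unit mass whose moments of orders
1, …, p_i vanish.

The average itself is not small near z = 0, but its normal derivative is. Differentiating in the
scale replaces one factor φ_j by a multiple of (rφ_j)', all of whose moments up to order p_j vanish
(`vanMom_dil_of_mollifier`). Subtracting a Taylor polynomial in that one variable gives the size
z^{a-1} (`exists_abs_mollify_le`). Only pure derivatives of v enter, which is all that the norm
controls. Vanishing moments in one variable survive further differentiation, and each derivative
costs its weight (`GoodOp.coordDeriv`). Hence the normal derivative of D^L Ev is O(z^{a-1-ord L}).
Integrating it down from heights where the cut-off vanishes bounds D^L Ev itself, by a negative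
power of z or by a constant (`exists_bound_listDeriv`, `exists_sup_bound_listDeriv`).

Such pointwise bounds give every Hölder seminorm: two points are lifted to a height δ adapted to
their distance, compared there, and joined to their lifts vertically (`weighted_space_holder`,
`time_holder`). A time step h calls for δ = |h|^{1/ν}, whence the exponent θ/ν = γ/m. Unit mass
gives the boundary value (`continuousOn_fullExt`), and uniform Hölder continuity in t carries the
time derivative to the boundary (`tendsto_coordDeriv_fullExt`).

The arithmetic of n enters twice. The bound θ < {n} for noninteger n yields θ < n - j for all
integers 0 ≤ j < n, so the derivatives weighted by z^{n-j} are in the range of negative powers. The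
condition ωγ ≤ 1 - {n} yields γ ≤ a - k for all integers 0 ≤ k < m - n, which the unweighted
estimate requires. -/

/-- Smooth compactly supported functions on the line. -/
structure IsTest (φ : ℝ → ℝ) : Prop where
  smooth : ContDiff ℝ ∞ φ
  supp : HasCompactSupport φ

/-- The moments of `φ` of order at most `p` vanish. -/
def VanMom (p : ℕ) (φ : ℝ → ℝ) : Prop := ∀ k ≤ p, ∫ r, r ^ k * φ r = 0

/-- The derivative of `r φ(r)`, which generates the dilations of `φ`. -/
def dil (φ : ℝ → ℝ) : ℝ → ℝ := deriv fun r => r * φ r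

lemma contDiff_infty_deriv {φ : ℝ → ℝ} (h : ContDiff ℝ ∞ φ) : ContDiff ℝ ∞ (deriv φ) :=
  (contDiff_infty_iff_deriv.1 h).2

lemma IsTest.hasDerivAt {φ : ℝ → ℝ} (h : IsTest φ) (r : ℝ) : HasDerivAt φ (deriv φ r) r :=
  (h.smooth.differentiable (by simp) r).hasDerivAt

lemma IsTest.continuous {φ : ℝ → ℝ} (h : IsTest φ) : Continuous φ := h.smooth.continuous

lemma IsTest.integrable {φ : ℝ → ℝ} (h : IsTest φ) : Integrable φ :=
  h.continuous.integrable_of_hasCompactSupport h.supp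

lemma IsTest.deriv {φ : ℝ → ℝ} (h : IsTest φ) : IsTest (deriv φ) :=
  ⟨contDiff_infty_deriv h.smooth, h.supp.deriv⟩

lemma IsTest.mul_left {φ g : ℝ → ℝ} (h : IsTest φ) (hg : ContDiff ℝ ∞ g) :
    IsTest (fun r => g r * φ r) :=
  ⟨hg.mul h.smooth, h.supp.mul_left⟩

lemma IsTest.dil {φ : ℝ → ℝ} (h : IsTest φ) : IsTest (dil φ) :=
  (h.mul_left contDiff_id).deriv

lemma IsTest.add {φ ψ : ℝ → ℝ} (h : IsTest φ) (h' : IsTest ψ) : IsTest (fun r => φ r + ψ r) :=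
  ⟨h.smooth.add h'.smooth, h.supp.add h'.supp⟩

lemma IsTest.pow_mul {φ : ℝ → ℝ} (h : IsTest φ) (k : ℕ) : IsTest (fun r => r ^ k * φ r) :=
  h.mul_left (contDiff_id.pow k)

lemma dil_apply {φ : ℝ → ℝ} (h : IsTest φ) (r : ℝ) : dil φ r = φ r + r * deriv φ r := by
  have := ((hasDerivAt_id' r).fun_mul (h.hasDerivAt r)).deriv
  simpa [dil] using this

lemma moment_deriv {φ : ℝ → ℝ} (h : IsTest φ) (k : ℕ) :
    ∫ r, r ^ k * deriv φ r = -∫ r, (k * r ^ (k - 1)) * φ r := by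
  refine integral_mul_deriv_eq_deriv_mul_of_integrable (fun x _ => by simpa using hasDerivAt_pow k x)
    (fun x _ => h.hasDerivAt x) (h.deriv.pow_mul k).integrable ?_ (h.pow_mul k).integrable
  exact (h.mul_left (g := fun r => (k : ℝ) * r ^ (k - 1))
    (contDiff_const.mul (contDiff_id.pow _))).integrable

/-- Integration by parts. The factor k is the point: the moment of order 0 is always destroyed and
no moment that vanishes is revived. -/
lemma moment_dil {φ : ℝ → ℝ} (h : IsTest φ) (k : ℕ) :
    ∫ r, r ^ k * dil φ r = -(k * ∫ r, r ^ k * φ r) := by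
  have := moment_deriv (h.mul_left contDiff_id) k
  rw [← integral_const_mul]
  refine this.trans ?_
  congr 2
  ext r
  rcases k with _ | k
  · simp
  · simp [pow_succ]; ring

lemma VanMom.deriv {p : ℕ} {φ : ℝ → ℝ} (h : IsTest φ) (hm : VanMom p φ) : VanMom p (deriv φ) := by
  intro k hk
  rw [moment_deriv h]
  simp only [mul_assoc]
  rw [integral_const_mul, hm (k - 1) (by omega)]
  simp

lemma VanMom.dil {p : ℕ} {φ : ℝ → ℝ} (h : IsTest φ) (hm : VanMom p φ) : VanMom p (dil φ) := by
  intro k hk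
  rw [moment_dil h, hm k hk]
  simp

lemma VanMom.const_mul {p : ℕ} {φ : ℝ → ℝ} (hm : VanMom p φ) (c : ℝ) :
    VanMom p (fun r => c * φ r) := by
  intro k hk
  simp only [mul_left_comm _ c]
  rw [integral_const_mul, hm k hk, mul_zero]

/-- There are mollifiers with vanishing moments of orders `1, …, p`. -/
lemma exists_mollifier (p : ℕ) :
    ∃ φ : ℝ → ℝ, IsTest φ ∧ ∫ r, φ r = 1 ∧ ∀ k, 1 ≤ k → k ≤ p → ∫ r, r ^ k * φ r = 0 := by
  induction p with
  | zero =>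
    let b : ContDiffBump (0 : ℝ) := ⟨1, 2, by norm_num, by norm_num⟩
    refine ⟨b.normed volume, ⟨b.contDiff_normed, b.hasCompactSupport_normed⟩,
      b.integral_normed, fun k h1 h2 => by omega⟩
  | succ p ih =>
    obtain ⟨φ, hφ, h1, hk⟩ := ih
    -- The correction multiplies the k-th moment by 1 - k/(p+1), which keeps the mass, keeps the
    -- zeros already obtained, and kills order p + 1.
    have key : ∀ k : ℕ, ∫ r, r ^ k * (φ r + 1 / ((p + 1 : ℕ) : ℝ) * dil φ r) =
        (1 - k / ((p + 1 : ℕ) : ℝ)) * ∫ r, r ^ k * φ r := by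
      intro k
      have e : ∀ r : ℝ, r ^ k * (φ r + 1 / ((p + 1 : ℕ) : ℝ) * dil φ r) =
          r ^ k * φ r + 1 / ((p + 1 : ℕ) : ℝ) * (r ^ k * dil φ r) := fun r => by ring
      simp only [e]
      rw [integral_add (hφ.pow_mul k).integrable ((hφ.dil.pow_mul k).integrable.const_mul _),
        integral_const_mul, moment_dil hφ]
      ring
    refine ⟨fun r => φ r + 1 / ((p + 1 : ℕ) : ℝ) * dil φ r,
      hφ.add (hφ.dil.mul_left contDiff_const), ?_, fun k hk1 hk2 => ?_⟩
    · simpa [h1] using key 0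
    · rw [key]
      rcases Nat.lt_or_ge p k with h | h
      · obtain rfl : k = p + 1 := by omega
        have : ((p + 1 : ℕ) : ℝ) ≠ 0 := by positivity
        rw [div_self this]; simp
      · rw [hk k hk1 h, mul_zero]

/-- This is why the normal derivative of the extension gains decay: the one nonzero moment of a
mollifier, its mass, is removed by the factor k of `moment_dil`. -/
lemma vanMom_dil_of_mollifier {p : ℕ} {φ : ℝ → ℝ} (h : IsTest φ)
    (hk : ∀ k, 1 ≤ k → k ≤ p → ∫ r, r ^ k * φ r = 0) : VanMom p (dil φ) := by
  intro k hkp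
  rw [moment_dil h]
  rcases Nat.eq_zero_or_pos k with rfl | h0
  · simp
  · rw [hk k h0 hkp]; simp

/-! ### Taylor approximation of Hölder functions -/

/-- Induction on p by integrating an approximation of g'. The coefficients are irrelevant later,
since the polynomial is only paired with functions of vanishing moments. -/
lemma exists_poly_approx (p : ℕ) {τ B : ℝ} (hτ : 0 ≤ τ) (hB : 0 ≤ B) : ∀ g : ℝ → ℝ,
    ContDiff ℝ p g → (∀ r, |iteratedDeriv p g r - iteratedDeriv p g 0| ≤ B * |r| ^ τ) →
    ∃ c : ℕ → ℝ, ∀ r, |g r - ∑ k ∈ Finset.range (p + 1), c k * r ^ k| ≤ B * (|r| ^ p * |r| ^ τ) := by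
  induction p with
  | zero =>
    intro g _ h
    exact ⟨fun _ => g 0, fun r => by simpa using h r⟩
  | succ p ih =>
    intro g hg h
    have hg' : ContDiff ℝ ((p : WithTop ℕ∞) + 1) g := by exact_mod_cast hg
    obtain ⟨hd, -, hg1⟩ := contDiff_succ_iff_deriv.1 hg'
    simp only [iteratedDeriv_succ'] at h
    obtain ⟨c, hc⟩ := ih (deriv g) hg1 h
    -- The primitive of the polynomial for g' that takes the value g 0 at 0.
    refine ⟨fun k => if k = 0 then g 0 else c (k - 1) / k, fun r => ?_⟩
    set D : ℝ → ℝ := fun s => g s - ∑ k ∈ Finset.range (p + 1 + 1),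
      (if k = 0 then g 0 else c (k - 1) / k) * s ^ k with hD
    have hD0 : D 0 = 0 := by
      simp [hD, Finset.sum_range_succ']
    have hDd : ∀ s, HasDerivAt D (deriv g s - ∑ k ∈ Finset.range (p + 1), c k * s ^ k) s := by
      intro s
      refine (hd s).hasDerivAt.sub ?_
      have : ∀ k ∈ Finset.range (p + 1 + 1), HasDerivAt
          (fun s : ℝ => (if k = 0 then g 0 else c (k - 1) / k) * s ^ k)
          ((if k = 0 then g 0 else c (k - 1) / k) * (k * s ^ (k - 1))) s :=
        fun k _ => (hasDerivAt_pow k s).const_mul _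
      convert HasDerivAt.fun_sum this using 1
      rw [Finset.sum_range_succ' _ (p + 1)]
      simp only [Nat.cast_zero, zero_mul, mul_zero, add_zero]
      refine Finset.sum_congr rfl fun k _ => ?_
      have : ((k + 1 : ℕ) : ℝ) ≠ 0 := by positivity
      simp only [Nat.add_one_ne_zero, if_false, Nat.add_sub_cancel]
      field_simp
    have := (convex_uIcc (0 : ℝ) r).norm_image_sub_le_of_norm_hasDerivWithin_le
      (C := B * (|r| ^ p * |r| ^ τ)) (fun s _ => (hDd s).hasDerivWithinAt) (fun s hs => ?_)
      (left_mem_uIcc) (right_mem_uIcc)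
    · rw [hD0, sub_zero, sub_zero, Real.norm_eq_abs, Real.norm_eq_abs] at this
      refine this.trans (le_of_eq ?_)
      ring
    · have hsr : |s| ≤ |r| := by
        rcases mem_uIcc.1 hs with h | h
        · rw [abs_of_nonneg h.1, abs_of_nonneg (h.1.trans h.2)]; exact h.2
        · rw [abs_of_nonpos h.2, abs_of_nonpos (h.1.trans h.2)]; linarith [h.1]
      refine (hc s).trans ?_
      gcongr

/-- The rescaling `z^{-μ} φ(r / z^μ)` of `φ`. -/
def sc (μ : ℝ) (φ : ℝ → ℝ) (z r : ℝ) : ℝ := z ^ (-μ) * φ (r * z ^ (-μ))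

/-- The substitution r = c - z^μ s, which moves the scale from the kernel to g. -/
lemma integral_mul_sc {μ z : ℝ} (hz : 0 < z) (φ g : ℝ → ℝ) (c : ℝ) :
    ∫ r, g r * sc μ φ z (c - r) = ∫ s, g (c - z ^ μ * s) * φ s := by
  have hh : 0 < z ^ (-μ) := Real.rpow_pos_of_pos hz _
  have e1 : ∫ r, g r * sc μ φ z (c - r) = ∫ r, g (c - r) * sc μ φ z r := by
    rw [← integral_sub_left_eq_self (fun r => g r * sc μ φ z (c - r)) volume c]
    simp
  rw [e1]
  have e2 : ∀ r, g (c - r) * sc μ φ z r =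
      z ^ (-μ) * (fun s => g (c - z ^ μ * s) * φ s) (r * z ^ (-μ)) := by
    intro r
    have : z ^ μ * (r * z ^ (-μ)) = r := by
      rw [mul_left_comm, ← Real.rpow_add hz]; simp
    simp only [sc, this]; ring
  simp only [e2]
  rw [integral_const_mul, Measure.integral_comp_mul_right (fun s => g (c - z ^ μ * s) * φ s),
    abs_of_pos (inv_pos.2 hh), smul_eq_mul,
    ← mul_assoc, mul_inv_cancel₀ hh.ne', one_mul]

lemma integral_sc {μ z : ℝ} (hz : 0 < z) (φ : ℝ → ℝ) (c : ℝ) :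
    ∫ r, sc μ φ z (c - r) = ∫ s, φ s := by
  simpa using integral_mul_sc hz φ (fun _ => 1) c

lemma integral_abs_sc {μ z : ℝ} (hz : 0 < z) (φ : ℝ → ℝ) (c : ℝ) :
    ∫ r, |sc μ φ z (c - r)| = ∫ s, |φ s| := by
  rw [← integral_sc (μ := μ) hz (fun s => |φ s|) c]
  congr 1; ext r
  simp [sc, abs_mul, abs_of_pos (Real.rpow_pos_of_pos hz (-μ))]

lemma continuous_sc {μ z : ℝ} {φ : ℝ → ℝ} (hφ : IsTest φ) : Continuous (sc μ φ z) := by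
  have := hφ.continuous
  unfold sc; fun_prop

/-- The Taylor polynomial of g integrates to zero against φ, so only the remainder of size |r|^{p+τ}
is seen. -/
lemma exists_integral_vanMom_le {p : ℕ} {τ : ℝ} (hτ : 0 ≤ τ) {φ : ℝ → ℝ} (hφ : IsTest φ)
    (hm : VanMom p φ) : ∃ C : ℝ, 0 ≤ C ∧ ∀ (g : ℝ → ℝ) (B : ℝ), 0 ≤ B → ContDiff ℝ p g →
      (∀ r, |iteratedDeriv p g r - iteratedDeriv p g 0| ≤ B * |r| ^ τ) →
      |∫ r, g r * φ r| ≤ C * B := by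
  refine ⟨∫ r, (|r| ^ p * |r| ^ τ) * |φ r|, integral_nonneg fun r => by positivity, ?_⟩
  intro g B hB hg h
  obtain ⟨c, hc⟩ := exists_poly_approx p hτ hB g hg h
  have hgc := hg.continuous
  have hφc := hφ.continuous
  have i1 : Integrable fun r => g r * φ r :=
    (hgc.mul hφc).integrable_of_hasCompactSupport hφ.supp.mul_left
  have i2 : Integrable fun r => (∑ k ∈ Finset.range (p + 1), c k * r ^ k) * φ r := by
    refine Continuous.integrable_of_hasCompactSupport ?_ hφ.supp.mul_left
    fun_prop
  have z2 : ∫ r, (∑ k ∈ Finset.range (p + 1), c k * r ^ k) * φ r = 0 := by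
    simp only [Finset.sum_mul, mul_assoc]
    rw [integral_finsetSum _ fun k _ => ((hφ.pow_mul k).integrable.const_mul _)]
    refine Finset.sum_eq_zero fun k hk => ?_
    rw [integral_const_mul, hm k (by simpa [Nat.lt_succ_iff] using hk), mul_zero]
  have e : ∫ r, g r * φ r = ∫ r, (g r - ∑ k ∈ Finset.range (p + 1), c k * r ^ k) * φ r := by
    simp only [sub_mul]
    rw [integral_sub i1 i2, z2, sub_zero]
  rw [e, mul_comm, ← integral_const_mul, ← Real.norm_eq_abs]
  refine norm_integral_le_of_norm_le ?_ (Eventually.of_forall fun r => ?_)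
  · refine Integrable.const_mul (Continuous.integrable_of_hasCompactSupport ?_ ?_) _
    · have : Continuous fun r : ℝ => |r| ^ τ := continuous_abs.rpow_const fun _ => Or.inr hτ
      fun_prop
    · exact hφ.supp.norm.mul_left
  · rw [norm_mul, Real.norm_eq_abs, Real.norm_eq_abs, ← mul_assoc]
    exact mul_le_mul_of_nonneg_right (hc r) (abs_nonneg _)

/-- After rescaling, the p-th derivative brings a factor z^{μp} and its Hölder increment a factor
z^{μτ}. The constant does not depend on the scale. -/
lemma exists_integral_sc_vanMom_le {p : ℕ} {τ μ : ℝ} (hτ : 0 ≤ τ) {φ : ℝ → ℝ} (hφ : IsTest φ)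
    (hm : VanMom p φ) : ∃ C : ℝ, 0 ≤ C ∧ ∀ (g : ℝ → ℝ) (B z c : ℝ), 0 ≤ B → 0 < z →
      ContDiff ℝ p g → (∀ r s, |iteratedDeriv p g r - iteratedDeriv p g s| ≤ B * |r - s| ^ τ) →
      |∫ r, g r * sc μ φ z (c - r)| ≤ C * B * z ^ (μ * (p + τ)) := by
  obtain ⟨C, hC0, hC⟩ := exists_integral_vanMom_le hτ hφ hm
  refine ⟨C, hC0, fun g B z c hB hz hg h => ?_⟩
  rw [integral_mul_sc hz, mul_assoc]
  have hzμ : 0 < z ^ μ := Real.rpow_pos_of_pos hz _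
  refine hC _ _ (by positivity) ?_ fun r => ?_
  · exact hg.comp (by fun_prop)
  · have hc : ContDiff ℝ p fun s => g (c - s) := hg.comp (by fun_prop)
    rw [iteratedDeriv_comp_const_mul (f := fun s => g (c - s)) hc, iteratedDeriv_comp_const_sub]
    simp only [smul_eq_mul, mul_zero, sub_zero]
    rw [← mul_sub, ← mul_sub, abs_mul, abs_mul, abs_pow, abs_pow, abs_neg, abs_one, one_pow, one_mul,
      abs_of_pos hzμ]
    have := h (c - z ^ μ * r) c
    rw [sub_sub_cancel_left, abs_neg, abs_mul, abs_of_pos hzμ, Real.mul_rpow hzμ.le (abs_nonneg _)]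
      at this
    calc _ ≤ (z ^ μ) ^ p * (B * ((z ^ μ) ^ τ * |r| ^ τ)) := by gcongr
      _ = _ := by
        rw [mul_add, Real.rpow_add hz, Real.rpow_mul hz.le, Real.rpow_mul hz.le, Real.rpow_natCast]
        ring

end

section

/-! ### Product kernels -/

lemma hasDerivAt_sc_right {μ z r : ℝ} {φ : ℝ → ℝ} (hφ : IsTest φ) :
    HasDerivAt (sc μ φ z) (z ^ (-μ) * sc μ (deriv φ) z r) r := by
  have h1 : HasDerivAt (fun r : ℝ => r * z ^ (-μ)) (z ^ (-μ)) r := by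
    simpa using (hasDerivAt_id' r).mul_const (z ^ (-μ))
  have := ((hφ.hasDerivAt (r * z ^ (-μ))).comp r h1).const_mul (z ^ (-μ))
  refine this.congr_deriv ?_
  simp only [sc]; ring

/-- A change of scale is again a rescaled kernel, up to z⁻¹, with profile proportional to the
dilation generator (rφ)'. -/
lemma hasDerivAt_sc_left {μ z r : ℝ} {φ : ℝ → ℝ} (hφ : IsTest φ) (hz : 0 < z) :
    HasDerivAt (fun z => sc μ φ z r) (z⁻¹ * sc μ (fun s => -μ * dil φ s) z r) z := by
  have h0 : HasDerivAt (fun z : ℝ => z ^ (-μ)) (-μ * z ^ (-μ - 1)) z :=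
    Real.hasDerivAt_rpow_const (Or.inl hz.ne')
  have := h0.fun_mul ((hφ.hasDerivAt (r * z ^ (-μ))).comp z (h0.const_mul r))
  refine this.congr_deriv ?_
  rw [Real.rpow_sub_one hz.ne']
  simp only [sc, dil_apply hφ, Function.comp]
  field_simp
  ring

lemma contDiffOn_sc {μ : ℝ} {φ : ℝ → ℝ} (hφ : IsTest φ) :
    ContDiffOn ℝ ∞ (fun y : ℝ × ℝ => sc μ φ y.1 y.2) (Ioi 0 ×ˢ univ) := by
  have h0 : ContDiffOn ℝ ∞ (fun y : ℝ × ℝ => y.1 ^ (-μ)) (Ioi 0 ×ˢ univ) :=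
    contDiffOn_fst.rpow_const_of_ne fun y hy => (ne_of_gt hy.1)
  exact h0.mul (hφ.smooth.comp_contDiffOn (contDiffOn_snd.mul h0))

variable {d : ℕ}

/-- The product of rescaled functions of one variable. -/
def prodKer (μ : Fin (d + 1) → ℝ) (φ : Fin (d + 1) → ℝ → ℝ) (z : ℝ) (u : Fin (d + 1) → ℝ) : ℝ :=
  ∏ i, sc (μ i) (φ i) z (u i)

/-- The anisotropic mollification of `V` with a product kernel. -/
def mollify (μ : Fin (d + 1) → ℝ) (V : (Fin (d + 1) → ℝ) → ℝ) (φ : Fin (d + 1) → ℝ → ℝ)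
    (P : ℝ × (Fin (d + 1) → ℝ)) : ℝ :=
  ∫ q, V q * prodKer μ φ P.1 (P.2 - q)

variable {μ : Fin (d + 1) → ℝ} {φ : Fin (d + 1) → ℝ → ℝ}

lemma contDiffOn_prodKer (hφ : ∀ i, IsTest (φ i)) :
    ContDiffOn ℝ ∞ (fun y : ℝ × (Fin (d + 1) → ℝ) => prodKer μ φ y.1 y.2) (Ioi 0 ×ˢ univ) := by
  unfold prodKer
  refine contDiffOn_prod fun i _ => ?_
  have : ContDiff ℝ ∞ fun y : ℝ × (Fin (d + 1) → ℝ) => (y.1, y.2 i) := by fun_prop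
  exact (contDiffOn_sc (hφ i)).comp this.contDiffOn fun y hy => ⟨hy.1, mem_univ _⟩

lemma continuous_prodKer (hφ : ∀ i, IsTest (φ i)) (z : ℝ) : Continuous (prodKer μ φ z) := by
  unfold prodKer
  exact continuous_finsetProd _ fun i _ => (continuous_sc (hφ i)).comp (continuous_apply i)

lemma IsTest.update (hφ : ∀ i, IsTest (φ i)) {ψ : ℝ → ℝ} (hψ : IsTest ψ) (j i : Fin (d + 1)) :
    IsTest (Function.update φ j ψ i) := by
  rcases eq_or_ne i j with rfl | h
  · simpa using hψ
  · simpa [h] using hφ i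

lemma prodKer_update (ψ : ℝ → ℝ) (j : Fin (d + 1)) (z : ℝ) (u : Fin (d + 1) → ℝ) :
    prodKer μ (Function.update φ j ψ) z u =
      (∏ i ∈ Finset.univ.erase j, sc (μ i) (φ i) z (u i)) * sc (μ j) ψ z (u j) := by
  rw [prodKer, ← Finset.prod_erase_mul _ _ (Finset.mem_univ j)]
  congr 1
  · refine Finset.prod_congr rfl fun i hi => ?_
    rw [Function.update_of_ne (Finset.ne_of_mem_erase hi)]
  · simp

lemma hasDerivAt_prodKer_tangential (hφ : ∀ i, IsTest (φ i)) (j : Fin (d + 1)) (z s : ℝ)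
    (u : Fin (d + 1) → ℝ) :
    HasDerivAt (fun s => prodKer μ φ z (u + s • Pi.single j 1))
      (z ^ (-μ j) * prodKer μ (Function.update φ j (deriv (φ j))) z (u + s • Pi.single j 1)) s := by
  unfold prodKer
  have key : ∀ i ∈ Finset.univ, HasDerivAt
      (fun s : ℝ => sc (μ i) (φ i) z ((u + s • Pi.single j (1 : ℝ) : Fin (d + 1) → ℝ) i))
      (if i = j then z ^ (-μ j) * sc (μ j) (deriv (φ j)) z
        ((u + s • Pi.single j (1 : ℝ) : Fin (d + 1) → ℝ) j) else 0) s := by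
    intro i _
    split_ifs with h
    · subst h
      have h1 : HasDerivAt (fun s : ℝ => (u + s • Pi.single i (1 : ℝ) : Fin (d + 1) → ℝ) i) 1 s := by
        simpa using (hasDerivAt_id' s).const_add (u i)
      simpa [Function.comp_def] using (hasDerivAt_sc_right (hφ i)).comp s h1
    · simpa [h] using hasDerivAt_const s _
  refine (HasDerivAt.fun_finsetProd key).congr_deriv ?_
  rw [Finset.sum_eq_single j (by simp +contextual) (by simp), if_pos rfl, ← prodKer,
    prodKer_update, smul_eq_mul]
  ring

/-- By Leibniz' rule each summand has exactly one factor replaced by a multiple of `dil`, so each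
gains vanishing moments in one variable. -/
lemma hasDerivAt_prodKer_normal (hφ : ∀ i, IsTest (φ i)) {z : ℝ} (hz : 0 < z)
    (u : Fin (d + 1) → ℝ) :
    HasDerivAt (fun z => prodKer μ φ z u)
      (z⁻¹ * ∑ j, prodKer μ (Function.update φ j fun s => -μ j * dil (φ j) s) z u) z := by
  unfold prodKer
  refine (HasDerivAt.fun_finsetProd fun i _ => hasDerivAt_sc_left (hφ i) hz).congr_deriv ?_
  rw [Finset.mul_sum]
  refine Finset.sum_congr rfl fun j _ => ?_
  rw [← prodKer, prodKer_update, smul_eq_mul]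
  ring

/-- Dominated differentiation: for s in a small closed ball only q in the support of V matters, and
K' is bounded on the product of these compact sets. -/
lemma hasDerivAt_integral_mul_kernel {V : (Fin (d + 1) → ℝ) → ℝ} (hV : Continuous V)
    (hVs : HasCompactSupport V) {K K' : ℝ → (Fin (d + 1) → ℝ) → ℝ} {U : Set ℝ} (hU : IsOpen U)
    {s₀ : ℝ} (hs₀ : s₀ ∈ U) (hK : ∀ s ∈ U, Continuous (K s))
    (hK' : ContinuousOn (fun y : ℝ × (Fin (d + 1) → ℝ) => K' y.1 y.2) (U ×ˢ univ))
    (hd : ∀ s ∈ U, ∀ q, HasDerivAt (fun s => K s q) (K' s q) s) :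
    HasDerivAt (fun s => ∫ q, V q * K s q) (∫ q, V q * K' s₀ q) s₀ := by
  obtain ⟨ε, hε, hεU⟩ := Metric.nhds_basis_closedBall.mem_iff.1 (hU.mem_nhds hs₀)
  have hc : IsCompact (Metric.closedBall s₀ ε ×ˢ tsupport V) := (isCompact_closedBall _ _).prod hVs
  obtain ⟨M, hM⟩ := hc.exists_bound_of_continuousOn
    (hK'.mono (prod_mono hεU (subset_univ _)))
  have hi : ∀ f : (Fin (d + 1) → ℝ) → ℝ, Continuous f → Integrable fun q => V q * f q :=
    fun f hf => (hV.mul hf).integrable_of_hasCompactSupport hVs.mul_right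
  have hK'c : Continuous (K' s₀) := by
    have : Continuous fun q : Fin (d + 1) → ℝ => (s₀, q) := by fun_prop
    exact continuousOn_univ.1 (hK'.comp this.continuousOn fun q _ => ⟨hs₀, mem_univ _⟩)
  refine (hasDerivAt_integral_of_dominated_loc_of_deriv_le (F' := fun s q => V q * K' s q)
    (bound := fun q => |V q| * M)
    (Metric.closedBall_mem_nhds s₀ hε) ?_ (hi _ (hK s₀ hs₀)) (hi _ hK'c).aestronglyMeasurable
    (Eventually.of_forall fun q s hs => ?_) ?_ (Eventually.of_forall fun q s hs => ?_)).2
  · filter_upwards [hU.mem_nhds hs₀] with s hs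
    exact (hi _ (hK s hs)).aestronglyMeasurable
  · by_cases hq : q ∈ tsupport V
    · rw [norm_mul, Real.norm_eq_abs (V q)]
      exact mul_le_mul_of_nonneg_left (hM (s, q) ⟨hs, hq⟩) (abs_nonneg _)
    · simp [image_eq_zero_of_notMem_tsupport hq]
  · exact (hV.abs.integrable_of_hasCompactSupport hVs.norm).mul_const _
  · exact (hd s (hεU hs) q).const_mul _

variable {V : (Fin (d + 1) → ℝ) → ℝ}

lemma hasDerivAt_mollify_tangential (hφ : ∀ i, IsTest (φ i)) (hV : Continuous V)
    (hVs : HasCompactSupport V) (j : Fin (d + 1)) {P : ℝ × (Fin (d + 1) → ℝ)} :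
    HasDerivAt (fun s : ℝ => mollify μ V φ (P + s • (0, Pi.single j 1)))
      (P.1 ^ (-μ j) * mollify μ V (Function.update φ j (deriv (φ j))) P) 0 := by
  have hφ' := IsTest.update hφ (hφ j).deriv j
  have := hasDerivAt_integral_mul_kernel hV hVs isOpen_univ (mem_univ 0)
    (K := fun s q => prodKer μ φ P.1 (P.2 - q + s • Pi.single j 1))
    (K' := fun s q => P.1 ^ (-μ j) * prodKer μ (Function.update φ j (deriv (φ j))) P.1
      (P.2 - q + s • Pi.single j 1))
    (fun s _ => (continuous_prodKer hφ _).comp (by fun_prop))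
    (Continuous.continuousOn <| continuous_const.mul <|
      (continuous_prodKer hφ' _).comp (by fun_prop))
    (fun s _ q => hasDerivAt_prodKer_tangential hφ j _ _ _)
  convert this using 1
  · ext s
    simp only [mollify, Prod.fst_add, Prod.smul_fst, smul_zero, add_zero, Prod.snd_add,
      Prod.smul_snd, sub_add_eq_add_sub]
  · simp only [mollify, zero_smul, add_zero]
    rw [← integral_const_mul]
    congr 1; ext q; ring

lemma integrable_mul_prodKer (hφ : ∀ i, IsTest (φ i)) (hV : Continuous V)
    (hVs : HasCompactSupport V) (P : ℝ × (Fin (d + 1) → ℝ)) :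
    Integrable fun q => V q * prodKer μ φ P.1 (P.2 - q) :=
  (hV.mul ((continuous_prodKer hφ _).comp (by fun_prop))).integrable_of_hasCompactSupport
    hVs.mul_right

lemma hasDerivAt_mollify_normal (hφ : ∀ i, IsTest (φ i)) (hV : Continuous V)
    (hVs : HasCompactSupport V) {z : ℝ} (hz : 0 < z) (u : Fin (d + 1) → ℝ) :
    HasDerivAt (fun z => mollify μ V φ (z, u))
      (z⁻¹ * ∑ j, mollify μ V (Function.update φ j fun s => -μ j * dil (φ j) s) (z, u)) z := by
  have hφ' := fun j => IsTest.update hφ ((hφ j).dil.mul_left (contDiff_const (c := -μ j))) j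
  have := hasDerivAt_integral_mul_kernel hV hVs isOpen_Ioi (mem_Ioi.2 hz)
    (K := fun s q => prodKer μ φ s (u - q))
    (K' := fun s q => s⁻¹ * ∑ j, prodKer μ (Function.update φ j fun s => -μ j * dil (φ j) s) s (u - q))
    (fun s _ => (continuous_prodKer hφ _).comp (by fun_prop))
    (by
      refine ContinuousOn.mul (continuousOn_fst.inv₀ fun y hy => (ne_of_gt hy.1)) ?_
      refine continuousOn_finsetSum _ fun j _ => ?_
      exact (contDiffOn_prodKer (μ := μ) (hφ' j)).continuousOn.comp
        (f := fun y : ℝ × (Fin (d + 1) → ℝ) => (y.1, u - y.2)) (by fun_prop)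
        fun y hy => ⟨hy.1, mem_univ _⟩)
    (fun s hs q => hasDerivAt_prodKer_normal hφ hs _)
  refine this.congr_deriv ?_
  simp only [mollify]
  rw [← integral_finsetSum _ fun j _ => integrable_mul_prodKer (hφ' j) hV hVs (z, u),
    ← integral_const_mul]
  congr 1; ext q
  simp only [← Finset.mul_sum]; ring

/-- The region of positive normal coordinate. -/
def upper (d : ℕ) : Set (ℝ × (Fin (d + 1) → ℝ)) := {P | 0 < P.1}

lemma isOpen_upper : IsOpen (upper d) := isOpen_lt continuous_const continuous_fst

lemma exists_abs_le_of_prodKer_ne_zero (hφ : ∀ i, IsTest (φ i)) :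
    ∃ ρ : ℝ, 0 < ρ ∧ ∀ (z : ℝ), 0 < z → ∀ u, prodKer μ φ z u ≠ 0 → ∀ i, |u i| ≤ ρ * z ^ μ i := by
  have : ∀ i, ∃ ρ : ℝ, 0 < ρ ∧ ∀ r, φ i r ≠ 0 → |r| ≤ ρ := by
    intro i
    obtain ⟨ρ, h0, hρ⟩ := (hφ i).supp.isCompact.isBounded.exists_pos_norm_le
    exact ⟨ρ, h0, fun r hr => hρ r (subset_tsupport _ hr)⟩
  choose ρ h0 hρ using this
  refine ⟨∑ i, ρ i, Finset.sum_pos (fun i _ => h0 i) ⟨0, Finset.mem_univ _⟩,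
    fun z hz u hu i => ?_⟩
  have hi : φ i (u i * z ^ (-μ i)) ≠ 0 := by
    intro h
    exact hu (Finset.prod_eq_zero (Finset.mem_univ i) (by rw [sc, h, mul_zero]))
  have h1 := hρ i _ hi
  have hzp := Real.rpow_pos_of_pos hz (μ i)
  rw [abs_mul, Real.rpow_neg hz.le, abs_inv, abs_of_pos hzp, ← div_eq_mul_inv, div_le_iff₀ hzp] at h1
  refine h1.trans ?_
  gcongr
  exact Finset.single_le_sum (fun i _ => (h0 i).le) (Finset.mem_univ i)

lemma contDiffOn_mollify (hμ : ∀ i, 0 < μ i) (hφ : ∀ i, IsTest (φ i)) (hV : Continuous V) :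
    ContDiffOn ℝ ∞ (mollify μ V φ) (upper d) := by
  obtain ⟨ρ, hρ0, hρ⟩ := exists_abs_le_of_prodKer_ne_zero (μ := μ) hφ
  intro P hP
  -- At heights below Z all kernels live in one compact box, as the theorem on convolutions with a
  -- parameter requires; smoothness is a local matter.
  set Z := P.1 + 1
  have hP' : 0 < P.1 := hP
  have hs : ContDiffOn ℝ ∞ (mollify μ V φ) (Ioo 0 Z ×ˢ univ) := by
    refine contDiffOn_convolution_right_with_param (n := ⊤) (ContinuousLinearMap.mul ℝ ℝ)
      (g := prodKer μ φ) (k := Set.pi univ fun i => Icc (-(ρ * Z ^ μ i)) (ρ * Z ^ μ i))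
      isOpen_Ioo (isCompact_univ_pi fun i => isCompact_Icc) ?_ hV.locallyIntegrable
      ((contDiffOn_prodKer hφ).mono (prod_mono (fun z hz => hz.1) subset_rfl))
    intro z u hz hu
    by_contra h
    refine hu fun i _ => abs_le.1 ((hρ z hz.1 u h i).trans ?_)
    have := Real.rpow_le_rpow hz.1.le hz.2.le (hμ i).le
    gcongr
  refine (hs.contDiffAt ((isOpen_Ioo.prod isOpen_univ).mem_nhds ?_)).contDiffWithinAt
  exact ⟨⟨hP', by simp [Z]⟩, mem_univ _⟩

/-! ### Estimates of mollifications -/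

lemma integrable_abs_prodKer (hφ : ∀ i, IsTest (φ i)) {z : ℝ} (hz : 0 < z)
    (u : Fin (d + 1) → ℝ) : Integrable fun q => |prodKer μ φ z (u - q)| := by
  have h1 : ∀ i, Integrable fun r => sc (μ i) (φ i) z (u i - r) := by
    intro i
    refine Integrable.comp_sub_left (f := sc (μ i) (φ i) z) ?_ (u i)
    have := (hφ i).integrable.comp_mul_right' (Real.rpow_pos_of_pos hz (-μ i)).ne'
    exact this.const_mul _
  exact (Integrable.fintype_prod h1).abs

/-- Rescaling preserves the L¹ norm, so mollification is bounded uniformly in z. -/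
lemma integral_abs_prodKer {z : ℝ} (hz : 0 < z) (u : Fin (d + 1) → ℝ) :
    ∫ q, |prodKer μ φ z (u - q)| = ∏ i, ∫ s, |φ i s| := by
  simp only [prodKer, Finset.abs_prod, Pi.sub_apply]
  rw [integral_fintype_prod_volume_eq_prod (fun i r => |sc (μ i) (φ i) z (u i - r)|)]
  exact Finset.prod_congr rfl fun i _ => integral_abs_sc hz _ _

lemma integral_prodKer {z : ℝ} (hz : 0 < z) (u : Fin (d + 1) → ℝ) :
    ∫ q, prodKer μ φ z (u - q) = ∏ i, ∫ s, φ i s := by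
  simp only [prodKer, Pi.sub_apply]
  rw [integral_fintype_prod_volume_eq_prod (fun i r => sc (μ i) (φ i) z (u i - r))]
  exact Finset.prod_congr rfl fun i _ => integral_sc hz _ _

/-- The bound on V is asked only where the kernel lives. This localization is what gives continuity
at the boundary. -/
lemma abs_mollify_le (hφ : ∀ i, IsTest (φ i)) {A : ℝ} {P : ℝ × (Fin (d + 1) → ℝ)} (hP : 0 < P.1)
    (hA : ∀ q, prodKer μ φ P.1 (P.2 - q) ≠ 0 → |V q| ≤ A) :
    |mollify μ V φ P| ≤ A * ∏ i, ∫ s, |φ i s| := by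
  rw [← integral_abs_prodKer (μ := μ) hP P.2, ← integral_const_mul, ← Real.norm_eq_abs]
  refine norm_integral_le_of_norm_le ((integrable_abs_prodKer (μ := μ) hφ hP _).const_mul _)
    (Eventually.of_forall fun q => ?_)
  rw [norm_mul, Real.norm_eq_abs, Real.norm_eq_abs]
  by_cases h : prodKer μ φ P.1 (P.2 - q) = 0
  · simp [h]
  · exact mul_le_mul_of_nonneg_right (hA q h) (abs_nonneg _)

/-- `V` is continuous with compact support, bounded by `A`, and Hölder continuous in each
coordinate `i`, of order `p i + τ i` with constant `A`. -/
structure Controlled (p : Fin (d + 1) → ℕ) (τ : Fin (d + 1) → ℝ) (V : (Fin (d + 1) → ℝ) → ℝ)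
    (A : ℝ) : Prop where
  continuous : Continuous V
  supp : HasCompactSupport V
  bdd : ∀ q, |V q| ≤ A
  smooth : ∀ i q, ContDiff ℝ (p i) fun r => V (Function.update q i r)
  holder : ∀ i q r s, |iteratedDeriv (p i) (fun r => V (Function.update q i r)) r -
    iteratedDeriv (p i) (fun r => V (Function.update q i r)) s| ≤ A * |r - s| ^ τ i

lemma Controlled.nonneg {p : Fin (d + 1) → ℕ} {τ : Fin (d + 1) → ℝ} {A : ℝ}
    (h : Controlled p τ V A) : 0 ≤ A := (abs_nonneg _).trans (h.bdd 0)

/-- Fubini isolates the variable i: the inner integral is small by the one-variable estimate, and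
the other factors contribute only their L¹ norms. No mixed regularity of V is needed. -/
lemma exists_abs_mollify_le {p : Fin (d + 1) → ℕ} {τ : Fin (d + 1) → ℝ} (hτ : ∀ i, 0 ≤ τ i)
    (hφ : ∀ i, IsTest (φ i)) {i : Fin (d + 1)} (hm : VanMom (p i) (φ i)) :
    ∃ C : ℝ, 0 ≤ C ∧ ∀ V A, Controlled p τ V A → ∀ P : ℝ × (Fin (d + 1) → ℝ), 0 < P.1 →
      |mollify μ V φ P| ≤ C * A * P.1 ^ (μ i * (p i + τ i)) := by
  obtain ⟨C, hC0, hC⟩ := exists_integral_sc_vanMom_le (μ := μ i) (hτ i) (hφ i) hm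
  refine ⟨C * ∏ j, ∫ s, |φ (i.succAbove j) s|, by positivity, fun V A hV P hP => ?_⟩
  have hmp := (volume_preserving_piFinSuccAbove (fun _ : Fin (d + 1) => ℝ) i).symm
  rw [mollify, ← hmp.integral_comp (MeasurableEquiv.measurableEmbedding _)]
  have hint := (hmp.integrable_comp_emb (MeasurableEquiv.measurableEmbedding _)).2
    (integrable_mul_prodKer (μ := μ) hφ hV.continuous hV.supp P)
  refine (congrArg abs (integral_prod_symm _ hint)).trans_le ?_
  have hz : ∀ q' : Fin d → ℝ, ‖∫ r : ℝ, (fun q => V q * prodKer μ φ P.1 (P.2 - q))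
      ((MeasurableEquiv.piFinSuccAbove (fun _ : Fin (d + 1) => ℝ) i).symm (r, q'))‖ ≤
      (C * A * P.1 ^ (μ i * (p i + τ i))) * ∏ j, |sc (μ (i.succAbove j)) (φ (i.succAbove j)) P.1
        (P.2 (i.succAbove j) - q' j)| := by
    intro q'
    have e : ∀ r : ℝ, (fun q => V q * prodKer μ φ P.1 (P.2 - q))
        ((MeasurableEquiv.piFinSuccAbove (fun _ : Fin (d + 1) => ℝ) i).symm (r, q')) =
        V (Function.update (i.insertNth 0 q') i r) * sc (μ i) (φ i) P.1 (P.2 i - r) *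
        ∏ j, sc (μ (i.succAbove j)) (φ (i.succAbove j)) P.1 (P.2 (i.succAbove j) - q' j) := by
      intro r
      have : (MeasurableEquiv.piFinSuccAbove (fun _ : Fin (d + 1) => ℝ) i).symm (r, q') =
          i.insertNth r q' := rfl
      simp only [this, prodKer, Fin.prod_univ_succAbove _ i, Pi.sub_apply,
        Fin.insertNth_apply_same, Fin.insertNth_apply_succAbove, Fin.update_insertNth]
      ring
    simp only [e]
    rw [integral_mul_const, norm_mul, ← Finset.abs_prod]
    refine mul_le_mul_of_nonneg_right ?_ (abs_nonneg _)
    exact hC _ A _ _ hV.nonneg hP (hV.smooth i _) (hV.holder i _)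
  refine (norm_integral_le_of_norm_le ?_ (Eventually.of_forall hz)).trans (le_of_eq ?_)
  · refine Integrable.const_mul (Integrable.fintype_prod (f := fun j r =>
      |sc (μ (i.succAbove j)) (φ (i.succAbove j)) P.1 (P.2 (i.succAbove j) - r)|) fun j => ?_) _
    refine (Integrable.comp_sub_left (f := sc (μ (i.succAbove j)) (φ (i.succAbove j)) P.1) ?_ _).abs
    have := (hφ (i.succAbove j)).integrable.comp_mul_right'
      (Real.rpow_pos_of_pos hP (-μ (i.succAbove j))).ne'
    exact this.const_mul _
  · rw [integral_const_mul, integral_fintype_prod_volume_eq_prod (fun j r =>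
      |sc (μ (i.succAbove j)) (φ (i.succAbove j)) P.1 (P.2 (i.succAbove j) - r)|)]
    simp only [integral_abs_sc hP]
    ring

end

section

/-! ### Directional derivatives on the upper half space -/

variable {d : ℕ}

/-- Coordinate directions of `ℝ × ℝ^{d+1}`; `none` is the normal direction. -/
def coordDir : Option (Fin (d + 1)) → ℝ × (Fin (d + 1) → ℝ)
  | none => (1, 0)
  | some i => (0, Pi.single i 1)

/-- The weight of a coordinate direction under anisotropic scaling. -/
def wt (μ : Fin (d + 1) → ℝ) : Option (Fin (d + 1)) → ℝ
  | none => 1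
  | some i => μ i

/-- The derivative in a coordinate direction. -/
def coordDeriv (c : Option (Fin (d + 1))) (F : ℝ × (Fin (d + 1) → ℝ) → ℝ) :
    ℝ × (Fin (d + 1) → ℝ) → ℝ :=
  fun P => lineDeriv ℝ F P (coordDir c)

/-- The iterated derivative along a list of coordinate directions. -/
def listDeriv (L : List (Option (Fin (d + 1)))) (F : ℝ × (Fin (d + 1) → ℝ) → ℝ) :
    ℝ × (Fin (d + 1) → ℝ) → ℝ :=
  L.foldr coordDeriv F

/-- The order of an iterated derivative under anisotropic scaling. -/
def ord (μ : Fin (d + 1) → ℝ) (L : List (Option (Fin (d + 1)))) : ℝ := (L.map (wt μ)).sum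

variable {F G : ℝ × (Fin (d + 1) → ℝ) → ℝ} {c : Option (Fin (d + 1))}

lemma differentiableAt_upper (hF : ContDiffOn ℝ ∞ F (upper d))
    {P : ℝ × (Fin (d + 1) → ℝ)} (hP : P ∈ upper d) : DifferentiableAt ℝ F P :=
  (hF.contDiffAt (isOpen_upper.mem_nhds hP)).differentiableAt (by simp)

lemma coordDeriv_eq_fderiv (hF : ContDiffOn ℝ ∞ F (upper d))
    {P : ℝ × (Fin (d + 1) → ℝ)} (hP : P ∈ upper d) :
    coordDeriv c F P = fderiv ℝ F P (coordDir c) :=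
  (differentiableAt_upper hF hP).lineDeriv_eq_fderiv

lemma contDiffOn_fderiv_upper (hF : ContDiffOn ℝ ∞ F (upper d)) :
    ContDiffOn ℝ ∞ (fderiv ℝ F) (upper d) :=
  hF.fderiv_of_isOpen isOpen_upper (by simp)

lemma contDiffOn_coordDeriv (hF : ContDiffOn ℝ ∞ F (upper d)) :
    ContDiffOn ℝ ∞ (coordDeriv c F) (upper d) :=
  ((contDiffOn_fderiv_upper hF).clm_apply contDiffOn_const).congr fun _ hP =>
    coordDeriv_eq_fderiv hF hP

lemma contDiffOn_listDeriv (hF : ContDiffOn ℝ ∞ F (upper d)) (L : List (Option (Fin (d + 1)))) :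
    ContDiffOn ℝ ∞ (listDeriv L F) (upper d) := by
  induction L with
  | nil => exact hF
  | cons c L ih => exact contDiffOn_coordDeriv ih

lemma coordDeriv_congr {U : Set (ℝ × (Fin (d + 1) → ℝ))} (hU : IsOpen U) (h : EqOn F G U) :
    EqOn (coordDeriv c F) (coordDeriv c G) U := fun _ hP =>
  (h.eventuallyEq_of_mem (hU.mem_nhds hP)).lineDeriv_eq

lemma listDeriv_congr {U : Set (ℝ × (Fin (d + 1) → ℝ))} (hU : IsOpen U) (h : EqOn F G U)
    (L : List (Option (Fin (d + 1)))) : EqOn (listDeriv L F) (listDeriv L G) U := by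
  induction L with
  | nil => exact h
  | cons c L ih => exact coordDeriv_congr hU ih

/-- Both sides are values of the symmetric second derivative. It lets a normal derivative be taken
first, which is where the vanishing moments appear. -/
lemma coordDeriv_comm (hF : ContDiffOn ℝ ∞ F (upper d)) (c c' : Option (Fin (d + 1))) :
    EqOn (coordDeriv c (coordDeriv c' F)) (coordDeriv c' (coordDeriv c F)) (upper d) := by
  have key : ∀ c c' : Option (Fin (d + 1)), ∀ P ∈ upper d, coordDeriv c (coordDeriv c' F) P =
      fderiv ℝ (fderiv ℝ F) P (coordDir c) (coordDir c') := by
    intro c c' P hP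
    rw [coordDeriv_congr isOpen_upper (fun Q hQ => coordDeriv_eq_fderiv hF hQ) hP]
    have hd : DifferentiableAt ℝ (fderiv ℝ F) P :=
      ((contDiffOn_fderiv_upper hF).contDiffAt (isOpen_upper.mem_nhds hP)).differentiableAt (by simp)
    have h2 : HasFDerivAt (fun Q => fderiv ℝ F Q (coordDir c')) _ P :=
      (ContinuousLinearMap.apply ℝ ℝ (coordDir c')).hasFDerivAt.comp P hd.hasFDerivAt
    rw [coordDeriv, h2.differentiableAt.lineDeriv_eq_fderiv, h2.fderiv]
    rfl
  intro P hP
  rw [key _ _ P hP, key _ _ P hP]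
  refine ContDiffAt.isSymmSndFDerivAt (hF.contDiffAt (isOpen_upper.mem_nhds hP)) ?_ _ _
  simp only [minSmoothness_of_isRCLikeNormedField]
  exact WithTop.coe_le_coe.2 le_top

lemma coordDeriv_listDeriv (hF : ContDiffOn ℝ ∞ F (upper d)) (c : Option (Fin (d + 1)))
    (L : List (Option (Fin (d + 1)))) :
    EqOn (coordDeriv c (listDeriv L F)) (listDeriv L (coordDeriv c F)) (upper d) := by
  induction L with
  | nil => exact fun _ _ => rfl
  | cons c' L ih =>
    exact (coordDeriv_comm (contDiffOn_listDeriv hF L) c c').trans (coordDeriv_congr isOpen_upper ih)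

/-! ### A class of operators closed under differentiation -/

variable {μ : Fin (d + 1) → ℝ} {p : Fin (d + 1) → ℕ}

/-- Linear combinations of mollifications with cut-off, homogeneous of degree `e`, whose kernels
have vanishing moments in some coordinate or whose cut-off vanishes near the boundary. -/
inductive GoodOp (μ : Fin (d + 1) → ℝ) (p : Fin (d + 1) → ℕ) :
    ℝ → (((Fin (d + 1) → ℝ) → ℝ) → ℝ × (Fin (d + 1) → ℝ) → ℝ) → Prop
  | base (e : ℝ) (φ : Fin (d + 1) → ℝ → ℝ) (χ : ℝ → ℝ) (hφ : ∀ i, IsTest (φ i))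
      (hχ : ContDiff ℝ ∞ χ) (h2 : ∀ z, 2 < z → χ z = 0)
      (h : (∃ i, VanMom (p i) (φ i)) ∨ ∀ z < 1, χ z = 0) :
      GoodOp μ p e fun V P => P.1 ^ e * (χ P.1 * mollify μ V φ P)
  | add {e : ℝ} {F G} (hF : GoodOp μ p e F) (hG : GoodOp μ p e G) :
      GoodOp μ p e fun V P => F V P + G V P
  | congr {e : ℝ} {F G} (hF : GoodOp μ p e F)
      (h : ∀ V, Continuous V → HasCompactSupport V → EqOn (F V) (G V) (upper d)) : GoodOp μ p e G

lemma GoodOp.sum {e : ℝ} {ι : Type*} (s : Finset ι)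
    (F : ι → ((Fin (d + 1) → ℝ) → ℝ) → ℝ × (Fin (d + 1) → ℝ) → ℝ)
    (h : ∀ j ∈ s, GoodOp μ p e (F j)) : GoodOp μ p e fun V P => ∑ j ∈ s, F j V P := by
  classical
  induction s using Finset.induction_on with
  | empty =>
    refine (GoodOp.base e (fun _ _ => 0) (fun _ => 0) (fun i => ⟨contDiff_const, ?_⟩) contDiff_const
      (fun _ _ => rfl) (Or.inr fun _ _ => rfl)).congr fun V _ _ P _ => by simp
    exact HasCompactSupport.zero
  | insert j s hj ih =>
    simp only [Finset.sum_insert hj]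
    exact (h j (by simp)).add (ih fun i hi => h i (by simp [hi]))

lemma GoodOp.contDiffOn (hμ : ∀ i, 0 < μ i) {e : ℝ}
    {F : ((Fin (d + 1) → ℝ) → ℝ) → ℝ × (Fin (d + 1) → ℝ) → ℝ} (hF : GoodOp μ p e F)
    {V : (Fin (d + 1) → ℝ) → ℝ} (hV : Continuous V) (hVs : HasCompactSupport V) :
    ContDiffOn ℝ ∞ (F V) (upper d) := by
  induction hF with
  | base φ χ hφ hχ h2 h =>
    refine ContDiffOn.mul (contDiffOn_fst.rpow_const_of_ne fun P hP => ne_of_gt hP) ?_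
    exact ((hχ.comp contDiff_fst).contDiffOn).mul (contDiffOn_mollify hμ hφ hV)
  | add _ _ ihF ihG => exact ihF.add ihG
  | congr _ h ih => exact ih.congr fun P hP => (h V hV hVs hP).symm

lemma deriv_eq_zero_of_eqOn_zero {χ : ℝ → ℝ} {U : Set ℝ} (hU : IsOpen U) (h : ∀ z ∈ U, χ z = 0)
    {z : ℝ} (hz : z ∈ U) : deriv χ z = 0 := by
  have : χ =ᶠ[𝓝 z] fun _ => 0 := by
    filter_upwards [hU.mem_nhds hz] with y hy using h y hy
  rw [this.deriv_eq, deriv_const]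

lemma coordDeriv_cutoff_tangential {φ : Fin (d + 1) → ℝ → ℝ} (hφ : ∀ i, IsTest (φ i))
    {V : (Fin (d + 1) → ℝ) → ℝ} (hV : Continuous V) (hVs : HasCompactSupport V) (e : ℝ) (χ : ℝ → ℝ)
    (j : Fin (d + 1)) {P : ℝ × (Fin (d + 1) → ℝ)} (hP : P ∈ upper d) :
    coordDeriv (some j) (fun P => P.1 ^ e * (χ P.1 * mollify μ V φ P)) P =
      P.1 ^ (e - μ j) * (χ P.1 * mollify μ V (Function.update φ j (deriv (φ j))) P) := by
  have := ((hasDerivAt_mollify_tangential (μ := μ) hφ hV hVs j (P := P)).const_mul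
    (χ P.1)).const_mul (P.1 ^ e)
  refine Eq.trans ?_ (this.deriv.trans ?_)
  · simp only [coordDeriv, lineDeriv, coordDir, Prod.fst_add, Prod.smul_fst, smul_zero, add_zero]
  · rw [sub_eq_add_neg, Real.rpow_add hP]; ring

/-- The derivatives of the power and of the cut-off leave the kernel alone and merge into a new
cut-off; the derivative of the mollification changes the kernel. -/
lemma coordDeriv_cutoff_normal {φ : Fin (d + 1) → ℝ → ℝ} (hφ : ∀ i, IsTest (φ i))
    {V : (Fin (d + 1) → ℝ) → ℝ} (hV : Continuous V) (hVs : HasCompactSupport V) (e : ℝ) {χ : ℝ → ℝ}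
    (hχ : ContDiff ℝ ∞ χ) {P : ℝ × (Fin (d + 1) → ℝ)} (hP : P ∈ upper d) :
    coordDeriv none (fun P => P.1 ^ e * (χ P.1 * mollify μ V φ P)) P =
      P.1 ^ (e - 1) * ((e * χ P.1 + P.1 * deriv χ P.1) * mollify μ V φ P) +
      ∑ j, P.1 ^ (e - 1) * (χ P.1 *
        mollify μ V (Function.update φ j fun s => -μ j * dil (φ j) s) P) := by
  have hP' : 0 < P.1 := hP
  have h1 := (Real.hasDerivAt_rpow_const (p := e) (Or.inl hP'.ne')).fun_mul
    (((hχ.differentiable (by simp) P.1).hasDerivAt).fun_mul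
      (hasDerivAt_mollify_normal (μ := μ) hφ hV hVs hP' P.2))
  have h2 : coordDeriv none (fun P => P.1 ^ e * (χ P.1 * mollify μ V φ P)) P =
      deriv (fun s => (fun z => z ^ e * (χ z * mollify μ V φ (z, P.2))) (P.1 + s)) 0 := by
    simp only [coordDeriv, lineDeriv, coordDir, Prod.fst_add, Prod.smul_fst, smul_eq_mul, mul_one]
    congr 1; ext s
    congr 3
    ext <;> simp
  rw [h2, deriv_comp_const_add (fun z => z ^ e * (χ z * mollify μ V φ (z, P.2))), add_zero, h1.deriv, ← Finset.mul_sum, ← Finset.mul_sum,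
    Real.rpow_sub_one hP'.ne']
  field_simp
  ring

/-- Both alternatives in the class are stable: vanishing moments pass to φ' and to `dil φ`, and a
cut-off that is zero for z < 1 has derivative zero there. -/
lemma GoodOp.coordDeriv (hμ : ∀ i, 0 < μ i) {e : ℝ}
    {F : ((Fin (d + 1) → ℝ) → ℝ) → ℝ × (Fin (d + 1) → ℝ) → ℝ} (hF : GoodOp μ p e F)
    (c : Option (Fin (d + 1))) : GoodOp μ p (e - wt μ c) fun V => coordDeriv c (F V) := by
  induction hF with
  | base φ χ hφ hχ h2 h =>
    rcases c with _ | j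
    · refine GoodOp.congr ?_ fun V hV hVs P hP =>
        (coordDeriv_cutoff_normal hφ hV hVs e hχ hP).symm
      have hχ' := contDiff_infty_deriv hχ
      refine GoodOp.add (GoodOp.base (e - 1) φ (fun z => e * χ z + z * deriv χ z) hφ (by fun_prop)
        (fun z hz => ?_) (h.imp_right fun h z hz => ?_))
        (GoodOp.sum _ _ fun j _ => GoodOp.base (e - 1) _ χ
          (IsTest.update hφ ((hφ j).dil.mul_left contDiff_const) j) hχ h2 ?_)
      · rw [h2 z hz, deriv_eq_zero_of_eqOn_zero isOpen_Ioi h2 hz]; simp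
      · rw [h z hz, deriv_eq_zero_of_eqOn_zero isOpen_Iio h hz]; simp
      · refine h.imp_left fun ⟨i, hi⟩ => ⟨i, ?_⟩
        rcases eq_or_ne i j with rfl | hij
        · simpa using (hi.dil (hφ i)).const_mul (-μ i)
        · simpa [hij] using hi
    · refine GoodOp.congr (GoodOp.base (e - μ j) _ χ (IsTest.update hφ (hφ j).deriv j) hχ h2 ?_)
        fun V hV hVs P hP => (coordDeriv_cutoff_tangential hφ hV hVs e χ j hP).symm
      refine h.imp_left fun ⟨i, hi⟩ => ⟨i, ?_⟩
      rcases eq_or_ne i j with rfl | hij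
      · simpa using hi.deriv (hφ i)
      · simpa [hij] using hi
  | add hF hG ihF ihG =>
    refine (ihF.add ihG).congr fun V hV hVs P hP => ?_
    have h1 := hF.contDiffOn hμ hV hVs
    have h2 := hG.contDiffOn hμ hV hVs
    simp only [coordDeriv_eq_fderiv h1 hP, coordDeriv_eq_fderiv h2 hP]
    rw [coordDeriv_eq_fderiv (h1.add h2) hP]
    rw [fderiv_fun_add (differentiableAt_upper h1 hP) (differentiableAt_upper h2 hP)]
    rfl
  | congr _ h ih =>
    exact ih.congr fun V hV hVs => coordDeriv_congr isOpen_upper (h V hV hVs)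

lemma GoodOp.listDeriv (hμ : ∀ i, 0 < μ i) {e : ℝ}
    {F : ((Fin (d + 1) → ℝ) → ℝ) → ℝ × (Fin (d + 1) → ℝ) → ℝ} (hF : GoodOp μ p e F)
    (L : List (Option (Fin (d + 1)))) : GoodOp μ p (e - ord μ L) fun V => listDeriv L (F V) := by
  induction L with
  | nil =>
    simp only [ord, List.map_nil, List.sum_nil, sub_zero]
    exact hF
  | cons c L ih =>
    have := ih.coordDeriv hμ c
    have he : e - ord μ (c :: L) = e - ord μ L - wt μ c := by
      simp only [ord, List.map_cons, List.sum_cons]; ring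
    rw [he]
    exact this

/-- The exponent a comes from the vanishing moments, the same for whichever variable carries them by
`ha`. In the other alternative the cut-off confines z to [1, 2], where all powers of z are
comparable. -/
lemma GoodOp.exists_bound {τ : Fin (d + 1) → ℝ} {a : ℝ} (hτ : ∀ i, 0 ≤ τ i)
    (ha : ∀ i, μ i * (p i + τ i) = a) {e : ℝ}
    {F : ((Fin (d + 1) → ℝ) → ℝ) → ℝ × (Fin (d + 1) → ℝ) → ℝ} (hF : GoodOp μ p e F) :
    ∃ C : ℝ, 0 ≤ C ∧ ∀ V A, Controlled p τ V A → ∀ P ∈ upper d,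
      (2 < P.1 → F V P = 0) ∧ |F V P| ≤ C * A * P.1 ^ (e + a) := by
  induction hF with
  | base φ χ hφ hχ h2 h =>
    obtain ⟨M, hM⟩ := (isCompact_Icc (a := (0 : ℝ)) (b := 2)).exists_bound_of_continuousOn
      hχ.continuous.continuousOn
    have hM0 : 0 ≤ M := (norm_nonneg _).trans (hM 0 (by simp))
    have hM' : ∀ z, 0 < z → |χ z| ≤ M := fun z hz => by
      rcases le_or_gt z 2 with h | h
      · exact hM z ⟨hz.le, h⟩
      · simpa [h2 z h] using hM0
    have main : ∃ C : ℝ, 0 ≤ C ∧ ∀ V A, Controlled p τ V A → ∀ P ∈ upper d,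
        |χ P.1 * mollify μ V φ P| ≤ C * A * P.1 ^ a := by
      rcases h with ⟨i, hi⟩ | h1
      · obtain ⟨C, hC0, hC⟩ := exists_abs_mollify_le (μ := μ) hτ hφ hi
        refine ⟨M * C, by positivity, fun V A hV P hP => ?_⟩
        have := hC V A hV P hP
        rw [ha i] at this
        rw [abs_mul, mul_assoc M, mul_assoc M]
        exact mul_le_mul (hM' _ hP) this (abs_nonneg _) hM0
      -- With the factor max(1, 2^{-a}), the quantity max(1, 2^{-a}) z^a is at least 1 on [1, 2] for
      -- either sign of a.
      · refine ⟨M * (∏ i, ∫ s, |φ i s|) * max 1 (2 ^ (-a)), ?_, fun V A hV P hP => ?_⟩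
        · have : 0 ≤ ∏ i, ∫ s, |φ i s| :=
            Finset.prod_nonneg fun i _ => integral_nonneg fun s => abs_nonneg _
          positivity
        · have hP' : 0 < P.1 := hP
          have hm := abs_mollify_le (μ := μ) hφ hP' (V := V) (fun q _ => hV.bdd q)
          have hI : 0 ≤ ∏ i, ∫ s, |φ i s| :=
            Finset.prod_nonneg fun i _ => integral_nonneg fun s => abs_nonneg _
          have hA := hV.nonneg
          by_cases hz : 1 ≤ P.1 ∧ P.1 ≤ 2
          · have h3 : 1 ≤ max 1 (2 ^ (-a)) * P.1 ^ a := by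
              rcases le_total 0 a with h0 | h0
              · calc (1 : ℝ) ≤ 1 * P.1 ^ a := by rw [one_mul]; exact Real.one_le_rpow hz.1 h0
                  _ ≤ _ := by gcongr; exact le_max_left _ _
              · calc (1 : ℝ) = 2 ^ (-a) * 2 ^ a := by rw [← Real.rpow_add two_pos]; simp
                  _ ≤ 2 ^ (-a) * P.1 ^ a := by
                    gcongr 1; exact Real.rpow_le_rpow_of_nonpos hP' hz.2 h0
                  _ ≤ _ := by gcongr; exact le_max_right _ _
            rw [abs_mul]
            calc |χ P.1| * |mollify μ V φ P| ≤ M * (A * ∏ i, ∫ s, |φ i s|) :=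
                  mul_le_mul (hM' _ hP) hm (abs_nonneg _) hM0
              _ ≤ M * (A * ∏ i, ∫ s, |φ i s|) * (max 1 (2 ^ (-a)) * P.1 ^ a) :=
                  le_mul_of_one_le_right (by positivity) h3
              _ = _ := by ring
          · have : χ P.1 = 0 := by
              by_cases h4 : P.1 < 1
              · exact h1 _ h4
              · exact h2 _ (by push Not at hz h4; exact hz h4)
            rw [this, zero_mul, abs_zero]
            positivity
    obtain ⟨C, hC0, hC⟩ := main
    refine ⟨C, hC0, fun V A hV P hP => ⟨fun hz => by simp [h2 _ hz], ?_⟩⟩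
    have hP' : 0 < P.1 := hP
    rw [abs_mul, abs_of_pos (Real.rpow_pos_of_pos hP' _), Real.rpow_add hP']
    calc _ ≤ P.1 ^ e * (C * A * P.1 ^ a) := by gcongr; exact hC V A hV P hP
      _ = _ := by ring
  | add _ _ ihF ihG =>
    obtain ⟨C, hC0, hC⟩ := ihF
    obtain ⟨C', hC0', hC'⟩ := ihG
    refine ⟨C + C', by positivity, fun V A hV P hP => ⟨fun hz => ?_, ?_⟩⟩
    · simp only [(hC V A hV P hP).1 hz, (hC' V A hV P hP).1 hz, add_zero]
    · calc _ ≤ _ := abs_add_le _ _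
        _ ≤ _ := add_le_add (hC V A hV P hP).2 (hC' V A hV P hP).2
        _ = _ := by ring
  | congr _ h ih =>
    obtain ⟨C, hC0, hC⟩ := ih
    refine ⟨C, hC0, fun V A hV P hP => ?_⟩
    rw [← h V hV.continuous hV.supp hP]
    exact hC V A hV P hP

end

section

/-! ### The extension operator on the upper half space and its derivatives -/

variable {d : ℕ} {μ : Fin (d + 1) → ℝ} {p : Fin (d + 1) → ℕ}

/-- A smooth cut-off equal to `1` for `z ≤ 1` and to `0` for `z ≥ 2`. -/
def cutoff (z : ℝ) : ℝ := Real.smoothTransition (2 - z)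

lemma contDiff_cutoff : ContDiff ℝ ∞ cutoff :=
  Real.smoothTransition.contDiff.comp (contDiff_const.sub contDiff_id)

lemma cutoff_of_le {z : ℝ} (hz : z ≤ 1) : cutoff z = 1 :=
  Real.smoothTransition.one_of_one_le (by linarith)

lemma cutoff_of_ge {z : ℝ} (hz : 2 ≤ z) : cutoff z = 0 :=
  Real.smoothTransition.zero_of_nonpos (by linarith)

/-- The mollification of `V` at the scale given by the normal coordinate, cut off. -/
def upperExt (μ : Fin (d + 1) → ℝ) (φ : Fin (d + 1) → ℝ → ℝ) (V : (Fin (d + 1) → ℝ) → ℝ)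
    (P : ℝ × (Fin (d + 1) → ℝ)) : ℝ :=
  cutoff P.1 * mollify μ V φ P

/-- Smooth functions of unit mass whose moments of orders `1, …, p i` vanish. -/
structure IsMollifier (p : Fin (d + 1) → ℕ) (φ : Fin (d + 1) → ℝ → ℝ) : Prop where
  test : ∀ i, IsTest (φ i)
  mass : ∀ i, ∫ r, φ i r = 1
  moment : ∀ i k, 1 ≤ k → k ≤ p i → ∫ r, r ^ k * φ i r = 0

variable {φ : Fin (d + 1) → ℝ → ℝ}

lemma contDiffOn_upperExt (hμ : ∀ i, 0 < μ i) (hφ : IsMollifier p φ) {V : (Fin (d + 1) → ℝ) → ℝ}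
    (hV : Continuous V) : ContDiffOn ℝ ∞ (upperExt μ φ V) (upper d) :=
  (contDiff_cutoff.comp contDiff_fst).contDiffOn.mul (contDiffOn_mollify hμ hφ.test hV)

/-- The extension itself need not be in the class, because its kernel has mass 1. One normal
derivative puts it there: it falls either on the cut-off, constant for z ≤ 1, or on a kernel factor,
which becomes a multiple of `dil`. -/
lemma goodOp_coordDeriv_upperExt (hφ : IsMollifier p φ) :
    GoodOp μ p (-1) fun V => coordDeriv none (upperExt μ φ V) := by
  have h2 : ∀ z, 2 < z → cutoff z = 0 := fun z hz => cutoff_of_ge hz.le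
  have h : GoodOp μ p (-1) fun V P => P.1 ^ (-1 : ℝ) * ((P.1 * deriv cutoff P.1) * mollify μ V φ P) +
      ∑ j, P.1 ^ (-1 : ℝ) * (cutoff P.1 *
        mollify μ V (Function.update φ j fun s => -μ j * dil (φ j) s) P) := by
    have hχ' := contDiff_infty_deriv contDiff_cutoff
    refine GoodOp.add (GoodOp.base (-1) φ (fun z => z * deriv cutoff z) hφ.test (by fun_prop)
      (fun z hz => ?_) (Or.inr fun z hz => ?_))
      (GoodOp.sum _ _ fun j _ => GoodOp.base (-1) _ cutoff
        (IsTest.update hφ.test ((hφ.test j).dil.mul_left contDiff_const) j) contDiff_cutoff h2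
        (Or.inl ⟨j, ?_⟩))
    · rw [deriv_eq_zero_of_eqOn_zero isOpen_Ioi h2 hz]; simp
    · have : cutoff =ᶠ[𝓝 z] fun _ => 1 := by
        filter_upwards [isOpen_Iio.mem_nhds hz] with y hy using cutoff_of_le (le_of_lt hy)
      rw [this.deriv_eq, deriv_const, mul_zero]
    · simpa using (vanMom_dil_of_mollifier (hφ.test j) (hφ.moment j)).const_mul (-μ j)
  refine h.congr fun V hV hVs P hP => ?_
  have := coordDeriv_cutoff_normal (μ := μ) hφ.test hV hVs 0 contDiff_cutoff hP
  simp only [Real.rpow_zero, one_mul, zero_mul, zero_add, zero_sub] at this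
  exact this.symm

/-- Comparison of increments of two functions by their derivatives. -/
lemma abs_sub_le_sub_of_abs_deriv_le {f g f' g' : ℝ → ℝ} {x y : ℝ} (hxy : x ≤ y)
    (hf : ∀ s ∈ Icc x y, HasDerivAt f (f' s) s) (hg : ∀ s ∈ Icc x y, HasDerivAt g (g' s) s)
    (h : ∀ s ∈ Icc x y, |f' s| ≤ g' s) : |f y - f x| ≤ g y - g x := by
  have key : ∀ (F F' : ℝ → ℝ), (∀ s ∈ Icc x y, HasDerivAt F (F' s) s) →
      (∀ s ∈ Icc x y, 0 ≤ F' s) → F x ≤ F y := by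
    intro F F' hF h0
    refine monotoneOn_of_deriv_nonneg (convex_Icc x y)
      (fun s hs => (hF s hs).continuousAt.continuousWithinAt)
      (fun s hs => (hF s (interior_subset hs)).differentiableAt.differentiableWithinAt)
      (fun s hs => ?_) (left_mem_Icc.2 hxy) (right_mem_Icc.2 hxy) hxy
    rw [(hF s (interior_subset hs)).deriv]
    exact h0 s (interior_subset hs)
  have h1 := key (fun s => g s - f s) _ (fun s hs => (hg s hs).sub (hf s hs))
    fun s hs => sub_nonneg.2 ((le_abs_self _).trans (h s hs))
  have h2 := key (fun s => g s + f s) _ (fun s hs => (hg s hs).add (hf s hs))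
    fun s hs => by linarith [(neg_abs_le (f' s)).trans' (neg_le_neg (h s hs))]
  rw [abs_le]
  constructor <;> linarith

/-- Stated for either sign of e: a negative e will give blow-up bounds, a positive e bounds up to
the boundary. -/
lemma abs_sub_le_of_deriv_rpow {f f' : ℝ → ℝ} {x y e B : ℝ} (hx : 0 < x) (hxy : x ≤ y)
    (he : e ≠ 0) (hf : ∀ s ∈ Icc x y, HasDerivAt f (f' s) s)
    (h : ∀ s ∈ Icc x y, |f' s| ≤ B * s ^ (e - 1)) : |f y - f x| ≤ B / e * (y ^ e - x ^ e) := by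
  have := abs_sub_le_sub_of_abs_deriv_le (g := fun s => B / e * s ^ e)
    (g' := fun s => B * s ^ (e - 1)) hxy hf (fun s hs => ?_) h
  · rwa [mul_sub]
  · refine ((Real.hasDerivAt_rpow_const (Or.inl (hx.trans_le hs.1).ne')).const_mul _).congr_deriv ?_
    field_simp

lemma hasDerivAt_vertical {F : ℝ × (Fin (d + 1) → ℝ) → ℝ} {z : ℝ} {u : Fin (d + 1) → ℝ}
    (hF : DifferentiableAt ℝ F (z, u)) :
    HasDerivAt (fun s => F (s, u)) (coordDeriv none F (z, u)) z := by
  have h1 : HasDerivAt (fun s : ℝ => (s, u)) ((1 : ℝ), (0 : Fin (d + 1) → ℝ)) z :=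
    (hasDerivAt_id z).prodMk (hasDerivAt_const z u)
  rw [coordDeriv, hF.lineDeriv_eq_fderiv]
  exact hF.hasFDerivAt.comp_hasDerivAt z h1

/-! ### Pointwise bounds for derivatives of the extension -/

section bounds

variable {τ : Fin (d + 1) → ℝ} {a : ℝ}

lemma listDeriv_eq_zero {F : ℝ × (Fin (d + 1) → ℝ) → ℝ} (h : ∀ P, 2 < P.1 → F P = 0)
    (L : List (Option (Fin (d + 1)))) {P : ℝ × (Fin (d + 1) → ℝ)} (hP : 2 < P.1) :
    listDeriv L F P = 0 := by
  have hU : IsOpen {P : ℝ × (Fin (d + 1) → ℝ) | 2 < P.1} := isOpen_lt continuous_const continuous_fst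
  rw [listDeriv_congr hU (fun Q hQ => h Q hQ : EqOn F (fun _ => 0) _) L hP]
  clear hP
  induction L generalizing P with
  | nil => rfl
  | cons c L ih =>
    have : listDeriv L (fun _ : ℝ × (Fin (d + 1) → ℝ) => (0 : ℝ)) = fun _ => 0 := funext fun Q => ih
    change coordDeriv c (listDeriv L _) P = 0
    rw [this, coordDeriv, lineDeriv]
    simp

lemma upperExt_eq_zero {V : (Fin (d + 1) → ℝ) → ℝ} {P : ℝ × (Fin (d + 1) → ℝ)} (hP : 2 < P.1) :
    upperExt μ φ V P = 0 := by
  rw [upperExt, cutoff_of_ge hP.le, zero_mul]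

/-- Since the extension vanishes for z > 2, exponents may be lowered freely at the cost of a
constant. -/
lemma rpow_le_two_rpow_mul {z e s : ℝ} (hz : 0 < z) (hz2 : z ≤ 2) (h : e ≤ s) :
    z ^ s ≤ 2 ^ (s - e) * z ^ e := by
  calc z ^ s = z ^ (s - e) * z ^ e := by rw [← Real.rpow_add hz]; ring_nf
    _ ≤ _ := by gcongr

/-- The normal derivative is commuted past D^L onto the extension, which lands in `GoodOp` with
degree -1 - ord L. -/
lemma exists_bound_normal_listDeriv (hμ : ∀ i, 0 < μ i) (hτ : ∀ i, 0 ≤ τ i)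
    (ha : ∀ i, μ i * (p i + τ i) = a) (hφ : IsMollifier p φ) (L : List (Option (Fin (d + 1))))
    {e : ℝ} (he : e ≤ a - ord μ L) :
    ∃ C : ℝ, 0 ≤ C ∧ ∀ V A, Controlled p τ V A → ∀ P ∈ upper d,
      |coordDeriv none (listDeriv L (upperExt μ φ V)) P| ≤ C * A * P.1 ^ (e - 1) := by
  have hg : GoodOp μ p (-1 - ord μ L) fun V => coordDeriv none (listDeriv L (upperExt μ φ V)) :=
    ((goodOp_coordDeriv_upperExt (μ := μ) hφ).listDeriv hμ L).congr fun V hV hVs P hP =>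
      (coordDeriv_listDeriv (contDiffOn_upperExt hμ hφ hV) none L hP).symm
  obtain ⟨C, hC0, hC⟩ := hg.exists_bound hτ ha
  refine ⟨C * 2 ^ (a - ord μ L - e), by positivity, fun V A hV P hP => ?_⟩
  have hA := hV.nonneg
  obtain ⟨h1, h2⟩ := hC V A hV P hP
  rcases le_or_gt P.1 2 with hz | hz
  · have := rpow_le_two_rpow_mul (e := e - 1) (s := -1 - ord μ L + a) hP hz (by linarith)
    have he' : -1 - ord μ L + a - (e - 1) = a - ord μ L - e := by ring
    rw [he'] at this
    calc _ ≤ _ := h2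
      _ ≤ C * A * (2 ^ (a - ord μ L - e) * P.1 ^ (e - 1)) := by gcongr
      _ = _ := by ring
  · have hP' : 0 < P.1 := hP
    rw [h1 hz, abs_zero]
    positivity

/-- Tangential derivatives alone need not produce enough vanishing moments, so D^L is recovered by
integrating its normal derivative from height 3, where it is zero because the extension vanishes on
the open set z > 2. -/
lemma abs_listDeriv_upperExt_le (hμ : ∀ i, 0 < μ i) (hφ : IsMollifier p φ)
    (L : List (Option (Fin (d + 1)))) {e B : ℝ} (he : e ≠ 0) {V : (Fin (d + 1) → ℝ) → ℝ}
    (hV : Continuous V) (hB : ∀ P ∈ upper d,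
      |coordDeriv none (listDeriv L (upperExt μ φ V)) P| ≤ B * P.1 ^ (e - 1))
    {P : ℝ × (Fin (d + 1) → ℝ)} (hP : P ∈ upper d) (hP3 : P.1 ≤ 3) :
    |listDeriv L (upperExt μ φ V) P| ≤ B / e * (3 ^ e - P.1 ^ e) := by
  have hP' : 0 < P.1 := hP
  have := abs_sub_le_of_deriv_rpow (f := fun s => listDeriv L (upperExt μ φ V) (s, P.2))
    (f' := fun s => coordDeriv none (listDeriv L (upperExt μ φ V)) (s, P.2)) (B := B) hP' hP3 he
    (fun s hs => hasDerivAt_vertical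
      (differentiableAt_upper (contDiffOn_listDeriv (contDiffOn_upperExt hμ hφ hV) L)
        (show 0 < s from hP'.trans_le hs.1)))
    (fun s hs => hB (s, P.2) (show 0 < s from hP'.trans_le hs.1))
  rwa [listDeriv_eq_zero (fun Q hQ => upperExt_eq_zero hQ) L (P := (3, P.2)) (by norm_num),
    zero_sub, abs_neg] at this

lemma exists_bound_listDeriv (hμ : ∀ i, 0 < μ i) (hτ : ∀ i, 0 ≤ τ i)
    (ha : ∀ i, μ i * (p i + τ i) = a) (hφ : IsMollifier p φ) (L : List (Option (Fin (d + 1))))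
    {e : ℝ} (he0 : e < 0) (he : e ≤ a - ord μ L) :
    ∃ C : ℝ, 0 ≤ C ∧ ∀ V A, Controlled p τ V A → ∀ P ∈ upper d,
      |listDeriv L (upperExt μ φ V) P| ≤ C * A * P.1 ^ e := by
  obtain ⟨C, hC0, hC⟩ := exists_bound_normal_listDeriv hμ hτ ha hφ L he
  refine ⟨C / -e, div_nonneg hC0 (by linarith), fun V A hV P hP => ?_⟩
  have hA := hV.nonneg
  have hP' : 0 < P.1 := hP
  have he' : 0 < -e := by linarith
  rcases le_or_gt P.1 3 with h3 | h3
  · refine (abs_listDeriv_upperExt_le hμ hφ L he0.ne hV.continuous (hC V A hV) hP h3).trans ?_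
    have : C * A / e * (3 ^ e - P.1 ^ e) = C * A / -e * (P.1 ^ e - 3 ^ e) := by
      rw [div_neg]; ring
    rw [this, div_mul_eq_mul_div C]
    gcongr
    exact sub_le_self _ (by positivity)
  · rw [listDeriv_eq_zero (fun Q hQ => upperExt_eq_zero hQ) L (by linarith), abs_zero]
    positivity

lemma exists_sup_bound_listDeriv (hμ : ∀ i, 0 < μ i) (hτ : ∀ i, 0 ≤ τ i)
    (ha : ∀ i, μ i * (p i + τ i) = a) (hφ : IsMollifier p φ) (L : List (Option (Fin (d + 1))))
    (hL : ord μ L < a) :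
    ∃ C : ℝ, 0 ≤ C ∧ ∀ V A, Controlled p τ V A → ∀ P ∈ upper d,
      |listDeriv L (upperExt μ φ V) P| ≤ C * A := by
  obtain ⟨C, hC0, hC⟩ := exists_bound_normal_listDeriv hμ hτ ha hφ L le_rfl
  have he : 0 < a - ord μ L := by linarith
  refine ⟨C / (a - ord μ L) * 3 ^ (a - ord μ L), by positivity, fun V A hV P hP => ?_⟩
  have hA := hV.nonneg
  have hP' : 0 < P.1 := hP
  rcases le_or_gt P.1 3 with h3 | h3
  · refine (abs_listDeriv_upperExt_le hμ hφ L he.ne' hV.continuous (hC V A hV) hP h3).trans ?_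
    calc _ ≤ C * A / (a - ord μ L) * 3 ^ (a - ord μ L) := by
          gcongr; exact sub_le_self _ (by positivity)
      _ = _ := by ring
  · rw [listDeriv_eq_zero (fun Q hQ => upperExt_eq_zero hQ) L (by linarith), abs_zero]
    positivity

end bounds

/-! ### Hölder estimates from weighted derivative bounds -/

/-- The component of a vector in a coordinate direction. -/
def comp (c : Option (Fin (d + 1))) (X : ℝ × (Fin (d + 1) → ℝ)) : ℝ := c.elim X.1 X.2

lemma sum_comp_smul_coordDir (X : ℝ × (Fin (d + 1) → ℝ)) :
    ∑ c, comp c X • coordDir c = X := by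
  rw [Fintype.sum_option]
  ext i
  · simp [comp, coordDir, Prod.fst_sum]
  · simp [comp, coordDir, Prod.snd_sum, Finset.sum_apply, Pi.single_apply]

lemma abs_comp_le (c : Option (Fin (d + 1))) (X : ℝ × (Fin (d + 1) → ℝ)) : |comp c X| ≤ ‖X‖ := by
  rcases c with _ | i
  · exact norm_fst_le X
  · exact (norm_le_pi_norm X.2 i).trans (norm_snd_le X)

variable {F : ℝ × (Fin (d + 1) → ℝ) → ℝ}

/-- Mean value inequality on a segment that stays above height r. There are d + 2 coordinate
directions, each contributing at most M. -/
lemma abs_sub_le_segment (hF : ∀ P ∈ upper d, DifferentiableAt ℝ F P) {P Q : ℝ × (Fin (d + 1) → ℝ)}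
    {r M : ℝ} (hr : 0 < r) (hP : r ≤ P.1) (hQ : r ≤ Q.1)
    (h : ∀ c R, r ≤ R.1 → |comp c (Q - P) * coordDeriv c F R| ≤ M) :
    |F Q - F P| ≤ (d + 2) * M := by
  have hmem : ∀ s ∈ Icc (0 : ℝ) 1, r ≤ (P + s • (Q - P)).1 := by
    intro s hs
    have h1 := mul_nonneg (sub_nonneg.2 hs.2) (sub_nonneg.2 hP)
    have h2 := mul_nonneg hs.1 (sub_nonneg.2 hQ)
    simp only [Prod.fst_add, Prod.smul_fst, Prod.fst_sub, smul_eq_mul]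
    nlinarith
  have hd : ∀ s ∈ Icc (0 : ℝ) 1, HasDerivWithinAt (fun s : ℝ => F (P + s • (Q - P)))
      (∑ c, comp c (Q - P) * coordDeriv c F (P + s • (Q - P))) (Icc 0 1) s := by
    intro s hs
    have hFd := hF (P + s • (Q - P)) (show 0 < (P + s • (Q - P)).1 from hr.trans_le (hmem s hs))
    have h1 : HasDerivAt (fun s : ℝ => P + s • (Q - P)) (Q - P) s := by
      simpa using ((hasDerivAt_id' s).smul_const (Q - P)).const_add P
    refine ((hFd.hasFDerivAt.comp_hasDerivAt s h1).congr_deriv ?_).hasDerivWithinAt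
    conv_lhs => rw [← sum_comp_smul_coordDir (Q - P)]
    rw [map_sum]
    refine Finset.sum_congr rfl fun c _ => ?_
    rw [map_smul, coordDeriv, hFd.lineDeriv_eq_fderiv, sum_comp_smul_coordDir, smul_eq_mul]
  have := (convex_Icc (0 : ℝ) 1).norm_image_sub_le_of_norm_hasDerivWithin_le (C := (d + 2) * M) hd
    (fun s hs => ?_) (left_mem_Icc.2 zero_le_one) (right_mem_Icc.2 zero_le_one)
  · simpa using this
  · refine (norm_sum_le _ _).trans ((Finset.sum_le_card_nsmul _ _ M fun c _ =>
      h c _ (hmem s hs)).trans (le_of_eq ?_))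
    simp only [Finset.card_univ, Fintype.card_option, Fintype.card_fin, nsmul_eq_mul]
    push_cast
    ring

/-- The singularity z^{θ-1} is integrable, and subadditivity of z^θ for θ ≤ 1 makes the estimate
independent of the starting height. -/
lemma abs_sub_le_vertical (hF : ∀ P ∈ upper d, DifferentiableAt ℝ F P) {θ B : ℝ} (hθ : 0 < θ)
    (hθ1 : θ ≤ 1) (hB : 0 ≤ B) (hN : ∀ P ∈ upper d, |coordDeriv none F P| ≤ B * P.1 ^ (θ - 1))
    {P : ℝ × (Fin (d + 1) → ℝ)} (hP : P ∈ upper d) {δ : ℝ} (hδ : 0 ≤ δ) :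
    |F (P.1 + δ, P.2) - F P| ≤ B / θ * δ ^ θ := by
  have hP' : 0 < P.1 := hP
  refine (abs_sub_le_of_deriv_rpow (f := fun s => F (s, P.2))
    (f' := fun s => coordDeriv none F (s, P.2)) (B := B) hP' (le_add_of_nonneg_right hδ) hθ.ne'
    (fun s hs => hasDerivAt_vertical (hF _ (show 0 < s from hP'.trans_le hs.1)))
    (fun s hs => hN (s, P.2) (show 0 < s from hP'.trans_le hs.1))).trans ?_
  have := Real.rpow_add_le_add_rpow hP'.le hδ hθ.le hθ1
  gcongr
  linarith

/-- Go up by δ, across, and down by δ: the crossing takes place where the derivatives are evaluated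
at height at least δ. -/
lemma abs_sub_le_lift (hF : ∀ P ∈ upper d, DifferentiableAt ℝ F P) {θ B : ℝ} (hθ : 0 < θ)
    (hθ1 : θ ≤ 1) (hB : 0 ≤ B) (hN : ∀ P ∈ upper d, |coordDeriv none F P| ≤ B * P.1 ^ (θ - 1))
    {P Q : ℝ × (Fin (d + 1) → ℝ)} (hP : P ∈ upper d) (hQ : Q ∈ upper d) {δ M : ℝ} (hδ : 0 < δ)
    (h : ∀ c R, δ ≤ R.1 → |comp c (Q - P) * coordDeriv c F R| ≤ M) :
    |F Q - F P| ≤ 2 * (B / θ * δ ^ θ) + (d + 2) * M := by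
  have hP' : 0 < P.1 := hP
  have hQ' : 0 < Q.1 := hQ
  have h1 := abs_sub_le_vertical hF hθ hθ1 hB hN hP hδ.le
  have h2 := abs_sub_le_vertical hF hθ hθ1 hB hN hQ hδ.le
  have h3 := abs_sub_le_segment hF (P := (P.1 + δ, P.2)) (Q := (Q.1 + δ, Q.2)) (M := M) hδ
    (by simp; linarith) (by simp; linarith) (by
      have : ((Q.1 + δ, Q.2) : ℝ × (Fin (d + 1) → ℝ)) - (P.1 + δ, P.2) = Q - P := by
        ext <;> simp
      rw [this]; exact h)
  have e : F Q - F P = -(F (Q.1 + δ, Q.2) - F Q) + (F (Q.1 + δ, Q.2) - F (P.1 + δ, P.2)) +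
      (F (P.1 + δ, P.2) - F P) := by ring
  rw [e]
  refine (abs_add_three _ _ _).trans ?_
  rw [abs_neg]
  linarith

/-- Weighted Hölder continuity at fixed time (the last coordinate). -/
lemma weighted_space_holder (hF : ∀ P ∈ upper d, DifferentiableAt ℝ F P) {σ γ B : ℝ} (hσ : 0 ≤ σ)
    (hσγ : σ < γ) (hγ : γ ≤ 1) (hB : 0 ≤ B)
    (hD : ∀ c, c ≠ some (Fin.last d) → ∀ P ∈ upper d,
      |coordDeriv c F P| ≤ B * P.1 ^ (γ - σ - 1))
    {P Q : ℝ × (Fin (d + 1) → ℝ)} (hP : P ∈ upper d) (hQ : Q ∈ upper d)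
    (ht : P.2 (Fin.last d) = Q.2 (Fin.last d)) :
    max P.1 Q.1 ^ σ * |F Q - F P| ≤
      (2 * (2 / (γ - σ) + (d + 2))) * B * ‖Q - P‖ ^ γ := by
  have hP' : 0 < P.1 := hP
  have hQ' : 0 < Q.1 := hQ
  have hθ : 0 < γ - σ := by linarith
  set z := max P.1 Q.1 with hz
  set δ := ‖Q - P‖ with hδ
  have hz0 : 0 < z := lt_max_of_lt_left hP'
  have hδnn : 0 ≤ δ := norm_nonneg _
  rcases hδnn.eq_or_lt with h0 | h0
  · have : Q = P := sub_eq_zero.1 (norm_eq_zero.1 h0.symm)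
    rw [this, sub_self, abs_zero, mul_zero]
    positivity
  have hcomp : ∀ r, 0 < r → ∀ c R, r ≤ R.1 →
      |comp c (Q - P) * coordDeriv c F R| ≤ δ * (B * r ^ (γ - σ - 1)) := by
    intro r hr c R hR
    rw [abs_mul]
    by_cases hc : c = some (Fin.last d)
    · have : comp c (Q - P) = 0 := by simp [hc, comp, ht]
      rw [this, abs_zero, zero_mul]
      positivity
    · refine mul_le_mul (abs_comp_le c _) ((hD c hc R (show 0 < R.1 from hr.trans_le hR)).trans ?_)
        (abs_nonneg _) (norm_nonneg _)
      gcongr ?_ * ?_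
      exact Real.rpow_le_rpow_of_nonpos hr hR (by linarith)
  have hδ1 : |Q.1 - P.1| ≤ δ := abs_comp_le none (Q - P)
  rcases lt_or_ge δ (z / 2) with h | h
  -- Points close relative to their height: no lift is needed, and weight times derivative bound is
  -- of size z^{γ-1} ≤ δ^{γ-1}.
  · have hm : z / 2 ≤ P.1 ∧ z / 2 ≤ Q.1 := by
      have := abs_le.1 hδ1
      rcases max_cases P.1 Q.1 with h' | h' <;> rw [← hz] at h' <;> constructor <;> linarith [h'.1]
    have h1 := abs_sub_le_segment hF (half_pos hz0) hm.1 hm.2 (hcomp _ (half_pos hz0))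
    have h2 : z ^ σ * (z / 2) ^ (γ - σ - 1) ≤ 2 * δ ^ (γ - 1) := by
      have e1 : z ^ σ * (z / 2) ^ (γ - σ - 1) = 2 ^ (1 - (γ - σ)) * z ^ (γ - 1) := by
        rw [Real.div_rpow hz0.le (by norm_num), div_eq_mul_inv, ← Real.rpow_neg (by norm_num),
          ← mul_assoc, ← Real.rpow_add hz0, mul_comm]
        congr 2 <;> ring
      rw [e1]
      have e2 : (2 : ℝ) ^ (1 - (γ - σ)) ≤ 2 ^ (1 : ℝ) :=
        Real.rpow_le_rpow_of_exponent_le (by norm_num) (by linarith)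
      rw [Real.rpow_one] at e2
      have e3 : z ^ (γ - 1) ≤ δ ^ (γ - 1) :=
        Real.rpow_le_rpow_of_nonpos h0 (by linarith) (by linarith)
      gcongr
    have h3 : δ ^ γ = δ ^ (γ - 1) * δ := by
      rw [Real.rpow_sub_one h0.ne']; field_simp
    calc z ^ σ * |F Q - F P| ≤ z ^ σ * ((d + 2) * (δ * (B * (z / 2) ^ (γ - σ - 1)))) := by gcongr
      _ = (z ^ σ * (z / 2) ^ (γ - σ - 1)) * ((d + 2) * δ * B) := by ring
      _ ≤ (2 * δ ^ (γ - 1)) * ((d + 2) * δ * B) := by gcongr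
      _ = 2 * (d + 2) * B * δ ^ γ := by rw [h3]; ring
      _ ≤ _ := by
        gcongr 2 * ?_ * _ * _
        exact le_add_of_nonneg_left (by positivity)
  -- Distant points: the weight is at most 2δ^σ since z ≤ 2δ, and lifting by δ gives an increment of
  -- order δ^{γ-σ}.
  · have h1 := abs_sub_le_lift hF hθ (by linarith) hB (hD none (by simp)) hP hQ h0 (hcomp _ h0)
    have h2 : z ^ σ ≤ 2 * δ ^ σ := by
      calc z ^ σ ≤ (2 * δ) ^ σ := Real.rpow_le_rpow hz0.le (by linarith) hσ
        _ = 2 ^ σ * δ ^ σ := Real.mul_rpow (by norm_num) h0.le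
        _ ≤ 2 ^ (1 : ℝ) * δ ^ σ := by
          gcongr ?_ * _
          exact Real.rpow_le_rpow_of_exponent_le (by norm_num) (by linarith)
        _ = _ := by rw [Real.rpow_one]
    have h3 : δ ^ γ = δ ^ σ * δ ^ (γ - σ) := by rw [← Real.rpow_add h0]; ring_nf
    have h4 : δ * δ ^ (γ - σ - 1) = δ ^ (γ - σ) := by
      rw [Real.rpow_sub_one h0.ne']; field_simp
    calc z ^ σ * |F Q - F P| ≤ (2 * δ ^ σ) * (2 * (B / (γ - σ) * δ ^ (γ - σ)) +
          (d + 2) * (δ * (B * δ ^ (γ - σ - 1)))) := by gcongr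
      _ = (2 * δ ^ σ) * (2 * (B / (γ - σ) * δ ^ (γ - σ)) +
          (d + 2) * (B * (δ * δ ^ (γ - σ - 1)))) := by ring
      _ = _ := by rw [h4, h3]; ring

/-- Hölder continuity in a coordinate of weight `ν`. -/
lemma time_holder (hF : ∀ P ∈ upper d, DifferentiableAt ℝ F P) {θ ν B : ℝ} (hθ : 0 < θ)
    (hθ1 : θ ≤ 1) (hν : θ ≤ ν) (hB : 0 ≤ B)
    (hN : ∀ P ∈ upper d, |coordDeriv none F P| ≤ B * P.1 ^ (θ - 1)) {j : Fin (d + 1)}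
    (hT : ∀ P ∈ upper d, |coordDeriv (some j) F P| ≤ B * P.1 ^ (θ - ν))
    {P : ℝ × (Fin (d + 1) → ℝ)} (hP : P ∈ upper d) (h : ℝ) :
    |F (P + h • coordDir (some j)) - F P| ≤ (2 / θ + (d + 2)) * B * |h| ^ (θ / ν) := by
  have hν0 : 0 < ν := hθ.trans_le hν
  rcases eq_or_ne h 0 with rfl | hh
  · simp only [zero_smul, add_zero, sub_self, abs_zero]
    positivity
  have hh' : 0 < |h| := abs_pos.2 hh
  -- The height at which a step |h| = δ^ν costs δ^ν · δ^{θ-ν} = δ^θ, the same as the two vertical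
  -- paths.
  set δ := |h| ^ (1 / ν) with hδ
  have hδ0 : 0 < δ := Real.rpow_pos_of_pos hh' _
  have hδν : δ ^ ν = |h| := by
    rw [hδ, ← Real.rpow_mul hh'.le]; field_simp; simp
  have hδθ : δ ^ θ = |h| ^ (θ / ν) := by
    rw [hδ, ← Real.rpow_mul hh'.le]; congr 1; field_simp
  have hQ : P + h • coordDir (some j) ∈ upper d := by
    have : 0 < P.1 := hP
    simpa [upper, coordDir] using this
  refine (abs_sub_le_lift hF hθ hθ1 hB hN hP hQ hδ0 (M := B * δ ^ θ) ?_).trans (le_of_eq ?_)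
  · intro c R hR
    rw [add_sub_cancel_left, abs_mul]
    have hz : ∀ c, c ≠ some j → comp c (h • coordDir (some j)) = 0 := by
      intro c hc
      rcases c with _ | i
      · simp [comp, coordDir]
      · have : i ≠ j := fun h => hc (by rw [h])
        simp [comp, coordDir, this]
    by_cases hc : c = some j
    · subst hc
      have e1 : comp (some j) (h • coordDir (some j)) = h := by simp [comp, coordDir]
      rw [e1, ← hδν]
      calc δ ^ ν * |coordDeriv (some j) F R| ≤ δ ^ ν * (B * R.1 ^ (θ - ν)) := by
            gcongr; exact hT R (show 0 < R.1 from hδ0.trans_le hR)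
        _ ≤ δ ^ ν * (B * δ ^ (θ - ν)) := by
            gcongr ?_ * (?_ * ?_)
            exact Real.rpow_le_rpow_of_nonpos hδ0 hR (by linarith)
        _ = B * (δ ^ ν * δ ^ (θ - ν)) := by ring
        _ = B * δ ^ θ := by rw [← Real.rpow_add hδ0]; ring_nf
    · rw [hz c hc, abs_zero, zero_mul]
      positivity
  · rw [hδθ]; ring

end

section

/-! ### Bounds for the terms of the weighted norm, in coordinates -/

variable {d : ℕ} {μ : Fin (d + 1) → ℝ} {p : Fin (d + 1) → ℕ} {φ : Fin (d + 1) → ℝ → ℝ}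
  {τ : Fin (d + 1) → ℝ} {a : ℝ}

/-- Bounds for a function and its derivatives that imply weighted Hölder continuity with weight
`σ` and exponent `γ` in space, and with exponent `θ / ν` in time (the last coordinate). -/
structure HolderBound (σ γ θ ν : ℝ) (F : ℝ × (Fin (d + 1) → ℝ) → ℝ) (B : ℝ) : Prop where
  diff : ∀ P ∈ upper d, DifferentiableAt ℝ F P
  sup : ∀ P ∈ upper d, |F P| ≤ B
  space : ∀ c, c ≠ some (Fin.last d) → ∀ P ∈ upper d, |coordDeriv c F P| ≤ B * P.1 ^ (γ - σ - 1)
  normal : ∀ P ∈ upper d, |coordDeriv none F P| ≤ B * P.1 ^ (θ - 1)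
  time : ∀ P ∈ upper d, |coordDeriv (some (Fin.last d)) F P| ≤ B * P.1 ^ (θ - ν)

lemma wt_eq_one (hμ1 : ∀ i, i ≠ Fin.last d → μ i = 1) {c : Option (Fin (d + 1))}
    (hc : c ≠ some (Fin.last d)) : wt μ c = 1 := by
  rcases c with _ | i
  · rfl
  · exact hμ1 i fun h => hc (by rw [h])

lemma ord_cons (c : Option (Fin (d + 1))) (L : List (Option (Fin (d + 1)))) :
    ord μ (c :: L) = wt μ c + ord μ L := by simp [ord]

lemma exists_bound_of_finite {ι : Type*} [Finite ι] {S : ι → ((Fin (d + 1) → ℝ) → ℝ) → ℝ → Prop}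
    (hmono : ∀ i V B B', B ≤ B' → S i V B → S i V B')
    (h : ∀ i, ∃ C : ℝ, 0 ≤ C ∧ ∀ V A, Controlled p τ V A → S i V (C * A)) :
    ∃ C : ℝ, 0 ≤ C ∧ ∀ V A, Controlled p τ V A → ∀ i, S i V (C * A) := by
  cases nonempty_fintype ι
  choose C hC0 hC using h
  refine ⟨∑ i, C i, Finset.sum_nonneg fun i _ => hC0 i, fun V A hV i => ?_⟩
  refine hmono i V _ _ ?_ (hC i V A hV)
  exact mul_le_mul_of_nonneg_right (Finset.single_le_sum (fun i _ => hC0 i) (Finset.mem_univ i))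
    hV.nonneg

lemma exists_space_bound (hμ : ∀ i, 0 < μ i) (hμ1 : ∀ i, i ≠ Fin.last d → μ i = 1)
    (hτ : ∀ i, 0 ≤ τ i) (ha : ∀ i, μ i * (p i + τ i) = a) (hφ : IsMollifier p φ)
    (L : List (Option (Fin (d + 1)))) {e : ℝ} (he0 : e < 0)
    (he : e ≤ a - ord μ L - 1) :
    ∃ C : ℝ, 0 ≤ C ∧ ∀ V A, Controlled p τ V A → ∀ c, c ≠ some (Fin.last d) → ∀ P ∈ upper d,
      |coordDeriv c (listDeriv L (upperExt μ φ V)) P| ≤ C * A * P.1 ^ e := by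
  refine exists_bound_of_finite (S := fun c V B => c ≠ some (Fin.last d) → ∀ P ∈ upper d,
      |coordDeriv c (listDeriv L (upperExt μ φ V)) P| ≤ B * P.1 ^ e) ?_ ?_
  · intro c V B B' hB h hc P hP
    have hP' : 0 < P.1 := hP
    exact (h hc P hP).trans (by gcongr)
  · intro c
    by_cases hc : c = some (Fin.last d)
    · exact ⟨0, le_rfl, fun V A _ h => (h hc).elim⟩
    · obtain ⟨C, hC0, hC⟩ := exists_bound_listDeriv hμ hτ ha hφ (c :: L) he0
        (by rw [ord_cons, wt_eq_one hμ1 hc]; linarith)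
      exact ⟨C, hC0, fun V A hV _ => hC V A hV⟩

/-- Since ord L ≤ ν and a = ν + θ, at least θ of the order remains: D^L is bounded, and one more
derivative blows up no faster than Hölder continuity allows. `hσ` is the compatibility of the
spatial weight with what remains. -/
lemma exists_holderBound_listDeriv (hμ : ∀ i, 0 < μ i) (hμ1 : ∀ i, i ≠ Fin.last d → μ i = 1)
    (hτ : ∀ i, 0 ≤ τ i) (ha : ∀ i, μ i * (p i + τ i) = a) (hφ : IsMollifier p φ)
    (L : List (Option (Fin (d + 1)))) {σ γ θ : ℝ}
    (hθ : 0 < θ) (hθ1 : θ < 1) (hθν : θ < μ (Fin.last d)) (haν : a = μ (Fin.last d) + θ)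
    (hL : ord μ L ≤ μ (Fin.last d)) (hγσ : γ - σ < 1) (hσ : γ - σ ≤ a - ord μ L) :
    ∃ C : ℝ, 0 ≤ C ∧ ∀ V A, Controlled p τ V A →
      HolderBound σ γ θ (μ (Fin.last d)) (listDeriv L (upperExt μ φ V)) (C * A) := by
  obtain ⟨C1, hC1, h1⟩ := exists_sup_bound_listDeriv hμ hτ ha hφ L (by linarith)
  obtain ⟨C2, hC2, h2⟩ := exists_space_bound hμ hμ1 hτ ha hφ L (e := γ - σ - 1) (by linarith)
    (by linarith)
  obtain ⟨C3, hC3, h3⟩ := exists_space_bound hμ hμ1 hτ ha hφ L (e := θ - 1) (by linarith)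
    (by linarith)
  obtain ⟨C4, hC4, h4⟩ := exists_bound_listDeriv hμ hτ ha hφ (some (Fin.last d) :: L)
    (e := θ - μ (Fin.last d)) (by linarith) (by rw [ord_cons, wt]; linarith)
  refine ⟨C1 + C2 + C3 + C4, by positivity, fun V A hV => ?_⟩
  have hA := hV.nonneg
  refine ⟨fun P hP => differentiableAt_upper
      (contDiffOn_listDeriv (contDiffOn_upperExt hμ hφ hV.continuous) L) hP,
    fun P hP => (h1 V A hV P hP).trans ?_, fun c hc P hP => (h2 V A hV c hc P hP).trans ?_,
    fun P hP => (h3 V A hV none (by simp) P hP).trans ?_, fun P hP => (h4 V A hV P hP).trans ?_⟩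
  all_goals
    have hP' : 0 < P.1 := hP
    gcongr
    linarith

lemma coordDeriv_rpow_mul {F : ℝ × (Fin (d + 1) → ℝ) → ℝ} {P : ℝ × (Fin (d + 1) → ℝ)}
    (hP : P ∈ upper d) (hF : DifferentiableAt ℝ F P) (κ : ℝ) (c : Option (Fin (d + 1))) :
    DifferentiableAt ℝ (fun P => P.1 ^ κ * F P) P ∧
    coordDeriv c (fun P => P.1 ^ κ * F P) P =
      κ * P.1 ^ (κ - 1) * (coordDir c).1 * F P + P.1 ^ κ * coordDeriv c F P := by
  have h1 := (Real.hasDerivAt_rpow_const (p := κ) (Or.inl (ne_of_gt hP))).comp_hasFDerivAt P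
    (hasFDerivAt_fst (𝕜 := ℝ) (p := P))
  have h2 := h1.mul hF.hasFDerivAt
  have h3 : HasFDerivAt (fun P : ℝ × (Fin (d + 1) → ℝ) => P.1 ^ κ * F P) _ P := h2
  refine ⟨h3.differentiableAt, ?_⟩
  rw [coordDeriv, h3.differentiableAt.lineDeriv_eq_fderiv, h3.fderiv, coordDeriv,
    hF.lineDeriv_eq_fderiv]
  simp
  ring

/-- Here D^L exceeds the order a and is of size z^{θ-κ}; the factor z^κ compensates. `hκ` keeps the
exponent negative, as `exists_bound_listDeriv` demands. -/
lemma exists_holderBound_rpow_mul_listDeriv (hμ : ∀ i, 0 < μ i) (hμ1 : ∀ i, i ≠ Fin.last d → μ i = 1)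
    (hτ : ∀ i, 0 ≤ τ i) (ha : ∀ i, μ i * (p i + τ i) = a) (hφ : IsMollifier p φ)
    (L : List (Option (Fin (d + 1)))) {σ γ θ κ : ℝ}
    (hθ : 0 < θ) (hθ1 : θ < 1) (hθν : θ < μ (Fin.last d)) (haν : a = μ (Fin.last d) + θ)
    (hκ : θ < κ) (hL : ord μ L = μ (Fin.last d) + κ) (hσ : γ - σ = θ) :
    ∃ C : ℝ, 0 ≤ C ∧ ∀ V A, Controlled p τ V A →
      HolderBound σ γ θ (μ (Fin.last d)) (fun P => P.1 ^ κ * listDeriv L (upperExt μ φ V) P)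
        (C * A) := by
  -- The exponent is lowered from θ - κ to -κ so that multiplication by z^κ gives a constant at all
  -- heights.
  obtain ⟨C1, hC1, h1⟩ := exists_bound_listDeriv hμ hτ ha hφ L (e := -κ) (by linarith)
    (by linarith)
  obtain ⟨C2, hC2, h2⟩ := exists_space_bound hμ hμ1 hτ ha hφ L (e := θ - 1 - κ) (by linarith)
    (by linarith)
  obtain ⟨C3, hC3, h3⟩ := exists_bound_listDeriv hμ hτ ha hφ L (e := θ - κ) (by linarith)
    (by linarith)
  obtain ⟨C4, hC4, h4⟩ := exists_bound_listDeriv hμ hτ ha hφ (some (Fin.last d) :: L)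
    (e := θ - μ (Fin.last d) - κ) (by linarith) (by rw [ord_cons, wt]; linarith)
  have hκ0 : 0 < κ := by linarith
  refine ⟨C1 + C2 + κ * C3 + C4, by positivity, fun V A hV => ?_⟩
  have hA := hV.nonneg
  have hd := fun P hP => differentiableAt_upper
    (contDiffOn_listDeriv (contDiffOn_upperExt (μ := μ) hμ hφ hV.continuous) L) (P := P) hP
  have hp : ∀ {z : ℝ}, 0 < z → ∀ x y : ℝ, ∀ {X b : ℝ}, |X| ≤ b * z ^ (y - x) →
      |z ^ x * X| ≤ b * z ^ y := by
    intro z hz x y X b h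
    rw [abs_mul, abs_of_pos (Real.rpow_pos_of_pos hz x)]
    calc z ^ x * |X| ≤ z ^ x * (b * z ^ (y - x)) := by gcongr
      _ = b * (z ^ x * z ^ (y - x)) := by ring
      _ = _ := by rw [← Real.rpow_add hz]; ring_nf
  have hs : ∀ c, c ≠ some (Fin.last d) → ∀ P ∈ upper d,
      |coordDeriv c (fun P => P.1 ^ κ * listDeriv L (upperExt μ φ V) P) P| ≤
        (C1 + C2 + κ * C3 + C4) * A * P.1 ^ (θ - 1) := by
    intro c hc P hP
    have hP' : 0 < P.1 := hP
    rw [(coordDeriv_rpow_mul hP (hd P hP) κ c).2]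
    have b1 : |κ * P.1 ^ (κ - 1) * (coordDir c).1 * listDeriv L (upperExt μ φ V) P| ≤
        κ * (C3 * A * P.1 ^ (θ - 1)) := by
      have hc1 : |(coordDir c).1| ≤ 1 := by
        rcases c with _ | i <;> simp [coordDir]
      have := hp hP' (κ - 1) (θ - 1) (X := listDeriv L (upperExt μ φ V) P) (b := C3 * A)
        (by convert h3 V A hV P hP using 3; ring)
      calc _ = κ * |(coordDir c).1| * |P.1 ^ (κ - 1) * listDeriv L (upperExt μ φ V) P| := by
            simp only [abs_mul, abs_of_pos hκ0]; ring
        _ ≤ κ * 1 * (C3 * A * P.1 ^ (θ - 1)) := by gcongr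
        _ = _ := by ring
    have b2 := hp hP' κ (θ - 1) (X := coordDeriv c (listDeriv L (upperExt μ φ V)) P)
      (b := C2 * A) (h2 V A hV c hc P hP)
    calc _ ≤ _ := abs_add_le _ _
      _ ≤ κ * (C3 * A * P.1 ^ (θ - 1)) + C2 * A * P.1 ^ (θ - 1) := add_le_add b1 b2
      _ = (C2 + κ * C3) * A * P.1 ^ (θ - 1) := by ring
      _ ≤ _ := by
        gcongr ?_ * _ * _
        linarith
  refine ⟨fun P hP => (coordDeriv_rpow_mul hP (hd P hP) κ none).1, fun P hP => ?_,
    fun c hc P hP => ?_, fun P hP => hs none (by simp) P hP, fun P hP => ?_⟩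
  · have := hp hP κ 0 (X := listDeriv L (upperExt μ φ V) P) (b := C1 * A)
      (by convert h1 V A hV P hP using 3; ring)
    rw [Real.rpow_zero, mul_one] at this
    refine this.trans ?_
    gcongr
    have := mul_nonneg hκ0.le hC3
    linarith
  · rw [hσ]; exact hs c hc P hP
  · rw [(coordDeriv_rpow_mul hP (hd P hP) κ _).2]
    have hP' : 0 < P.1 := hP
    have b2 := hp hP' κ (θ - μ (Fin.last d)) (b := C4 * A) (h4 V A hV P hP)
    simp only [coordDir, mul_zero, zero_mul, zero_add]
    refine b2.trans ?_
    gcongr ?_ * _ * _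
    have := mul_nonneg hκ0.le hC3
    linarith

/-! ### Behaviour at the boundary -/

/-- The extension of `V` to the closed half space. -/
def fullExt (μ : Fin (d + 1) → ℝ) (φ : Fin (d + 1) → ℝ → ℝ) (V : (Fin (d + 1) → ℝ) → ℝ)
    (P : ℝ × (Fin (d + 1) → ℝ)) : ℝ :=
  if 0 < P.1 then upperExt μ φ V P else V P.2

lemma fullExt_eqOn {V : (Fin (d + 1) → ℝ) → ℝ} : EqOn (fullExt μ φ V) (upperExt μ φ V) (upper d) :=
  fun _ hP => if_pos hP

lemma fullExt_of_nonpos {V : (Fin (d + 1) → ℝ) → ℝ} {P : ℝ × (Fin (d + 1) → ℝ)} (h : P.1 ≤ 0) :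
    fullExt μ φ V P = V P.2 := if_neg h.not_gt

lemma mollify_sub_const (hφ : IsMollifier p φ) {V : (Fin (d + 1) → ℝ) → ℝ} (hV : Continuous V)
    (hVs : HasCompactSupport V) (c : ℝ) {P : ℝ × (Fin (d + 1) → ℝ)} (hP : 0 < P.1) :
    mollify μ V φ P - c = mollify μ (fun q => V q - c) φ P := by
  have hi : Integrable fun q => prodKer μ φ P.1 (P.2 - q) := by
    have hc : Continuous fun q => prodKer μ φ P.1 (P.2 - q) :=
      (continuous_prodKer hφ.test P.1).comp (by fun_prop)
    exact (integrable_norm_iff hc.aestronglyMeasurable).1 (integrable_abs_prodKer hφ.test hP P.2)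
  simp only [mollify, sub_mul]
  rw [integral_sub (integrable_mul_prodKer hφ.test hV hVs P) (hi.const_mul c), integral_const_mul,
    integral_prodKer hP]
  simp [hφ.mass]

/-- At the boundary the kernel has mass 1 and shrinks to a point, so its average of V minus the
boundary value tends to zero. The L¹ norm M may exceed 1, as the kernel changes sign, hence the
tolerance ε/(M+1). -/
lemma continuousOn_fullExt (hμ : ∀ i, 0 < μ i) (hφ : IsMollifier p φ) {V : (Fin (d + 1) → ℝ) → ℝ}
    (hV : Continuous V) (hVs : HasCompactSupport V) :
    ContinuousOn (fullExt μ φ V) {P | 0 ≤ P.1} := by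
  intro P₀ hP₀
  rcases (show 0 ≤ P₀.1 from hP₀).lt_or_eq with h0 | h0
  · have h1 := (contDiffOn_upperExt hμ hφ hV).continuousOn.continuousAt
      (isOpen_upper.mem_nhds (show P₀ ∈ upper d from h0))
    refine (h1.congr ?_).continuousWithinAt
    filter_upwards [isOpen_upper.mem_nhds (show P₀ ∈ upper d from h0)] with P hP
      using (fullExt_eqOn hP).symm
  · obtain ⟨ρ, hρ0, hρ⟩ := exists_abs_le_of_prodKer_ne_zero (μ := μ) hφ.test
    set M := ∏ i, ∫ s, |φ i s|
    have hM : 0 ≤ M := Finset.prod_nonneg fun i _ => integral_nonneg fun s => abs_nonneg _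
    have hval : fullExt μ φ V P₀ = V P₀.2 := fullExt_of_nonpos h0.symm.le
    rw [ContinuousWithinAt, hval, Metric.tendsto_nhds]
    intro ε hε
    obtain ⟨η, hη, hVη⟩ := Metric.continuousAt_iff.1 (hV.continuousAt (x := P₀.2)) (ε / (M + 1))
      (by positivity)
    have hz : ∀ i, ∀ᶠ P in 𝓝[{P | 0 ≤ P.1}] P₀, ρ * P.1 ^ μ i < η / 2 := by
      intro i
      have hc : Continuous fun P : ℝ × (Fin (d + 1) → ℝ) => ρ * P.1 ^ μ i :=
        continuous_const.mul (continuous_fst.rpow_const fun _ => Or.inr (hμ i).le)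
      have := hc.tendsto P₀
      rw [← h0, Real.zero_rpow (hμ i).ne', mul_zero] at this
      exact nhdsWithin_le_nhds (this.eventually_lt_const (half_pos hη))
    have h1 : ∀ᶠ P in 𝓝[{P : ℝ × (Fin (d + 1) → ℝ) | 0 ≤ P.1}] P₀, P.1 < 1 :=
      nhdsWithin_le_nhds ((continuous_fst.tendsto P₀).eventually_lt_const (by rw [← h0]; norm_num))
    have h2 : ∀ᶠ P in 𝓝[{P : ℝ × (Fin (d + 1) → ℝ) | 0 ≤ P.1}] P₀, dist P.2 P₀.2 < η / 2 :=
      nhdsWithin_le_nhds ((continuous_snd.tendsto P₀).eventually (Metric.ball_mem_nhds _ (half_pos hη)))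
    filter_upwards [eventually_all.2 hz, h1, h2, self_mem_nhdsWithin] with P hP1 hP2 hP3 hP4
    rcases (show 0 ≤ P.1 from hP4).lt_or_eq with hp | hp
    · rw [fullExt_eqOn (show P ∈ upper d from hp), upperExt, cutoff_of_le hP2.le, one_mul,
        Real.dist_eq, mollify_sub_const hφ hV hVs _ hp]
      refine (abs_mollify_le hφ.test hp (A := ε / (M + 1)) fun q hq => ?_).trans_lt ?_
      · refine le_of_lt (hVη ?_)
        have hq' : dist q P.2 ≤ η / 2 := by
          rw [dist_comm, dist_pi_le_iff (by positivity)]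
          exact fun i => (hρ _ hp _ hq i).trans (hP1 i).le
        calc dist q P₀.2 ≤ dist q P.2 + dist P.2 P₀.2 := dist_triangle _ _ _
          _ < η := by linarith
      · rw [div_mul_eq_mul_div, div_lt_iff₀ (by positivity)]
        nlinarith
    · rw [fullExt_of_nonpos hp.symm.le]
      refine (hVη (by linarith)).trans_le (div_le_self hε.le (by linarith))

lemma coordDeriv_fullExt_of_nonpos {V : (Fin (d + 1) → ℝ) → ℝ} {P : ℝ × (Fin (d + 1) → ℝ)}
    (h : P.1 ≤ 0) (i : Fin (d + 1)) :
    coordDeriv (some i) (fullExt μ φ V) P = deriv (fun s : ℝ => V (P.2 + s • Pi.single i 1)) 0 := by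
  rw [coordDeriv, lineDeriv]
  congr 1; ext s
  rw [fullExt_of_nonpos (by simpa [coordDir] using h)]
  simp [coordDir]

/-- If the derivative in a tangential direction is uniformly Hölder continuous up to the boundary,
then it converges to that of the boundary value. -/
lemma tendsto_coordDeriv_fullExt (hμ : ∀ i, 0 < μ i) (hφ : IsMollifier p φ)
    {V : (Fin (d + 1) → ℝ) → ℝ} (hV : Continuous V) (hVs : HasCompactSupport V) {i : Fin (d + 1)}
    {C β : ℝ} (hβ : 0 < β)
    (hH : ∀ P ∈ upper d, ∀ h : ℝ, |coordDeriv (some i) (upperExt μ φ V) (P + h • coordDir (some i)) -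
      coordDeriv (some i) (upperExt μ φ V) P| ≤ C * |h| ^ β)
    {P : ℝ × (Fin (d + 1) → ℝ)} (hP : 0 ≤ P.1)
    (hd : DifferentiableAt ℝ (fun s : ℝ => V (P.2 + s • Pi.single i 1)) 0) :
    Tendsto (fun z => coordDeriv (some i) (fullExt μ φ V) (P.1 + z, P.2)) (𝓝[>] 0)
      (𝓝 (coordDeriv (some i) (fullExt μ φ V) P)) := by
  have hsm := contDiffOn_upperExt (μ := μ) hμ hφ hV
  have hvert : Tendsto (fun z : ℝ => (P.1 + z, P.2)) (𝓝[>] 0) (𝓝[{P | 0 ≤ P.1}] P) := by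
    refine tendsto_nhdsWithin_iff.2 ⟨?_, ?_⟩
    · have : Continuous fun z : ℝ => (P.1 + z, P.2) := by fun_prop
      have := this.tendsto 0
      simp only [add_zero] at this
      exact this.mono_left nhdsWithin_le_nhds
    · filter_upwards [self_mem_nhdsWithin] with z hz
      exact add_nonneg hP (le_of_lt hz)
  rcases hP.lt_or_eq with h0 | h0
  · have hPu : P ∈ upper d := h0
    have hc : ContinuousAt (coordDeriv (some i) (fullExt μ φ V)) P :=
      ((contDiffOn_coordDeriv hsm).congr (coordDeriv_congr isOpen_upper fullExt_eqOn)).continuousOn.continuousAt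
        (isOpen_upper.mem_nhds hPu)
    exact hc.tendsto.comp (hvert.mono_right nhdsWithin_le_nhds)
  · rw [coordDeriv_fullExt_of_nonpos h0.symm.le, ← h0, Metric.tendsto_nhds]
    simp only [zero_add]
    intro ε hε
    set g : ℝ → ℝ := fun s => V (P.2 + s • Pi.single i 1) with hg
    have ev1 : ∀ᶠ h in 𝓝[>] (0 : ℝ), |h⁻¹ * (g h - g 0) - deriv g 0| < ε / 3 := by
      have := hd.hasDerivAt.tendsto_slope_zero_right
      -- Fix one step h good both for the difference quotient of V and for the Hölder modulus; for
      -- that h the quotients at height z converge to the quotient on the boundary.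
      have := (Metric.tendsto_nhds.1 this) (ε / 3) (by positivity)
      simpa [Real.dist_eq] using this
    have ev2 : ∀ᶠ h in 𝓝[>] (0 : ℝ), C * |h| ^ β < ε / 3 := by
      have hc : Continuous fun h : ℝ => C * |h| ^ β :=
        continuous_const.mul (continuous_abs.rpow_const fun _ => Or.inr hβ.le)
      have := hc.tendsto 0
      rw [abs_zero, Real.zero_rpow hβ.ne', mul_zero] at this
      exact nhdsWithin_le_nhds (this.eventually_lt_const (by positivity))
    obtain ⟨h, hh1, hh2, hh0⟩ := (ev1.and (ev2.and self_mem_nhdsWithin)).exists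
    have hh0 : 0 < h := hh0
    have hlim : ∀ s : ℝ, Tendsto (fun z => fullExt μ φ V (z, P.2 + s • Pi.single i 1)) (𝓝[>] 0)
        (𝓝 (g s)) := by
      intro s
      have h1 := continuousOn_fullExt hμ hφ hV hVs (0, P.2 + s • Pi.single i 1)
        (le_refl (0 : ℝ))
      rw [ContinuousWithinAt, fullExt_of_nonpos le_rfl] at h1
      refine h1.comp (tendsto_nhdsWithin_iff.2 ⟨?_, ?_⟩)
      · have : Continuous fun z : ℝ => (z, P.2 + s • Pi.single i (1 : ℝ)) := by fun_prop
        exact (this.tendsto 0).mono_left nhdsWithin_le_nhds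
      · filter_upwards [self_mem_nhdsWithin] with z hz
        exact le_of_lt hz
    have hlim2 := ((hlim h).sub (hlim 0)).const_mul h⁻¹
    have ev3 := (Metric.tendsto_nhds.1 hlim2) (ε / 3) (by positivity)
    filter_upwards [ev3, self_mem_nhdsWithin] with z hz hz0
    have hz0 : 0 < z := hz0
    have hQ : (z, P.2) ∈ upper d := hz0
    have hder : ∀ s, HasDerivAt (fun s : ℝ => fullExt μ φ V (z, P.2 + s • Pi.single i 1))
        (coordDeriv (some i) (upperExt μ φ V) ((z, P.2) + s • coordDir (some i))) s := by
      intro s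
      have hmem : (z, P.2) + s • coordDir (some i) ∈ upper d := by
        simpa [upper, coordDir] using hz0
      have hdF := differentiableAt_upper hsm hmem
      have h1 : HasDerivAt (fun s : ℝ => (z, P.2) + s • coordDir (some i)) (coordDir (some i)) s := by
        simpa using ((hasDerivAt_id' s).smul_const (coordDir (some i))).const_add (z, P.2)
      have h2 := hdF.hasFDerivAt.comp_hasDerivAt s h1
      rw [coordDeriv, hdF.lineDeriv_eq_fderiv]
      refine h2.congr_of_eventuallyEq (Eventually.of_forall fun s' => ?_)
      have hmem' : (z, P.2) + s' • coordDir (some i) ∈ upper d := by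
        simpa [upper, coordDir] using hz0
      have e : ((z, P.2) : ℝ × (Fin (d + 1) → ℝ)) + s' • coordDir (some i) =
          (z, P.2 + s' • Pi.single i 1) := by ext <;> simp [coordDir]
      rw [Function.comp, ← fullExt_eqOn hmem', e]
    -- The quotient at height z is a derivative at an intermediate point, within C h^β of the
    -- derivative at the base point, uniformly in z.
    obtain ⟨ξ, hξ, hslope⟩ := exists_hasDerivAt_eq_slope _ _ hh0
      (fun s _ => (hder s).continuousAt.continuousWithinAt) fun s _ => hder s
    have hC0 : 0 ≤ C := by
      have := (abs_nonneg _).trans (hH _ hQ 1)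
      simpa using this
    have b1 : |coordDeriv (some i) (upperExt μ φ V) (z, P.2) - h⁻¹ *
        (fullExt μ φ V (z, P.2 + h • Pi.single i 1) - fullExt μ φ V (z, P.2 + (0 : ℝ) • Pi.single i 1))|
        < ε / 3 := by
      rw [sub_zero] at hslope
      rw [inv_mul_eq_div, ← hslope, abs_sub_comm]
      refine (hH _ hQ ξ).trans_lt (lt_of_le_of_lt ?_ hh2)
      rw [abs_of_pos hξ.1, abs_of_pos hh0]
      have := Real.rpow_le_rpow hξ.1.le hξ.2.le hβ.le
      gcongr
    rw [coordDeriv_congr isOpen_upper fullExt_eqOn hQ]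
    rw [Real.dist_eq] at hz ⊢
    rw [abs_lt] at *
    constructor <;> linarith [b1.1, b1.2, hz.1, hz.2, hh1.1, hh1.2]

end

section

/-! ### Coordinates on space-time -/

variable {d : ℕ}

/-- The coordinates of a point of `ℝ^{d+1} × ℝ`: the normal one, and the tangential ones followed
by time. -/
def toCoord (p : SpaceTime (d + 1)) : ℝ × (Fin (d + 1) → ℝ) :=
  (p.1 (Fin.last d), fun i => Fin.lastCases p.2 (fun j : Fin d => p.1 j.castSucc) i)

/-- The point of `ℝ^d × ℝ` with given coordinates, time being the last one. -/
def ofCoord (q : Fin (d + 1) → ℝ) : SpaceTime d :=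
  (WithLp.toLp 2 fun i : Fin d => q i.castSucc, q (Fin.last d))

/-- The tangential and time directions of `ℝ^d × ℝ`. -/
def bdryDir (i : Fin (d + 1)) : SpaceTime d := Fin.lastCases timeDir (fun j => spaceDir j) i

/-- The coordinate direction that corresponds to a spatial variable. -/
def spaceIdx (i : Fin (d + 1)) : Option (Fin (d + 1)) :=
  Fin.lastCases none (fun j : Fin d => some j.castSucc) i

lemma spaceIdx_ne_last (i : Fin (d + 1)) : spaceIdx i ≠ some (Fin.last d) := by
  refine Fin.lastCases ?_ (fun j => ?_) i
  · simp [spaceIdx]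
  · simp [spaceIdx, Fin.castSucc_ne_last]

lemma toCoord_add_spaceDir (p : SpaceTime (d + 1)) (i : Fin (d + 1)) (s : ℝ) :
    toCoord (p + s • spaceDir i) = toCoord p + s • coordDir (spaceIdx i) := by
  refine Prod.ext ?_ (funext fun k => ?_)
  · refine Fin.lastCases ?_ (fun j => ?_) i
    · simp [toCoord, spaceIdx, coordDir, spaceDir]
    · simp [toCoord, spaceIdx, coordDir, spaceDir, (Fin.castSucc_ne_last j).symm]
  · refine Fin.lastCases ?_ (fun l => ?_) k <;> refine Fin.lastCases ?_ (fun j => ?_) i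
    · simp [toCoord, spaceIdx, coordDir, spaceDir]
    · simp [toCoord, spaceIdx, coordDir, spaceDir, (Fin.castSucc_ne_last j).symm]
    · simp [toCoord, spaceIdx, coordDir, spaceDir, Fin.castSucc_ne_last]
    · simp [toCoord, spaceIdx, coordDir, spaceDir, Pi.single_apply]

lemma toCoord_add_timeDir (p : SpaceTime (d + 1)) (s : ℝ) :
    toCoord (p + s • timeDir) = toCoord p + s • coordDir (some (Fin.last d)) := by
  refine Prod.ext ?_ (funext fun k => ?_)
  · simp [toCoord, coordDir, timeDir]
  · refine Fin.lastCases ?_ (fun l => ?_) k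
    · simp [toCoord, coordDir, timeDir]
    · simp [toCoord, coordDir, timeDir, Fin.castSucc_ne_last]

/-- Line derivatives only see lines, which `toCoord` maps to lines; no differentiability of F is
needed. -/
lemma dirDeriv_spaceDir_comp (F : ℝ × (Fin (d + 1) → ℝ) → ℝ) (i : Fin (d + 1)) :
    dirDeriv (spaceDir i) (F ∘ toCoord) = coordDeriv (spaceIdx i) F ∘ toCoord := by
  ext p
  simp only [dirDeriv, coordDeriv, lineDeriv, Function.comp, toCoord_add_spaceDir]

lemma dirDeriv_timeDir_comp (F : ℝ × (Fin (d + 1) → ℝ) → ℝ) :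
    dirDeriv timeDir (F ∘ toCoord) = coordDeriv (some (Fin.last d)) F ∘ toCoord := by
  ext p
  simp only [dirDeriv, coordDeriv, lineDeriv, Function.comp, toCoord_add_timeDir]

lemma contDiff_toCoord : ContDiff ℝ ∞ (toCoord : SpaceTime (d + 1) → _) := by
  have h : ∀ i : Fin (d + 1), ContDiff ℝ ∞ fun p : SpaceTime (d + 1) => p.1 i := by
    intro i; fun_prop
  refine (h _).prodMk (contDiff_pi.2 fun k => ?_)
  refine Fin.lastCases ?_ (fun l => ?_) k
  · simpa using contDiff_snd
  · simpa using h l.castSucc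

lemma ofCoord_toCoord (p : SpaceTime (d + 1)) :
    ofCoord (toCoord p).2 = (tangential p.1, p.2) := by
  simp [ofCoord, toCoord, tangential]

lemma norm_toCoord_sub_le (x y : EuclideanSpace ℝ (Fin (d + 1))) (t : ℝ) :
    ‖toCoord (x, t) - toCoord (y, t)‖ ≤ ‖x - y‖ := by
  have h : ∀ i, |x i - y i| ≤ ‖x - y‖ := fun i => PiLp.norm_apply_le (x - y) i
  refine norm_prod_le_iff.2 ⟨h _, (pi_norm_le_iff_of_nonneg (norm_nonneg _)).2 fun k => ?_⟩
  refine Fin.lastCases ?_ (fun l => ?_) k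
  · simp [toCoord]
  · simpa [toCoord] using h l.castSucc

lemma ofCoord_update (q : Fin (d + 1) → ℝ) (i : Fin (d + 1)) (r : ℝ) :
    ofCoord (Function.update q i r) = ofCoord (Function.update q i 0) + r • bdryDir i := by
  refine Prod.ext (PiLp.ext fun l => ?_) ?_ <;> refine Fin.lastCases ?_ (fun j => ?_) i
  · simp [ofCoord, bdryDir, timeDir, Fin.castSucc_ne_last]
  · by_cases h : l = j
    · subst h; simp [ofCoord, bdryDir, spaceDir]
    · simp [ofCoord, bdryDir, spaceDir, h]
  · simp [ofCoord, bdryDir, timeDir]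
  · simp [ofCoord, bdryDir, spaceDir, (Fin.castSucc_ne_last j).symm]

lemma continuous_ofCoord : Continuous (ofCoord : (Fin (d + 1) → ℝ) → SpaceTime d) := by
  unfold ofCoord; fun_prop

/-! ### The anisotropic norm controls boundary data -/

lemma iteratedDeriv_line {k : ℕ} (e : SpaceTime k) (v : SpaceTime k → ℝ) (P : SpaceTime k) (j : ℕ) :
    iteratedDeriv j (fun s : ℝ => v (P + s • e)) = fun r => (dirDeriv e)^[j] v (P + r • e) := by
  induction j with
  | zero => simp
  | succ j ih =>
    ext r
    rw [iteratedDeriv_succ, ih, Function.iterate_succ_apply', dirDeriv, lineDeriv]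
    have := deriv_comp_const_add (fun s => (dirDeriv e)^[j] v (P + s • e)) r 0
    rw [add_zero] at this
    rw [← this]
    congr 1; ext s
    rw [add_smul, add_assoc]

lemma abs_sub_le_of_dirSeminorm {k : ℕ} {e : SpaceTime k} {l : ℝ} {v : SpaceTime k → ℝ} {A : ℝ}
    (hA : 0 ≤ A) (h : dirSeminorm e l v ≤ ENNReal.ofReal A) (P : SpaceTime k) (r s : ℝ) :
    |(dirDeriv e)^[⌊l⌋₊] v (P + r • e) - (dirDeriv e)^[⌊l⌋₊] v (P + s • e)| ≤
      A * |r - s| ^ (l - ⌊l⌋₊) := by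
  have key : ∀ r s : ℝ, s < r →
      |(dirDeriv e)^[⌊l⌋₊] v (P + r • e) - (dirDeriv e)^[⌊l⌋₊] v (P + s • e)| ≤
      A * |r - s| ^ (l - ⌊l⌋₊) := by
    intro r s hrs
    have hpos : 0 < r - s := sub_pos.2 hrs
    have h1 : ENNReal.ofReal (|(dirDeriv e)^[⌊l⌋₊] v (P + s • e + (r - s) • e) -
        (dirDeriv e)^[⌊l⌋₊] v (P + s • e)| / (r - s) ^ (l - ⌊l⌋₊)) ≤ ENNReal.ofReal A :=
      le_trans (le_iSup_of_le (P + s • e) (le_iSup_of_le (r - s)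
        (le_iSup (fun _ : 0 < r - s => _) hpos))) h
    rw [ENNReal.ofReal_le_ofReal_iff hA, div_le_iff₀ (Real.rpow_pos_of_pos hpos _), add_assoc,
      ← add_smul, add_sub_cancel] at h1
    rwa [abs_of_pos hpos]
  rcases lt_trichotomy s r with h1 | h1 | h1
  · exact key r s h1
  · subst h1
    simp only [sub_self, abs_zero]
    positivity
  · rw [abs_sub_comm, abs_sub_comm r s]
    exact key s r h1

/-- The numbers of derivatives in the coordinates. -/
def bdryOrder (d : ℕ) (a b : ℝ) (i : Fin (d + 1)) : ℕ := if i = Fin.last d then ⌊b⌋₊ else ⌊a⌋₊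

/-- The Hölder exponents in the coordinates. -/
def bdryExp (d : ℕ) (a b : ℝ) (i : Fin (d + 1)) : ℝ :=
  if i = Fin.last d then b - ⌊b⌋₊ else a - ⌊a⌋₊

/-- Each summand of the norm controls one condition of `Controlled`, after restriction to coordinate
lines. -/
lemma controlled_of_memAniso {a b : ℝ} {v : SpaceTime d → ℝ} (hv : MemAniso a b v)
    (hs : HasCompactSupport (v ∘ ofCoord)) :
    Controlled (bdryOrder d a b) (bdryExp d a b) (v ∘ ofCoord) (anisoNorm a b v).toReal := by
  have hA : ENNReal.ofReal (anisoNorm a b v).toReal = anisoNorm a b v :=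
    ENNReal.ofReal_toReal hv.norm_lt_top.ne
  have hupd : ∀ (i : Fin (d + 1)) (q : Fin (d + 1) → ℝ),
      (fun r => (v ∘ ofCoord) (Function.update q i r)) =
        fun r => v (ofCoord (Function.update q i 0) + r • bdryDir i) := fun i q => by
    ext r; rw [Function.comp, ofCoord_update]
  refine ⟨hv.continuous.comp continuous_ofCoord, hs, fun q => ?_, fun i q => ?_, fun i q r s => ?_⟩
  · have h1 : ‖v (ofCoord q)‖ₑ ≤ ENNReal.ofReal (anisoNorm a b v).toReal := by
      rw [hA, anisoNorm, add_assoc]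
      exact le_add_right (le_iSup (fun p => ‖v p‖ₑ) _)
    rwa [← ofReal_norm, ENNReal.ofReal_le_ofReal_iff ENNReal.toReal_nonneg] at h1
  · rw [hupd]
    refine Fin.lastCases ?_ (fun j => ?_) i
    · simpa [bdryOrder, bdryDir] using hv.time_contDiff _
    · simpa [bdryOrder, bdryDir, Fin.castSucc_ne_last] using hv.space_contDiff j _
  · rw [hupd]
    refine Fin.lastCases ?_ (fun j => ?_) i
    · simp only [bdryOrder, bdryDir, bdryExp, if_true, Fin.lastCases_last, iteratedDeriv_line]
      refine abs_sub_le_of_dirSeminorm ENNReal.toReal_nonneg ?_ _ r s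
      rw [hA, anisoNorm]
      exact le_add_self
    · simp only [bdryOrder, bdryDir, bdryExp, Fin.castSucc_ne_last, if_false, Fin.lastCases_castSucc,
        iteratedDeriv_line]
      refine abs_sub_le_of_dirSeminorm ENNReal.toReal_nonneg ?_ _ r s
      rw [hA, anisoNorm]
      refine le_add_right (le_add_left ?_)
      exact Finset.single_le_sum (f := fun i : Fin d => dirSeminorm (spaceDir i) a v)
        (fun _ _ => zero_le) (Finset.mem_univ j)

/-! ### Multi-index derivatives as iterated derivatives along lists -/

/-- Only the length of the list matters afterwards, since all spatial directions have weight 1. -/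
lemma exists_list_multiDeriv {k : ℕ} (α : Fin k → ℕ) :
    ∃ L : List (Fin k), L.length = ∑ i, α i ∧
      ∀ f : SpaceTime k → ℝ, multiDeriv α f = L.foldr (fun i => dirDeriv (spaceDir i)) f := by
  have h : ∀ l : List (Fin k), ∃ L : List (Fin k), L.length = (l.map α).sum ∧
      ∀ f : SpaceTime k → ℝ, l.foldr (fun i g => (dirDeriv (spaceDir i))^[α i] g) f =
        L.foldr (fun i => dirDeriv (spaceDir i)) f := by
    intro l
    induction l with
    | nil => exact ⟨[], rfl, fun f => rfl⟩
    | cons i l ih =>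
      obtain ⟨L, hL, hf⟩ := ih
      refine ⟨List.replicate (α i) i ++ L, by simp [hL], fun f => ?_⟩
      rw [List.foldr_cons, hf, List.foldr_append]
      induction α i with
      | zero => rfl
      | succ j ihj => rw [Function.iterate_succ_apply', ihj, List.replicate_succ, List.foldr_cons]
  obtain ⟨L, hL, hf⟩ := h (List.finRange k)
  exact ⟨L, by rw [hL, Fin.sum_univ_def], hf⟩

lemma isOpen_openQ : IsOpen (openQ d) := by
  have : Continuous fun p : SpaceTime (d + 1) => p.1 (Fin.last d) := by fun_prop
  exact isOpen_lt continuous_const this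

lemma foldr_dirDeriv_congr {f g : SpaceTime (d + 1) → ℝ} (h : EqOn f g (openQ d))
    (L : List (Fin (d + 1))) :
    EqOn (L.foldr (fun i => dirDeriv (spaceDir i)) f) (L.foldr (fun i => dirDeriv (spaceDir i)) g)
      (openQ d) := by
  induction L with
  | nil => exact h
  | cons i L ih =>
    exact fun p hp => (ih.eventuallyEq_of_mem (isOpen_openQ.mem_nhds hp)).lineDeriv_eq

lemma foldr_dirDeriv_comp (F : ℝ × (Fin (d + 1) → ℝ) → ℝ) (L : List (Fin (d + 1))) :
    L.foldr (fun i => dirDeriv (spaceDir i)) (F ∘ toCoord) =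
      listDeriv (L.map spaceIdx) F ∘ toCoord := by
  induction L with
  | nil => rfl
  | cons i L ih => rw [List.foldr_cons, ih, dirDeriv_spaceDir_comp]; rfl

lemma ord_map_spaceIdx {μ : Fin (d + 1) → ℝ} (hμ1 : ∀ i, i ≠ Fin.last d → μ i = 1)
    (L : List (Fin (d + 1))) : ord μ (L.map spaceIdx) = L.length := by
  induction L with
  | nil => simp [ord]
  | cons i L ih =>
    rw [List.map_cons, ord_cons, ih, wt_eq_one hμ1 (spaceIdx_ne_last i)]
    push_cast [List.length_cons]; ring

/-! ### Estimates of the weighted Hölder norms -/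

lemma holderNormOn_le {S : Set (SpaceTime (d + 1))} {m : ℕ} {σ γ : ℝ} {f : SpaceTime (d + 1) → ℝ}
    {B₁ B₂ B₃ : ℝ} (h1 : 0 ≤ B₁) (h2 : 0 ≤ B₂) (h3 : 0 ≤ B₃) (hsup : ∀ p ∈ S, |f p| ≤ B₁)
    (hx : ∀ x y t, (x, t) ∈ S → (y, t) ∈ S →
      max (x (Fin.last d)) (y (Fin.last d)) ^ σ * |f (x, t) - f (y, t)| ≤ B₂ * ‖x - y‖ ^ γ)
    (ht : ∀ x t s, (x, t) ∈ S → (x, s) ∈ S → |f (x, t) - f (x, s)| ≤ B₃ * |t - s| ^ (γ / m)) :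
    holderNormOn S m σ γ f ≤ ENNReal.ofReal (B₁ + B₂ + B₃) := by
  rw [ENNReal.ofReal_add (by positivity) h3, ENNReal.ofReal_add h1 h2]
  refine add_le_add (add_le_add ?_ ?_) ?_
  · refine iSup₂_le fun p hp => ?_
    rw [← ofReal_norm]
    exact ENNReal.ofReal_le_ofReal (hsup p hp)
  · refine iSup_le fun t => iSup_le fun x => iSup_le fun y => iSup₂_le fun hx' hy' => ?_
    refine ENNReal.ofReal_le_ofReal ?_
    rw [← mul_div_assoc]
    -- Coinciding points are harmless: the quotient by zero is zero.
    exact div_le_of_le_mul₀ (by positivity) h2 (hx x y t hx' hy')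
  · refine iSup_le fun x => iSup_le fun t => iSup_le fun s => iSup₂_le fun hx' hy' => ?_
    exact ENNReal.ofReal_le_ofReal (div_le_of_le_mul₀ (by positivity) h3 (ht x t s hx' hy'))

lemma toCoord_time (x : EuclideanSpace ℝ (Fin (d + 1))) (t : ℝ) :
    (toCoord (x, t)).2 (Fin.last d) = t := by simp [toCoord]

lemma toCoord_change_time (x : EuclideanSpace ℝ (Fin (d + 1))) (t s : ℝ) :
    toCoord (x, t) = toCoord (x, s) + (t - s) • coordDir (some (Fin.last d)) := by
  rw [← toCoord_add_timeDir]
  simp [timeDir]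

/-- The constant in the estimate of weighted Hölder norms by derivative bounds. -/
def holderConst (d : ℕ) (σ γ θ : ℝ) : ℝ :=
  1 + 2 * (2 / (γ - σ) + (d + 2)) + (2 / θ + (d + 2))

lemma holderConst_nonneg {σ γ θ : ℝ} (hσγ : σ < γ) (hθ : 0 < θ) : 0 ≤ holderConst d σ γ θ := by
  have : 0 < γ - σ := by linarith
  unfold holderConst; positivity

lemma HolderBound.nonneg {σ γ θ ν B : ℝ} {F : ℝ × (Fin (d + 1) → ℝ) → ℝ}
    (h : HolderBound σ γ θ ν F B) : 0 ≤ B :=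
  (abs_nonneg _).trans (h.sup (1, 0) (show (0 : ℝ) < 1 from one_pos))

/-- The vertical shift z serves both half spaces: z = 0 for the open one, and z → 0 from above for
the closed one. -/
lemma HolderBound.space_holder {σ γ θ ν B : ℝ} {F : ℝ × (Fin (d + 1) → ℝ) → ℝ}
    (h : HolderBound σ γ θ ν F B) (hσ : 0 ≤ σ) (hσγ : σ < γ) (hγ : γ ≤ 1)
    {x y : EuclideanSpace ℝ (Fin (d + 1))} {t z : ℝ}
    (hx : 0 < x (Fin.last d) + z) (hy : 0 < y (Fin.last d) + z) :
    max (x (Fin.last d) + z) (y (Fin.last d) + z) ^ σ *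
      |F (x (Fin.last d) + z, (toCoord (x, t)).2) - F (y (Fin.last d) + z, (toCoord (y, t)).2)| ≤
      (2 * (2 / (γ - σ) + (d + 2))) * B * ‖x - y‖ ^ γ := by
  have hpos : 0 < γ - σ := by linarith
  have hB := h.nonneg
  have := weighted_space_holder h.diff hσ hσγ hγ hB h.space
    (P := (y (Fin.last d) + z, (toCoord (y, t)).2)) (Q := (x (Fin.last d) + z, (toCoord (x, t)).2))
    hy hx (by simp only [toCoord_time])
  rw [max_comm] at this
  refine this.trans ?_
  have hn : ‖((x (Fin.last d) + z, (toCoord (x, t)).2) : ℝ × (Fin (d + 1) → ℝ)) -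
      (y (Fin.last d) + z, (toCoord (y, t)).2)‖ ≤ ‖x - y‖ := by
    refine le_trans (le_of_eq ?_) (norm_toCoord_sub_le x y t)
    congr 1
    ext <;> simp [toCoord]
  have := Real.rpow_le_rpow (norm_nonneg _) hn (hσ.trans hσγ.le)
  gcongr

lemma HolderBound.time_holder {σ γ θ ν B β : ℝ} {F : ℝ × (Fin (d + 1) → ℝ) → ℝ}
    (h : HolderBound σ γ θ ν F B) (hθ : 0 < θ) (hθ1 : θ ≤ 1) (hν : θ ≤ ν) (hβ : θ / ν = β)
    {P : ℝ × (Fin (d + 1) → ℝ)} (hP : P ∈ upper d) (s : ℝ) :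
    |F (P + s • coordDir (some (Fin.last d))) - F P| ≤ (2 / θ + (d + 2)) * B * |s| ^ β := by
  rw [← hβ]
  exact WeightedHolder.time_holder h.diff hθ hθ1 hν h.nonneg h.normal h.time hP s

lemma HolderBound.holderNormOn_openQ_le {σ γ θ ν B : ℝ} {m : ℕ} {F : ℝ × (Fin (d + 1) → ℝ) → ℝ}
    (h : HolderBound σ γ θ ν F B) (hσ : 0 ≤ σ) (hσγ : σ < γ) (hγ : γ ≤ 1) (hθ : 0 < θ) (hθ1 : θ ≤ 1)
    (hν : θ ≤ ν) (hβ : θ / ν = γ / m) {f : SpaceTime (d + 1) → ℝ}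
    (hf : EqOn f (F ∘ toCoord) (openQ d)) :
    holderNormOn (openQ d) m σ γ f ≤ ENNReal.ofReal (holderConst d σ γ θ * B) := by
  have hB := h.nonneg
  have hpos : 0 < γ - σ := by linarith
  have e : holderConst d σ γ θ * B = B + (2 * (2 / (γ - σ) + (d + 2))) * B +
    (2 / θ + (d + 2)) * B := by rw [holderConst]; ring
  rw [e]
  refine holderNormOn_le hB (by positivity) (by positivity) (fun p hp => ?_)
    (fun x y t hx hy => ?_) (fun x t s hx hy => ?_)
  · rw [hf hp]; exact h.sup _ hp
  · rw [hf hx, hf hy]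
    have hx' : 0 < x (Fin.last d) := hx
    have hy' : 0 < y (Fin.last d) := hy
    have := h.space_holder hσ hσγ hγ (x := x) (y := y) (t := t) (z := 0) (by simpa) (by simpa)
    simp only [add_zero] at this
    exact this
  · rw [hf hx, hf hy, Function.comp, Function.comp, toCoord_change_time x t s]
    exact h.time_holder hθ hθ1 hν hβ hy _

/-- A bound in the upper half space passes to the closed half space by vertical limits. -/
lemma HolderBound.holderNormOn_closedQ_le {σ γ θ ν B : ℝ} {m : ℕ}
    {F : ℝ × (Fin (d + 1) → ℝ) → ℝ}
    (h : HolderBound σ γ θ ν F B) (hσ : 0 ≤ σ) (hσγ : σ < γ) (hγ : γ ≤ 1) (hθ : 0 < θ) (hθ1 : θ ≤ 1)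
    (hν : θ ≤ ν) (hβ : θ / ν = γ / m)
    {G : ℝ × (Fin (d + 1) → ℝ) → ℝ} (hG : EqOn F G (upper d))
    (hlim : ∀ P : ℝ × (Fin (d + 1) → ℝ), 0 ≤ P.1 →
      Tendsto (fun z => G (P.1 + z, P.2)) (𝓝[>] 0) (𝓝 (G P))) :
    holderNormOn (closedQ d) m σ γ (G ∘ toCoord) ≤ ENNReal.ofReal (holderConst d σ γ θ * B) := by
  have hB := h.nonneg
  have hpos : 0 < γ - σ := by linarith
  have hlim' : ∀ P : ℝ × (Fin (d + 1) → ℝ), 0 ≤ P.1 →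
      Tendsto (fun z => F (P.1 + z, P.2)) (𝓝[>] 0) (𝓝 (G P)) := by
    intro P hP
    refine (hlim P hP).congr' ?_
    filter_upwards [self_mem_nhdsWithin] with z hz
    exact (hG (show 0 < P.1 + z from add_pos_of_nonneg_of_pos hP hz)).symm
  have e : holderConst d σ γ θ * B = B + (2 * (2 / (γ - σ) + (d + 2))) * B +
    (2 / θ + (d + 2)) * B := by rw [holderConst]; ring
  rw [e]
  refine holderNormOn_le hB (by positivity) (by positivity) (fun p hp => ?_)
    (fun x y t hx hy => ?_) (fun x t s hx hy => ?_)
  · refine le_of_tendsto (hlim' (toCoord p) hp).abs ?_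
    filter_upwards [self_mem_nhdsWithin] with z hz
    exact h.sup _ (show 0 < _ + z from add_pos_of_nonneg_of_pos hp hz)
  · have hm : Tendsto (fun z : ℝ => max (x (Fin.last d) + z) (y (Fin.last d) + z) ^ σ) (𝓝[>] 0)
        (𝓝 (max (x (Fin.last d)) (y (Fin.last d)) ^ σ)) := by
      have hc : Continuous fun z : ℝ => max (x (Fin.last d) + z) (y (Fin.last d) + z) ^ σ :=
        Continuous.rpow_const (by fun_prop) fun _ => Or.inr hσ
      have := hc.tendsto 0
      simp only [add_zero] at this
      exact this.mono_left nhdsWithin_le_nhds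
    refine le_of_tendsto (hm.mul ((hlim' (toCoord (x, t)) hx).sub (hlim' (toCoord (y, t)) hy)).abs) ?_
    filter_upwards [self_mem_nhdsWithin] with z hz
    exact h.space_holder hσ hσγ hγ (add_pos_of_nonneg_of_pos hx hz) (add_pos_of_nonneg_of_pos hy hz)
  · refine le_of_tendsto ((hlim' (toCoord (x, t)) hx).sub (hlim' (toCoord (x, s)) hy)).abs ?_
    filter_upwards [self_mem_nhdsWithin] with z hz
    have := h.time_holder hθ hθ1 hν hβ (P := ((toCoord (x, s)).1 + z, (toCoord (x, s)).2))
      (show 0 < _ + z from add_pos_of_nonneg_of_pos hy hz) (t - s)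
    have e' : ((toCoord (x, s)).1 + z, (toCoord (x, s)).2) + (t - s) • coordDir (some (Fin.last d)) =
        ((toCoord (x, t)).1 + z, (toCoord (x, t)).2) := by
      rw [toCoord_change_time x t s]
      ext <;> simp [coordDir]
    rwa [e'] at this

/-! ### Quantities dominated by a norm -/

/-- `Φ` is bounded on `S` by a constant multiple of `N`. -/
def Dominated {T : Type*} (S : Set T) (N Φ : T → ℝ≥0∞) : Prop :=
  ∃ C : ℝ≥0, ∀ v ∈ S, Φ v ≤ C * N v

lemma Dominated.add {T : Type*} {S : Set T} {N Φ Ψ : T → ℝ≥0∞} (h : Dominated S N Φ)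
    (h' : Dominated S N Ψ) : Dominated S N fun v => Φ v + Ψ v := by
  obtain ⟨C, hC⟩ := h
  obtain ⟨C', hC'⟩ := h'
  refine ⟨C + C', fun v hv => ?_⟩
  rw [ENNReal.coe_add, add_mul]
  exact add_le_add (hC v hv) (hC' v hv)

lemma Dominated.sum {T ι : Type*} {S : Set T} {N : T → ℝ≥0∞} (s : Finset ι) {Φ : ι → T → ℝ≥0∞}
    (h : ∀ i ∈ s, Dominated S N (Φ i)) : Dominated S N fun v => ∑ i ∈ s, Φ i v := by
  classical
  induction s using Finset.induction_on with
  | empty => exact ⟨0, fun v _ => by simp⟩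
  | insert j s hj ih =>
    simp only [Finset.sum_insert hj]
    exact (h j (by simp)).add (ih fun i hi => h i (by simp [hi]))

end

section

/-! ### The extension operator -/

variable {d : ℕ}

/-- The anisotropic weights: `1` in space and `ν` in time. -/
def coordWeight (d : ℕ) (ν : ℝ) (i : Fin (d + 1)) : ℝ := if i = Fin.last d then ν else 1

/-- The extension of a function on `ℝ^d × ℝ` to the half space. -/
def extFun (μ : Fin (d + 1) → ℝ) (φ : Fin (d + 1) → ℝ → ℝ) (v : SpaceTime d → ℝ) :
    SpaceTime (d + 1) → ℝ :=
  fullExt μ φ (v ∘ ofCoord) ∘ toCoord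

/-- Continuous functions with compact support, in coordinates. -/
def bdrySpace (d : ℕ) : Submodule ℝ (SpaceTime d → ℝ) where
  carrier := {v | Continuous (v ∘ ofCoord) ∧ HasCompactSupport (v ∘ ofCoord)}
  zero_mem' := ⟨continuous_const, HasCompactSupport.zero⟩
  add_mem' h h' := ⟨h.1.add h'.1, h.2.add h'.2⟩
  smul_mem' c _ h := ⟨h.1.const_smul c, h.2.comp_left (g := fun x => c • x) (smul_zero c)⟩

/-- The extension as a linear operator. -/
def extLin (μ : Fin (d + 1) → ℝ) (φ : Fin (d + 1) → ℝ → ℝ) (hφ : ∀ i, IsTest (φ i)) :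
    bdrySpace d →ₗ[ℝ] (SpaceTime (d + 1) → ℝ) where
  toFun v := extFun μ φ v.1
  map_add' v w := by
    ext p
    simp only [extFun, fullExt, Function.comp, Submodule.coe_add, Pi.add_apply]
    split_ifs with h
    · simp only [upperExt, mollify, Function.comp, Pi.add_apply, add_mul]
      rw [← mul_add, ← integral_add]
      · exact integrable_mul_prodKer hφ v.2.1 v.2.2 _
      · exact integrable_mul_prodKer hφ w.2.1 w.2.2 _
    · rfl
  map_smul' c v := by
    ext p
    simp only [extFun, fullExt, Function.comp, Submodule.coe_smul, Pi.smul_apply, smul_eq_mul,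
      RingHom.id_apply]
    split_ifs with h
    · simp only [upperExt, mollify, Function.comp, Pi.smul_apply, smul_eq_mul, mul_assoc]
      rw [integral_const_mul, mul_left_comm]
    · rfl

/-- Boundary data supported in `B_R`. -/
def bdryData (d : ℕ) (a b R : ℝ) : Set (SpaceTime d → ℝ) :=
  {v | MemAniso a b v ∧ ∀ p, v p ≠ 0 → ‖p.1‖ ≤ R ∧ |p.2| ≤ R}

lemma abs_le_of_ofCoord {R : ℝ} {q : Fin (d + 1) → ℝ}
    (h : ‖(ofCoord q).1‖ ≤ R ∧ |(ofCoord q).2| ≤ R) (i : Fin (d + 1)) : |q i| ≤ R := by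
  refine Fin.lastCases ?_ (fun j => ?_) i
  · exact h.2
  · exact (PiLp.norm_apply_le (ofCoord q).1 j).trans h.1

lemma hasCompactSupport_of_mem_bdryData {a b R : ℝ} {v : SpaceTime d → ℝ}
    (hv : v ∈ bdryData d a b R) : HasCompactSupport (v ∘ ofCoord) := by
  refine HasCompactSupport.intro
    (isCompact_univ_pi fun _ : Fin (d + 1) => isCompact_Icc (a := -R) (b := R)) fun q hq => ?_
  by_contra h
  exact hq fun i _ => abs_le.1 (abs_le_of_ofCoord (hv.2 _ h) i)

lemma exists_coord_bound {μ : Fin (d + 1) → ℝ} {p : Fin (d + 1) → ℕ} {φ : Fin (d + 1) → ℝ → ℝ}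
    (hμ : ∀ i, 0 < μ i) (hφ : IsMollifier p φ) {R : ℝ} (hR : 0 < R) :
    ∃ R' : ℝ, ∀ V : (Fin (d + 1) → ℝ) → ℝ, (∀ q, V q ≠ 0 → ∀ i, |q i| ≤ R) →
      ∀ P : ℝ × (Fin (d + 1) → ℝ), 0 ≤ P.1 → fullExt μ φ V P ≠ 0 → ∀ c, |comp c P| ≤ R' := by
  obtain ⟨ρ, hρ0, hρ⟩ := exists_abs_le_of_prodKer_ne_zero (μ := μ) hφ.test
  have hsum : ∀ i, (2 : ℝ) ^ μ i ≤ ∑ j, (2 : ℝ) ^ μ j := fun i =>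
    Finset.single_le_sum (f := fun j => (2 : ℝ) ^ μ j) (fun j _ => by positivity)
      (Finset.mem_univ i)
  have hsum0 : 0 ≤ ∑ j, (2 : ℝ) ^ μ j := Finset.sum_nonneg fun j _ => by positivity
  have hρs := mul_nonneg hρ0.le hsum0
  -- The cut-off limits the height to 2, and there the kernel reaches at most ρ·2^{μ i} in the
  -- variable i; the sum serves all i at once.
  refine ⟨R + 2 + ρ * ∑ j, (2 : ℝ) ^ μ j, fun V hV P hP hne c => ?_⟩
  rcases hP.lt_or_eq with h0 | h0
  · rw [fullExt_eqOn (show P ∈ upper d from h0), upperExt] at hne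
    have hz : P.1 ≤ 2 := by
      by_contra h
      exact hne (by rw [cutoff_of_ge (not_le.1 h).le, zero_mul])
    obtain ⟨q, hq⟩ : ∃ q, V q * prodKer μ φ P.1 (P.2 - q) ≠ 0 := by
      by_contra h
      push Not at h
      exact hne (by simp [mollify, h])
    rcases c with _ | i
    · change |P.1| ≤ _
      rw [abs_of_pos h0]
      linarith
    · have h1 := hV q (left_ne_zero_of_mul hq) i
      have h2 := hρ _ h0 _ (right_ne_zero_of_mul hq) i
      have h3 : ρ * P.1 ^ μ i ≤ ρ * ∑ j, (2 : ℝ) ^ μ j := by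
        gcongr
        exact (Real.rpow_le_rpow hP hz (hμ i).le).trans (hsum i)
      change |P.2 i| ≤ _
      rw [Pi.sub_apply] at h2
      rw [abs_le] at *
      constructor <;> linarith [h1.1, h1.2, h2.1, h2.2]
  · rw [fullExt_of_nonpos h0.symm.le] at hne
    rcases c with _ | i
    · change |P.1| ≤ _
      rw [← h0, abs_zero]
      linarith
    · have := hV _ hne i
      change |P.2 i| ≤ _
      linarith

lemma exists_compact_support {μ : Fin (d + 1) → ℝ} {p : Fin (d + 1) → ℕ}
    {φ : Fin (d + 1) → ℝ → ℝ} (hμ : ∀ i, 0 < μ i) (hφ : IsMollifier p φ) {a b R : ℝ} (hR : 0 < R) :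
    ∃ K : Set (SpaceTime (d + 1)), IsCompact K ∧ ∀ v ∈ bdryData d a b R,
      ∀ x ∈ closedQ d, x ∉ K → extFun μ φ v x = 0 := by
  obtain ⟨R', hR'⟩ := exists_coord_bound hμ hφ hR
  refine ⟨Metric.closedBall 0 (Real.sqrt (∑ _i : Fin (d + 1), R' ^ 2)) ×ˢ Metric.closedBall 0 R',
    (isCompact_closedBall _ _).prod (isCompact_closedBall _ _), fun v hv x hx hxK => ?_⟩
  by_contra h
  have hc := hR' (v ∘ ofCoord) (fun q hq => abs_le_of_ofCoord (hv.2 _ hq)) (toCoord x) hx h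
  refine hxK ⟨?_, ?_⟩
  · rw [mem_closedBall_zero_iff, EuclideanSpace.norm_eq]
    refine Real.sqrt_le_sqrt (Finset.sum_le_sum fun i _ => ?_)
    have hi : |x.1 i| ≤ R' := by
      refine Fin.lastCases ?_ (fun j => ?_) i
      · exact hc none
      · simpa [comp, toCoord] using hc (some j.castSucc)
    rw [Real.norm_eq_abs]
    gcongr
  · rw [mem_closedBall_zero_iff, Real.norm_eq_abs]
    simpa [comp, toCoord] using hc (some (Fin.last d))

/-! ### Terms of the weighted norm are dominated by the anisotropic norm -/

section norms

variable {a b R ν : ℝ} {φ : Fin (d + 1) → ℝ → ℝ}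

lemma extFun_eqOn {μ : Fin (d + 1) → ℝ} {v : SpaceTime d → ℝ} :
    EqOn (extFun μ φ v) (upperExt μ φ (v ∘ ofCoord) ∘ toCoord) (openQ d) :=
  fun _ hp => fullExt_eqOn hp

lemma coordWeight_pos (hν : 0 < ν) (i : Fin (d + 1)) : 0 < coordWeight d ν i := by
  unfold coordWeight; split_ifs <;> simp [hν]

lemma coordWeight_last : coordWeight d ν (Fin.last d) = ν := if_pos rfl

lemma coordWeight_of_ne (i : Fin (d + 1)) (hi : i ≠ Fin.last d) : coordWeight d ν i = 1 := if_neg hi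

lemma bdryExp_nonneg (ha : 0 ≤ a) (hb : 0 ≤ b) (i : Fin (d + 1)) : 0 ≤ bdryExp d a b i := by
  unfold bdryExp; split_ifs <;> simp [Nat.floor_le, ha, hb]

lemma coordWeight_mul (hab : ν * b = a) (i : Fin (d + 1)) :
    coordWeight d ν i * (bdryOrder d a b i + bdryExp d a b i) = a := by
  unfold coordWeight bdryOrder bdryExp
  split_ifs
  · rw [← hab]; ring
  · ring

lemma exists_isMollifier (p : Fin (d + 1) → ℕ) : ∃ φ, IsMollifier p φ := by
  choose φ h1 h2 h3 using fun i => exists_mollifier (p i)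
  exact ⟨φ, h1, h2, h3⟩

lemma ofReal_mul_toReal {c : ℝ} (hc : 0 ≤ c) {N : ℝ≥0∞} (hN : N ≠ ⊤) :
    ENNReal.ofReal (c * N.toReal) = (c.toNNReal : ℝ≥0∞) * N := by
  rw [ENNReal.ofReal_mul hc, ENNReal.ofReal_toReal hN]; rfl

lemma dominated_of_bound {Φ : (SpaceTime d → ℝ) → ℝ≥0∞} {C : ℝ} (hC : 0 ≤ C)
    (h : ∀ v ∈ bdryData d a b R,
      Controlled (bdryOrder d a b) (bdryExp d a b) (v ∘ ofCoord) (anisoNorm a b v).toReal →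
      Φ v ≤ ENNReal.ofReal (C * (anisoNorm a b v).toReal)) :
    Dominated (bdryData d a b R) (anisoNorm a b) Φ :=
  ⟨C.toNNReal, fun v hv => (h v hv
    (controlled_of_memAniso hv.1 (hasCompactSupport_of_mem_bdryData hv))).trans_eq
    (ofReal_mul_toReal hC hv.1.norm_lt_top.ne)⟩

lemma dominated_holderNormOn_openQ {σ γ θ : ℝ} {m : ℕ} (hσ : 0 ≤ σ) (hσγ : σ < γ) (hγ : γ ≤ 1)
    (hθ : 0 < θ) (hθ1 : θ ≤ 1) (hν : θ ≤ ν) (hβ : θ / ν = γ / m)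
    {F : ((Fin (d + 1) → ℝ) → ℝ) → ℝ × (Fin (d + 1) → ℝ) → ℝ}
    (hF : ∃ C : ℝ, 0 ≤ C ∧ ∀ V A, Controlled (bdryOrder d a b) (bdryExp d a b) V A →
      HolderBound σ γ θ ν (F V) (C * A))
    {f : (SpaceTime d → ℝ) → SpaceTime (d + 1) → ℝ}
    (hf : ∀ v, EqOn (f v) (F (v ∘ ofCoord) ∘ toCoord) (openQ d)) :
    Dominated (bdryData d a b R) (anisoNorm a b) fun v => holderNormOn (openQ d) m σ γ (f v) := by
  obtain ⟨C, hC0, hC⟩ := hF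
  refine dominated_of_bound (C := holderConst d σ γ θ * C)
    (mul_nonneg (holderConst_nonneg hσγ hθ) hC0) fun v _ hc => ?_
  rw [mul_assoc]
  exact (hC _ _ hc).holderNormOn_openQ_le hσ hσγ hγ hθ hθ1 hν hβ (hf v)

lemma dominated_supNorm (hν : 0 < ν) (ha : 0 < a) (hb : 0 ≤ b) (hab : ν * b = a)
    (hφ : IsMollifier (bdryOrder d a b) φ) :
    Dominated (bdryData d a b R) (anisoNorm a b) fun v =>
      supNormOn (closedQ d) (extFun (coordWeight d ν) φ v) := by
  obtain ⟨C, hC0, hC⟩ := exists_sup_bound_listDeriv (coordWeight_pos hν) (bdryExp_nonneg ha.le hb)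
    (coordWeight_mul hab) hφ [] (by simpa [ord] using ha)
  refine dominated_of_bound (C := C + 1) (by positivity) fun v _ hc => ?_
  refine iSup₂_le fun p hp => ?_
  rw [← ofReal_norm]
  refine ENNReal.ofReal_le_ofReal ?_
  have hA := hc.nonneg
  rcases (show 0 ≤ (toCoord p).1 from hp).lt_or_eq with h0 | h0
  · rw [extFun_eqOn (show p ∈ openQ d from h0)]
    refine (hC _ _ hc (toCoord p) h0).trans ?_
    gcongr
    linarith
  · rw [extFun, Function.comp, fullExt_of_nonpos h0.symm.le]
    refine (hc.bdd _).trans ?_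
    nlinarith

lemma differentiable_time {V : (Fin (d + 1) → ℝ) → ℝ} {A : ℝ} (hb : 1 ≤ b)
    (hc : Controlled (bdryOrder d a b) (bdryExp d a b) V A) (q : Fin (d + 1) → ℝ) :
    DifferentiableAt ℝ (fun s : ℝ => V (q + s • Pi.single (Fin.last d) 1)) 0 := by
  have h1 := hc.smooth (Fin.last d) q
  have h2 : bdryOrder d a b (Fin.last d) ≠ 0 := by
    simp only [bdryOrder, if_true]
    exact (Nat.floor_pos.2 hb).ne'
  have h3 := h1.differentiable (by exact_mod_cast h2)
  have h4 : (fun s : ℝ => V (q + s • Pi.single (Fin.last d) 1)) =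
      (fun r => V (Function.update q (Fin.last d) r)) ∘ fun s => q (Fin.last d) + s := by
    ext s
    simp only [Function.comp]
    congr 1; ext i
    by_cases hi : i = Fin.last d
    · subst hi; simp
    · simp [hi]
  rw [h4]
  exact (h3.comp (by fun_prop)) 0

/-- At boundary points a line in the time direction stays in the boundary, so differentiability is
that of the datum. -/
lemma lineDifferentiableAt_extFun (hν : 0 < ν) (hb : 1 ≤ b) (hφ : IsMollifier (bdryOrder d a b) φ)
    {v : SpaceTime d → ℝ} {A : ℝ}
    (hc : Controlled (bdryOrder d a b) (bdryExp d a b) (v ∘ ofCoord) A)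
    {p : SpaceTime (d + 1)} (hp : p ∈ closedQ d) :
    LineDifferentiableAt ℝ (extFun (coordWeight d ν) φ v) p timeDir := by
  have e : ∀ s : ℝ, extFun (coordWeight d ν) φ v (p + s • timeDir) =
      fullExt (coordWeight d ν) φ (v ∘ ofCoord) (toCoord p + s • coordDir (some (Fin.last d))) :=
    fun s => by rw [extFun, Function.comp, toCoord_add_timeDir]
  rw [LineDifferentiableAt]
  simp only [e]
  rcases (show 0 ≤ (toCoord p).1 from hp).lt_or_eq with h0 | h0
  · have hP : toCoord p ∈ upper d := h0
    have h1 : DifferentiableAt ℝ (fullExt (coordWeight d ν) φ (v ∘ ofCoord)) (toCoord p) :=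
      differentiableAt_upper ((contDiffOn_upperExt (coordWeight_pos hν) hφ hc.continuous).congr
        fullExt_eqOn) hP
    exact h1.lineDifferentiableAt
  · have h1 := differentiable_time hb hc (toCoord p).2
    refine h1.congr_of_eventuallyEq (Eventually.of_forall fun s => ?_)
    beta_reduce
    rw [fullExt_of_nonpos (by simp [coordDir, ← h0])]
    simp [coordDir]

/-- The time derivative has anisotropic order exactly ν, leaving θ. This norm includes boundary
points, so interior bounds must be carried to the limit by `tendsto_coordDeriv_fullExt`. -/
lemma dominated_timeDeriv {σ γ θ : ℝ} {m : ℕ} (hσ : 0 ≤ σ) (hγ0 : 0 < γ) (hm : 0 < m) (hγ : γ ≤ 1)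
    (hθ : 0 < θ) (hθ1 : θ < 1) (hν : θ < ν) (hβ : θ / ν = γ / m) (hσθ : γ - σ = θ)
    (hb : 1 ≤ b) (hab : ν * b = a) (haν : a = ν + θ) (hφ : IsMollifier (bdryOrder d a b) φ) :
    Dominated (bdryData d a b R) (anisoNorm a b) fun v =>
      holderNormOn (closedQ d) m σ γ (dirDeriv timeDir (extFun (coordWeight d ν) φ v)) := by
  have hν0 : 0 < ν := hθ.trans hν
  have ha0 : 0 ≤ a := by linarith
  have hord : ord (coordWeight d ν) [some (Fin.last d)] = ν := by
    simp [ord, wt, coordWeight_last]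
  obtain ⟨C, hC0, hC⟩ := exists_holderBound_listDeriv (σ := σ) (γ := γ) (θ := θ)
    (coordWeight_pos hν0) coordWeight_of_ne (bdryExp_nonneg ha0 (by linarith)) (coordWeight_mul hab)
    hφ [some (Fin.last d)] hθ hθ1 (by rwa [coordWeight_last]) (by rwa [coordWeight_last])
    (by rw [hord, coordWeight_last]) (by linarith) (by rw [hord]; linarith)
  rw [coordWeight_last] at hC
  have hσγ : σ < γ := by linarith
  refine dominated_of_bound (C := holderConst d σ γ θ * C)
    (mul_nonneg (holderConst_nonneg hσγ hθ) hC0) fun v _ hc => ?_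
  rw [mul_assoc, extFun, dirDeriv_timeDir_comp]
  refine (hC _ _ hc).holderNormOn_closedQ_le hσ hσγ hγ hθ hθ1.le hν.le hβ
    (fun P hP => (coordDeriv_congr isOpen_upper fullExt_eqOn hP).symm) fun P hP => ?_
  refine tendsto_coordDeriv_fullExt (coordWeight_pos hν0) hφ hc.continuous hc.supp
    (β := γ / m) (C := (2 / θ + (d + 2)) * (C * (anisoNorm a b v).toReal)) (by positivity)
    (fun Q hQ s => ?_) hP (differentiable_time hb hc _)
  exact (hC _ _ hc).time_holder hθ hθ1.le hν.le hβ hQ s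

end norms

/-- The weight σ affects only the derivatives of order k < m - n, so one statement gives both
estimates of the theorem; `hk` is the only condition linking σ to the order. -/
lemma dominated_weightedNorm {m : ℕ} {n γ θ σ a b R : ℝ} {φ : Fin (d + 1) → ℝ → ℝ} (hm : 0 < m)
    (hn : 0 < n) (hγ0 : 0 < γ) (hγ : γ < 1) (hθ : 0 < θ) (hθν : θ < m - n)
    (hβ : θ / (m - n) = γ / m) (hσθ : γ - n / m * γ = θ) (hb : 1 ≤ b) (hab : (m - n) * b = a)
    (haν : a = m - n + θ) (hφ : IsMollifier (bdryOrder d a b) φ)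
    (hκ : ∀ j : ℕ, (j : ℝ) < n → θ < n - j) (hσ : 0 ≤ σ) (hσγ : σ < γ)
    (hk : ∀ k : ℕ, (k : ℝ) < m - n → γ - σ ≤ a - k) :
    Dominated (bdryData d a b R) (anisoNorm a b) fun v =>
      weightedNorm m n γ σ (extFun (coordWeight d (m - n)) φ v) := by
  have hω0 : 0 ≤ n / m * γ := by positivity
  have hθ1 : θ < 1 := by linarith
  have hν0 : 0 < (m : ℝ) - n := hθ.trans hθν
  have ha0 : 0 < a := by linarith
  have hb0 : 0 ≤ b := by linarith
  have hμ := coordWeight_pos (d := d) hν0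
  have hlast : coordWeight d ((m : ℝ) - n) (Fin.last d) = m - n := coordWeight_last
  have hone := coordWeight_of_ne (d := d) (ν := (m : ℝ) - n)
  have hmd : ∀ α : Fin (d + 1) → ℕ, ∃ L : List (Option (Fin (d + 1))),
      ord (coordWeight d ((m : ℝ) - n)) L = (∑ i, α i : ℕ) ∧ ∀ v : SpaceTime d → ℝ,
        EqOn (multiDeriv α (extFun (coordWeight d ((m : ℝ) - n)) φ v))
          (listDeriv L (upperExt (coordWeight d ((m : ℝ) - n)) φ (v ∘ ofCoord)) ∘ toCoord)
          (openQ d) := by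
    intro α
    obtain ⟨L, hL, hf⟩ := exists_list_multiDeriv α
    refine ⟨L.map spaceIdx, by rw [ord_map_spaceIdx hone, hL], fun v => ?_⟩
    rw [hf, ← foldr_dirDeriv_comp]
    exact foldr_dirDeriv_congr extFun_eqOn L
  refine (((dominated_supNorm hν0 ha0 hb0 hab hφ).add ?_).add ?_).add
    (dominated_timeDeriv hω0 hγ0 hm hγ.le hθ hθ1 hθν hβ hσθ hb hab haν hφ)
  · refine Dominated.sum _ fun k hk' => Dominated.sum _ fun α hα => ?_
    obtain ⟨-, hk0, hkν⟩ := Finset.mem_filter.1 hk'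
    obtain ⟨L, hL, hLf⟩ := hmd α
    rw [(Finset.mem_piAntidiag.1 hα).1] at hL
    have key := exists_holderBound_listDeriv (σ := σ) (γ := γ) (θ := θ) hμ hone
      (bdryExp_nonneg ha0.le hb0) (coordWeight_mul hab) hφ L hθ hθ1 (by rwa [hlast])
      (by rwa [hlast]) (by rw [hlast, hL]; exact hkν.le) (by linarith) (by rw [hL]; exact hk k hkν)
    rw [hlast] at key
    exact dominated_holderNormOn_openQ hσ hσγ hγ.le hθ hθ1.le hθν.le hβ key hLf
  · refine Dominated.sum _ fun j hj => Dominated.sum _ fun α hα => ?_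
    have hjn : (j : ℝ) ≤ n :=
      (Nat.le_floor_iff hn.le).1 (Nat.lt_succ_iff.1 (Finset.mem_range.1 hj))
    have hjm : j ≤ m := by
      have : (j : ℝ) ≤ m := by linarith
      exact_mod_cast this
    obtain ⟨L, hL, hLf⟩ := hmd α
    rw [(Finset.mem_piAntidiag.1 (Finset.mem_filter.1 hα).1).1, Nat.cast_sub hjm] at hL
    have key : ∃ C : ℝ, 0 ≤ C ∧ ∀ V A, Controlled (bdryOrder d a b) (bdryExp d a b) V A →
        HolderBound (n / m * γ) γ θ ((m : ℝ) - n)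
          (fun P => P.1 ^ (n - j) * listDeriv L (upperExt (coordWeight d ((m : ℝ) - n)) φ V) P)
          (C * A) := by
      -- For j < n the order m - j exceeds ν by κ = n - j. For j = n, possible only for integer n,
      -- the weight is 1 and the order is exactly ν.
      rcases hjn.lt_or_eq with hlt | heq
      · have := exists_holderBound_rpow_mul_listDeriv (σ := n / m * γ) (γ := γ) (θ := θ)
          (κ := n - j) hμ hone (bdryExp_nonneg ha0.le hb0) (coordWeight_mul hab) hφ L hθ hθ1
          (by rwa [hlast]) (by rwa [hlast]) (hκ j hlt) (by rw [hlast, hL]; ring) hσθ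
        rwa [hlast] at this
      · have := exists_holderBound_listDeriv (σ := n / m * γ) (γ := γ) (θ := θ) hμ hone
          (bdryExp_nonneg ha0.le hb0) (coordWeight_mul hab) hφ L hθ hθ1 (by rwa [hlast])
          (by rwa [hlast]) (by rw [hlast, hL, heq]) (by linarith) (by rw [hL]; linarith)
        rw [hlast] at this
        simpa only [heq, sub_self, Real.rpow_zero, one_mul] using this
    refine dominated_holderNormOn_openQ hω0 (by linarith) hγ.le hθ hθ1.le hθν.le hβ key
      fun v p hp => ?_
    simp only [Function.comp, hLf v hp]
    rfl

lemma memWeighted_extFun {m : ℕ} {n γ ν a b R : ℝ} {φ : Fin (d + 1) → ℝ → ℝ} (hν : 0 < ν)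
    (hb : 1 ≤ b) (hφ : IsMollifier (bdryOrder d a b) φ) {v : SpaceTime d → ℝ}
    (hv : v ∈ bdryData d a b R)
    (hN : weightedNorm m n γ (n / m * γ) (extFun (coordWeight d ν) φ v) < ⊤) :
    MemWeighted m n γ (extFun (coordWeight d ν) φ v) := by
  have hc := controlled_of_memAniso hv.1 (hasCompactSupport_of_mem_bdryData hv)
  refine ⟨?_, fun t => ?_, fun p hp => lineDifferentiableAt_extFun hν hb hφ hc hp, hN⟩
  · exact (continuousOn_fullExt (coordWeight_pos hν) hφ hc.continuous hc.supp).comp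
      contDiff_toCoord.continuous.continuousOn fun p hp => hp
  · have h1 : ContDiffOn ℝ ∞ (fun x : EuclideanSpace ℝ (Fin (d + 1)) =>
        upperExt (coordWeight d ν) φ (v ∘ ofCoord) (toCoord (x, t))) {x | 0 < x (Fin.last d)} :=
      (contDiffOn_upperExt (coordWeight_pos hν) hφ hc.continuous).comp
        (contDiff_toCoord.comp (contDiff_id.prodMk contDiff_const)).contDiffOn fun x hx => hx
    refine (h1.congr fun x hx => ?_).of_le (by exact_mod_cast le_top)
    exact extFun_eqOn (show (x, t) ∈ openQ d from hx)

/-! ### Arithmetic of the fractional part -/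

lemma lt_sub_of_fract {n θ : ℝ} (hn : 0 < n) (hθ1 : θ < 1)
    (h : Int.fract n ≠ 0 → θ < Int.fract n) (j : ℕ) (hj : (j : ℝ) < n) : θ < n - j := by
  have hfl : ((⌊n⌋₊ : ℕ) : ℝ) + Int.fract n = n := by
    rw [Int.fract, natCast_floor_eq_intCast_floor hn.le]; ring
  by_cases h0 : Int.fract n = 0
  · rw [h0, add_zero] at hfl
    have : j + 1 ≤ ⌊n⌋₊ := by
      have : (j : ℝ) < (⌊n⌋₊ : ℕ) := by linarith
      exact_mod_cast this
    have : (j : ℝ) + 1 ≤ (⌊n⌋₊ : ℕ) := by exact_mod_cast this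
    linarith
  · have : j ≤ ⌊n⌋₊ := Nat.le_floor hj.le
    have : (j : ℝ) ≤ (⌊n⌋₊ : ℕ) := by exact_mod_cast this
    linarith [h h0]

/-- The integer m - k - ⌊n⌋ is positive, hence at least 1. -/
lemma one_sub_fract_le {n : ℝ} {m k : ℕ} (hk : (k : ℝ) < m - n) : 1 - Int.fract n ≤ m - n - k := by
  have h1 : (⌊n⌋ : ℝ) + Int.fract n = n := Int.floor_add_fract n
  have h2 : (k : ℤ) + ⌊n⌋ < m := by
    have : (k : ℝ) + ⌊n⌋ < m := by linarith [Int.fract_nonneg n]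
    exact_mod_cast this
  have h3 : (k : ℝ) + ⌊n⌋ + 1 ≤ m := by exact_mod_cast h2
  linarith

end

end WeightedHolder

end

theorem mainTheorem2 (d m : ℕ) (n γ R : ℝ) (hn : 0 < n) (hnm : n < m)
    (hγ0 : 0 < γ) (hγ1 : γ < 1)
    (hfract : Int.fract n ≠ 0 → (1 - n / m) * γ < min (Int.fract n) (1 - Int.fract n))
    (hR : 0 < R) :
    ∃ (E : (WeightedHolder.SpaceTime d → ℝ) →ₗ[ℝ] (WeightedHolder.SpaceTime (d + 1) → ℝ))
      (C : NNReal),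
      ∀ v : WeightedHolder.SpaceTime d → ℝ,
        WeightedHolder.MemAniso (m - n + (1 - n / m) * γ) (1 + γ / m) v →
        (∀ p, v p ≠ 0 → ‖p.1‖ ≤ R ∧ |p.2| ≤ R) →
        WeightedHolder.MemWeighted m n γ (E v) ∧
        (∃ K : Set (WeightedHolder.SpaceTime (d + 1)), IsCompact K ∧
          ∀ p ∈ WeightedHolder.closedQ d, p ∉ K → E v p = 0) ∧
        (∀ (x : EuclideanSpace ℝ (Fin (d + 1))) (t : ℝ), x (Fin.last d) = 0 →
          E v (x, t) = v (WeightedHolder.tangential x, t)) ∧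
        WeightedHolder.weightedNorm m n γ (n / m * γ) (E v) ≤
          C * WeightedHolder.anisoNorm (m - n + (1 - n / m) * γ) (1 + γ / m) v ∧
        (n / m * γ ≤ 1 - Int.fract n →
          WeightedHolder.weightedNorm m n γ 0 (E v) ≤
            C * WeightedHolder.anisoNorm (m - n + (1 - n / m) * γ) (1 + γ / m) v) := by
  have hm0 : (0 : ℝ) < m := hn.trans hnm
  have hm : 0 < m := by exact_mod_cast hm0
  have hm1 : (1 : ℝ) ≤ m := by exact_mod_cast hm
  have hν : 0 < (m : ℝ) - n := sub_pos.2 hnm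
  set θ : ℝ := (1 - n / m) * γ with hθdef
  have hω : n / m < 1 := (div_lt_one hm0).2 hnm
  have hω0 : 0 < n / m := div_pos hn hm0
  have hθ : 0 < θ := mul_pos (by linarith) hγ0
  have hθm : θ = (m - n) * (γ / m) := by rw [hθdef]; field_simp
  have hγm : γ / m < 1 := (div_lt_one hm0).2 (by linarith)
  have hγm0 : 0 < γ / m := div_pos hγ0 hm0
  have hθν : θ < m - n := by rw [hθm]; exact mul_lt_of_lt_one_right hν hγm
  have hβ : θ / (m - n) = γ / m := by rw [hθm]; field_simp
  have hσθ : γ - n / m * γ = θ := by rw [hθdef]; ring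
  have hθ1 : θ < 1 := by nlinarith
  have hab : (m - n) * (1 + γ / m) = m - n + θ := by rw [hθm]; ring
  have hb : 1 ≤ 1 + γ / m := by linarith
  have hκ := WeightedHolder.lt_sub_of_fract hn hθ1
    (fun h => (hfract h).trans_le (min_le_left _ _))
  obtain ⟨φ, hφ⟩ := WeightedHolder.exists_isMollifier
    (WeightedHolder.bdryOrder d (m - n + θ) (1 + γ / m))
  have hμ := WeightedHolder.coordWeight_pos (d := d) hν
  obtain ⟨K, hK, hKsupp⟩ := WeightedHolder.exists_compact_support hμ hφ
    (a := m - n + θ) (b := 1 + γ / m) hR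
  -- The integral formula is linear on continuous data with compact support; outside that subspace
  -- any linear extension will do.
  obtain ⟨E, hE⟩ := LinearMap.exists_extend
    (WeightedHolder.extLin (WeightedHolder.coordWeight d (m - n)) φ hφ.test)
  have hEv : ∀ v ∈ WeightedHolder.bdryData d (m - n + θ) (1 + γ / m) R,
      E v = WeightedHolder.extFun (WeightedHolder.coordWeight d (m - n)) φ v := by
    intro v hv
    exact LinearMap.congr_fun hE ⟨v, hv.1.continuous.comp WeightedHolder.continuous_ofCoord,
      WeightedHolder.hasCompactSupport_of_mem_bdryData hv⟩
  obtain ⟨C₁, hC₁⟩ := WeightedHolder.dominated_weightedNorm (R := R) (σ := n / m * γ) hm hn hγ0 hγ1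
    hθ hθν hβ hσθ hb hab rfl hφ hκ (by positivity) (by linarith) (fun k hk => by linarith)
  -- The constant is chosen before the condition on ωγ is assumed, so the condition is decided here.
  obtain ⟨C₂, hC₂⟩ : ∃ C : NNReal, n / m * γ ≤ 1 - Int.fract n →
      ∀ v ∈ WeightedHolder.bdryData d (m - n + θ) (1 + γ / m) R,
        WeightedHolder.weightedNorm m n γ 0
          (WeightedHolder.extFun (WeightedHolder.coordWeight d (m - n)) φ v) ≤
          C * WeightedHolder.anisoNorm (m - n + θ) (1 + γ / m) v := by
    by_cases h : n / m * γ ≤ 1 - Int.fract n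
    · obtain ⟨C, hC⟩ := WeightedHolder.dominated_weightedNorm (R := R) (σ := 0) hm hn hγ0 hγ1
        hθ hθν hβ hσθ hb hab rfl hφ hκ le_rfl hγ0
        -- For σ = 0 the requirement γ ≤ m - n + θ - k reads ωγ ≤ m - n - k.
        (fun k hk => by linarith [WeightedHolder.one_sub_fract_le hk])
      exact ⟨C, fun _ => hC⟩
    · exact ⟨0, fun h' => (h h').elim⟩
  refine ⟨E, C₁ + C₂, fun v hv hsupp => ?_⟩
  have hvS : v ∈ WeightedHolder.bdryData d (m - n + θ) (1 + γ / m) R := ⟨hv, hsupp⟩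
  rw [hEv v hvS]
  have h1 := hC₁ v hvS
  refine ⟨WeightedHolder.memWeighted_extFun hν hb hφ hvS (h1.trans_lt ?_),
    ⟨K, hK, hKsupp v hvS⟩, fun x t hx => ?_, h1.trans ?_, fun h => (hC₂ h v hvS).trans ?_⟩
  · exact ENNReal.mul_lt_top ENNReal.coe_lt_top hv.norm_lt_top
  · have h0 : (WeightedHolder.toCoord (x, t)).1 ≤ 0 := le_of_eq hx
    rw [WeightedHolder.extFun, Function.comp, WeightedHolder.fullExt_of_nonpos h0, Function.comp,
      WeightedHolder.ofCoord_toCoord]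
  · gcongr
    exact_mod_cast le_self_add
  · gcongr
    exact_mod_cast le_add_self
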